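/- Let $d\ge 2$, $0<s<\frac d2$ and $\frac{2d}{d+2s}<q<\frac{d}{2s}$. All functions below are real-valued except Fourier transforms, and $\mathscr F[\varphi](\xi)=(2\pi)^{-d/2}\int_{\mathbb R^d}e^{-ix\cdot\xi}\varphi(x)\,dx$, extended to tempered distributions. Let $\mathring H^s(\mathbb R^d)$ be the space of all $u\in L^{\frac{2d}{d-2s}}(\mathbb R^d)$ whose Fourier transform is a locally integrable function with $$\|u\|_{\mathring H^s}^2:=\int_{\mathbb R^d}|\xi|^{2s}|\mathscr F[u](\xi)|^2\,d\xi<\infty,$$ and let $\mathring H^{-s}(\mathbb R^d)$ be its dual space with the dual norm. For $0<\alpha<d$ let $$I_\alpha(x)=A_\alpha|x|^{\alpha-d},\qquad A_\alpha=\frac{\Gamma((d-\alpha)/2)}{\pi^{d/2}\,2^\alpha\,\Gamma(\alpha/2)} .$$ Let $T\in\mathring H^{-s}(\mathbb R^d)\cap L^q(\mathbb R^d)$, that is, $T\in L^q(\mathbb R^d)$ and $T$ is identified with a continuous linear functional on $\mathring H^s(\mathbb R^d)$ satisfying $\langle T,\varphi\rangle=\int_{\mathbb R^d}T(x)\varphi(x)\,dx$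 for all $\varphi\in C_c^\infty(\mathbb R^d)$. Suppose that there is $f\in L^1(\mathbb R^d)$ with $T\cdot(I_{2s}*T)\ge-|f|$ almost everywhere. Then the integral defining $(I_{2s}*T)(x)$ converges absolutely for almost every $x$, the function $(I_{2s}*T)\,T$ belongs to $L^1(\mathbb R^d)$, and $$\|T\|^2_{\mathring H^{-s}(\mathbb R^d)}=\mathcal D_{2s}(T,T):=\int_{\mathbb R^d}(I_{2s}*T)(x)\,T(x)\,dx .$$ -/

import Mathlib

open MeasureTheory SchwartzMap
open scoped ENNReal ContDiff Convolution

/-- The Fourier transform in the unitary normalization,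
`F[φ](ξ) = (2π)^(-d/2) ∫ exp(-i x·ξ) φ(x) dx`. -/
noncomputable def unitaryFourier {d : ℕ} (φ : EuclideanSpace ℝ (Fin d) → ℂ)
    (ξ : EuclideanSpace ℝ (Fin d)) : ℂ :=
  (((2 * Real.pi) ^ (-(d : ℝ) / 2) : ℝ) : ℂ) *
    ∫ x, Complex.exp (-((inner ℝ x ξ : ℝ) : ℂ) * Complex.I) * φ x

/-- The Fourier transform, in the sense of tempered distributions, of the function `u` is the
locally integrable function `g`: `⟨g, φ⟩ = ⟨u, F[φ]⟩` for all Schwartz functions `φ`, where both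
pairings are absolutely convergent integrals. -/
def HasFourierTransform {d : ℕ} (u : EuclideanSpace ℝ (Fin d) → ℝ)
    (g : EuclideanSpace ℝ (Fin d) → ℂ) : Prop :=
  LocallyIntegrable g volume ∧
    ∀ φ : 𝓢(EuclideanSpace ℝ (Fin d), ℂ),
      Integrable (fun ξ => g ξ * φ ξ) volume ∧
      Integrable (fun x => (u x : ℂ) * unitaryFourier φ x) volume ∧
      ∫ ξ, g ξ * φ ξ = ∫ x, (u x : ℂ) * unitaryFourier φ x

theorem HasFourierTransform.congr {d : ℕ} {u v : EuclideanSpace ℝ (Fin d) → ℝ}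
    {g : EuclideanSpace ℝ (Fin d) → ℂ} (h : HasFourierTransform u g)
    (huv : u =ᵐ[volume] v) : HasFourierTransform v g := by
  refine ⟨h.1, fun φ => ?_⟩
  obtain ⟨h1, h2, h3⟩ := h.2 φ
  have e : (fun x => (u x : ℂ) * unitaryFourier φ x) =ᵐ[volume]
      fun x => (v x : ℂ) * unitaryFourier φ x := by
    filter_upwards [huv] with x hx
    rw [hx]
  exact ⟨h1, h2.congr e, h3.trans (integral_congr_ae e)⟩

theorem HasFourierTransform.add {d : ℕ} {u v : EuclideanSpace ℝ (Fin d) → ℝ}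
    {g h : EuclideanSpace ℝ (Fin d) → ℂ} (hu : HasFourierTransform u g)
    (hv : HasFourierTransform v h) : HasFourierTransform (u + v) (g + h) := by
  refine ⟨hu.1.add hv.1, fun φ => ?_⟩
  obtain ⟨a1, a2, a3⟩ := hu.2 φ
  obtain ⟨b1, b2, b3⟩ := hv.2 φ
  simp only [Pi.add_apply, Complex.ofReal_add, add_mul]
  exact ⟨a1.add b1, a2.add b2, by rw [integral_add a1 b1, integral_add a2 b2, a3, b3]⟩

theorem HasFourierTransform.smul {d : ℕ} {u : EuclideanSpace ℝ (Fin d) → ℝ}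
    {g : EuclideanSpace ℝ (Fin d) → ℂ} (c : ℝ) (hu : HasFourierTransform u g) :
    HasFourierTransform (c • u) (c • g) := by
  refine ⟨hu.1.smul c, fun φ => ?_⟩
  obtain ⟨a1, a2, a3⟩ := hu.2 φ
  simp only [Pi.smul_apply, smul_eq_mul, Complex.ofReal_mul, Complex.real_smul, mul_assoc]
  exact ⟨a1.const_mul _, a2.const_mul _, by rw [integral_const_mul, integral_const_mul, a3]⟩

theorem HasFourierTransform.zero {d : ℕ} :
    HasFourierTransform (0 : EuclideanSpace ℝ (Fin d) → ℝ) 0 :=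
  ⟨locallyIntegrable_zero, fun φ => by simp⟩

theorem HasFourierTransform.ae_unique {d : ℕ} {u : EuclideanSpace ℝ (Fin d) → ℝ}
    {g h : EuclideanSpace ℝ (Fin d) → ℂ} (hg : HasFourierTransform u g)
    (hh : HasFourierTransform u h) : g =ᵐ[volume] h := by
  have key : ∀ᵐ x ∂(volume : Measure (EuclideanSpace ℝ (Fin d))), (g - h) x = 0 := by
    apply ae_eq_zero_of_integral_contDiff_smul_eq_zero (hg.1.sub hh.1)
    intro w w_smooth w_cpt
    have hw₁ : HasCompactSupport (Complex.ofRealCLM ∘ w) := w_cpt.comp_left rfl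
    have hw₂ : ContDiff ℝ ∞ (Complex.ofRealCLM ∘ w) := by fun_prop
    obtain ⟨a1, a2, a3⟩ := hg.2 (hw₁.toSchwartzMap hw₂)
    obtain ⟨b1, b2, b3⟩ := hh.2 (hw₁.toSchwartzMap hw₂)
    have := integral_sub a1 b1
    rw [a3, b3, sub_self] at this
    rw [← this]
    refine integral_congr_ae (Filter.Eventually.of_forall fun x => ?_)
    simp
    ring
  filter_upwards [key] with x hx
  exact sub_eq_zero.mp hx

/-- The space of real functions `u ∈ L^{2d/(d-2s)}(ℝᵈ)` whose Fourier transform `F[u]` is a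
locally integrable function with `∫ |ξ|^{2s} |F[u](ξ)|² dξ < ∞`. -/
noncomputable def homSobolevSubmodule (d : ℕ) (s : ℝ) :
    Submodule ℝ (Lp ℝ (ENNReal.ofReal (2 * d / (d - 2 * s)))
      (volume : Measure (EuclideanSpace ℝ (Fin d)))) where
  carrier := {u | ∃ g : EuclideanSpace ℝ (Fin d) → ℂ,
    HasFourierTransform u g ∧ MemLp (fun ξ => ‖ξ‖ ^ s • g ξ) 2 volume}
  add_mem' := by
    rintro u v ⟨g, hg, hg'⟩ ⟨h, hh, hh'⟩
    refine ⟨g + h, (hg.add hh).congr (Lp.coeFn_add u v).symm, ?_⟩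
    have e : (fun ξ => ‖ξ‖ ^ s • (g + h) ξ) = (fun ξ => ‖ξ‖ ^ s • g ξ) + fun ξ => ‖ξ‖ ^ s • h ξ := by
      ext ξ
      simp
    rw [e]
    exact hg'.add hh'
  zero_mem' := ⟨0, HasFourierTransform.zero.congr (Lp.coeFn_zero _ _ _).symm, by simp⟩
  smul_mem' := by
    rintro c u ⟨g, hg, hg'⟩
    refine ⟨c • g, (hg.smul c).congr (Lp.coeFn_smul c u).symm, ?_⟩
    have e : (fun ξ => ‖ξ‖ ^ s • (c • g) ξ) = c • fun ξ => ‖ξ‖ ^ s • g ξ := by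
      ext ξ
      simp only [Pi.smul_apply]
      rw [smul_comm]
    rw [e]
    exact hg'.const_smul c

/-- The homogeneous fractional Sobolev space `H̊^s(ℝᵈ)`. It is a type of its own because its norm
is not the one of `L^{2d/(d-2s)}`. -/
def HomSobolev (d : ℕ) (s : ℝ) : Type := ↥(homSobolevSubmodule d s)

namespace HomSobolev

noncomputable instance (d : ℕ) (s : ℝ) : AddCommGroup (HomSobolev d s) :=
  inferInstanceAs (AddCommGroup ↥(homSobolevSubmodule d s))

noncomputable instance (d : ℕ) (s : ℝ) : Module ℝ (HomSobolev d s) :=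
  inferInstanceAs (Module ℝ ↥(homSobolevSubmodule d s))

/-- The element of `L^{2d/(d-2s)}(ℝᵈ)` underlying an element of `H̊^s(ℝᵈ)`. -/
noncomputable def toLp {d : ℕ} {s : ℝ} (u : HomSobolev d s) :
    Lp ℝ (ENNReal.ofReal (2 * d / (d - 2 * s))) (volume : Measure (EuclideanSpace ℝ (Fin d))) :=
  Subtype.val u

/-- The Fourier transform `F[u]` of `u ∈ H̊^s(ℝᵈ)`, a function unique up to null sets. -/
noncomputable def fourier {d : ℕ} {s : ℝ} (u : HomSobolev d s) : EuclideanSpace ℝ (Fin d) → ℂ :=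
  (Subtype.property u).choose

theorem hasFourierTransform_fourier {d : ℕ} {s : ℝ} (u : HomSobolev d s) :
    HasFourierTransform u.toLp u.fourier :=
  (Subtype.property u).choose_spec.1

theorem memLp_fourier {d : ℕ} {s : ℝ} (u : HomSobolev d s) :
    MemLp (fun ξ => ‖ξ‖ ^ s • u.fourier ξ) 2 volume :=
  (Subtype.property u).choose_spec.2

/-- The linear map `u ↦ |ξ|^s F[u](ξ)` from `H̊^s(ℝᵈ)` to `L²(ℝᵈ; ℂ)`. -/
noncomputable def toL2 (d : ℕ) (s : ℝ) :
    HomSobolev d s →ₗ[ℝ] Lp ℂ 2 (volume : Measure (EuclideanSpace ℝ (Fin d))) where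
  toFun u := u.memLp_fourier.toLp _
  map_add' u v := by
    rw [← MemLp.toLp_add]
    apply MemLp.toLp_congr
    have h := (u + v).hasFourierTransform_fourier.ae_unique
      ((u.hasFourierTransform_fourier.add v.hasFourierTransform_fourier).congr
        (Lp.coeFn_add u.toLp v.toLp).symm)
    filter_upwards [h] with ξ hξ
    simp [hξ]
  map_smul' c u := by
    rw [RingHom.id_apply, ← MemLp.toLp_const_smul]
    apply MemLp.toLp_congr
    have h := (c • u).hasFourierTransform_fourier.ae_unique
      ((u.hasFourierTransform_fourier.smul c).congr (Lp.coeFn_smul c u.toLp).symm)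
    filter_upwards [h] with ξ hξ
    simp only [hξ, Pi.smul_apply]
    rw [smul_comm]

/-- The norm of `H̊^s(ℝᵈ)`, that is, `‖u‖ = ‖|ξ|^s F[u]‖_{L²}`; see `norm_eq`.
It is definite by `eq_zero_of_norm`. -/
noncomputable instance (d : ℕ) (s : ℝ) : SeminormedAddCommGroup (HomSobolev d s) :=
  SeminormedAddCommGroup.induced (HomSobolev d s)
    (Lp ℂ 2 (volume : Measure (EuclideanSpace ℝ (Fin d)))) (toL2 d s)

noncomputable instance (d : ℕ) (s : ℝ) : NormedSpace ℝ (HomSobolev d s) :=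
  NormedSpace.induced ℝ (HomSobolev d s)
    (Lp ℂ 2 (volume : Measure (EuclideanSpace ℝ (Fin d)))) (toL2 d s)

/-- `‖u‖ = (∫ |ξ|^{2s} |F[u](ξ)|² dξ)^{1/2}`. -/
theorem norm_eq {d : ℕ} {s : ℝ} (u : HomSobolev d s) :
    ‖u‖ = Real.sqrt (∫ ξ, ‖ξ‖ ^ (2 * s) * ‖u.fourier ξ‖ ^ 2) := by
  have h : ‖u‖ = ‖u.memLp_fourier.toLp _‖ := rfl
  rw [h, Lp.norm_toLp, u.memLp_fourier.eLpNorm_eq_integral_rpow_norm (by simp) (by simp),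
    ENNReal.toReal_ofReal (by positivity), Real.sqrt_eq_rpow]
  simp only [ENNReal.toReal_ofNat, one_div]
  congr 2
  ext ξ
  rw [norm_smul, Real.norm_of_nonneg (by positivity), Real.mul_rpow (by positivity) (by positivity),
    ← Real.rpow_mul (norm_nonneg _), mul_comm s 2]
  norm_num

/-- The continuous functional `T` on `H̊^s(ℝᵈ)` is the regular distribution given by the function
`τ`: `⟨T, φ⟩ = ∫ τ φ` for all `φ ∈ C_c^∞(ℝᵈ)`. The variable `u` is `φ` as an element of
`H̊^s(ℝᵈ)`; it exists by `exists_of_test`. -/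
def IsRegularDistribution {d : ℕ} {s : ℝ} (T : StrongDual ℝ (HomSobolev d s))
    (τ : EuclideanSpace ℝ (Fin d) → ℝ) : Prop :=
  ∀ φ : EuclideanSpace ℝ (Fin d) → ℝ, ContDiff ℝ ∞ φ → HasCompactSupport φ →
    ∀ u : HomSobolev d s, u.toLp =ᵐ[volume] φ → T u = ∫ x, τ x * φ x

end HomSobolev

/-- The Riesz kernel `I_α(x) = A_α |x|^{α-d}` with
`A_α = Γ((d-α)/2) / (π^{d/2} 2^α Γ(α/2))`. -/
noncomputable def rieszKernel (d : ℕ) (α : ℝ) (x : EuclideanSpace ℝ (Fin d)) : ℝ :=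
  Real.Gamma ((d - α) / 2) / (Real.pi ^ ((d : ℝ) / 2) * 2 ^ α * Real.Gamma (α / 2)) *
    ‖x‖ ^ (α - d)

/-- The Riesz potential `I_α * τ`. -/
noncomputable def rieszPotential {d : ℕ} (α : ℝ) (τ : EuclideanSpace ℝ (Fin d) → ℝ) :
    EuclideanSpace ℝ (Fin d) → ℝ :=
  rieszKernel d α ⋆[ContinuousLinearMap.mul ℝ ℝ, volume] τ

/-- The Coulomb type energy `D_α(τ, τ) = ∫ (I_α * τ)(x) τ(x) dx`. -/
noncomputable def coulombEnergy {d : ℕ} (α : ℝ) (τ : EuclideanSpace ℝ (Fin d) → ℝ) : ℝ :=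
  ∫ x, rieszPotential α τ x * τ x

theorem unitaryFourier_eq {d : ℕ} (φ : EuclideanSpace ℝ (Fin d) → ℂ)
    (ξ : EuclideanSpace ℝ (Fin d)) :
    unitaryFourier φ ξ = (((2 * Real.pi) ^ (-(d : ℝ) / 2) : ℝ) : ℂ) *
      FourierTransform.fourier φ ((2 * Real.pi)⁻¹ • ξ) := by
  rw [unitaryFourier, Real.fourier_eq']
  congr 2
  ext x
  have h : -2 * Real.pi * inner ℝ x ((2 * Real.pi)⁻¹ • ξ) = -inner ℝ x ξ := by
    rw [inner_smul_right]
    field_simp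
  rw [h, smul_eq_mul]
  push_cast
  ring

theorem exists_schwartz_eq_unitaryFourier {d : ℕ} (φ : 𝓢(EuclideanSpace ℝ (Fin d), ℂ)) :
    ∃ G : 𝓢(EuclideanSpace ℝ (Fin d), ℂ), ∀ ξ, unitaryFourier φ ξ = G ξ := by
  let e : EuclideanSpace ℝ (Fin d) ≃L[ℝ] EuclideanSpace ℝ (Fin d) :=
    ContinuousLinearEquiv.smulLeft (Units.mk0 (2 * Real.pi)⁻¹ (by positivity))
  refine ⟨(((2 * Real.pi) ^ (-(d : ℝ) / 2) : ℝ) : ℂ) •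
    SchwartzMap.compCLMOfContinuousLinearEquiv ℂ e (FourierTransform.fourier φ), fun ξ => ?_⟩
  rw [unitaryFourier_eq]
  rfl

theorem integral_unitaryFourier_mul {d : ℕ} (φ ψ : 𝓢(EuclideanSpace ℝ (Fin d), ℂ)) :
    ∫ ξ, unitaryFourier ψ ξ * φ ξ = ∫ x, ψ x * unitaryFourier φ x := by
  have key := VectorFourier.integral_fourierIntegral_smul_eq_flip
    (μ := (volume : Measure (EuclideanSpace ℝ (Fin d)))) (ν := volume)
    (e := Real.fourierChar)
    (L := (2 * Real.pi)⁻¹ • innerₗ (EuclideanSpace ℝ (Fin d))) (f := ψ) (g := φ)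
    Real.continuous_fourierChar
    (by
      simp only [LinearMap.smul_apply, innerₗ_apply_apply]
      fun_prop) ψ.integrable φ.integrable
  have e1 : ∀ (η : 𝓢(EuclideanSpace ℝ (Fin d), ℂ)) (ξ : EuclideanSpace ℝ (Fin d)),
      unitaryFourier η ξ = (((2 * Real.pi) ^ (-(d : ℝ) / 2) : ℝ) : ℂ) *
      VectorFourier.fourierIntegral Real.fourierChar volume
        ((2 * Real.pi)⁻¹ • innerₗ (EuclideanSpace ℝ (Fin d))) η ξ := by
    intro η ξ
    rw [unitaryFourier_eq, Real.fourier_eq]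
    simp only [VectorFourier.fourierIntegral, LinearMap.smul_apply, innerₗ_apply_apply,
      inner_smul_right, smul_eq_mul]
  have e2 : ((2 * Real.pi)⁻¹ • innerₗ (EuclideanSpace ℝ (Fin d))).flip =
      (2 * Real.pi)⁻¹ • innerₗ (EuclideanSpace ℝ (Fin d)) := by
    ext x y
    simp [real_inner_comm]
  rw [e2] at key
  simp only [smul_eq_mul] at key
  simp only [e1, mul_assoc, mul_left_comm (ψ _), integral_const_mul]
  rw [key]

theorem hasFourierTransform_of_schwartz {d : ℕ} (u : EuclideanSpace ℝ (Fin d) → ℝ)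
    (ψ : 𝓢(EuclideanSpace ℝ (Fin d), ℂ)) (h : ∀ x, ψ x = u x) :
    HasFourierTransform u (unitaryFourier ψ) := by
  obtain ⟨G, hG⟩ := exists_schwartz_eq_unitaryFourier ψ
  have hG' : unitaryFourier ψ = G := funext hG
  have hint : ∀ a b : 𝓢(EuclideanSpace ℝ (Fin d), ℂ), Integrable (fun x => a x * b x) volume :=
    fun a b => (a.memLp 2).integrable_mul (b.memLp 2)
  refine ⟨?_, fun φ => ?_⟩
  · rw [hG']
    exact G.integrable.locallyIntegrable
  · obtain ⟨H, hH⟩ := exists_schwartz_eq_unitaryFourier φ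
    refine ⟨?_, ?_, ?_⟩
    · rw [hG']
      exact hint G φ
    · simp only [← h, hH]
      exact hint ψ H
    · simp only [← h]
      exact integral_unitaryFourier_mul φ ψ

/-- Test functions belong to `H̊^s(ℝᵈ)`. -/
theorem HomSobolev.exists_of_test {d : ℕ} {s : ℝ} (hs : 0 ≤ s)
    (φ : EuclideanSpace ℝ (Fin d) → ℝ) (h1 : ContDiff ℝ ∞ φ) (h2 : HasCompactSupport φ) :
    ∃ u : HomSobolev d s, u.toLp =ᵐ[volume] φ := by
  have hw₁ : HasCompactSupport (Complex.ofRealCLM ∘ φ) := h2.comp_left rfl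
  have hw₂ : ContDiff ℝ ∞ (Complex.ofRealCLM ∘ φ) := by fun_prop
  have hL : MemLp φ (ENNReal.ofReal (2 * d / (d - 2 * s))) volume :=
    h1.continuous.memLp_of_hasCompactSupport h2
  have hF := hasFourierTransform_of_schwartz φ (hw₁.toSchwartzMap hw₂) (fun x => rfl)
  obtain ⟨G, hG⟩ := exists_schwartz_eq_unitaryFourier (hw₁.toSchwartzMap hw₂)
  refine ⟨⟨hL.toLp φ, _, hF.congr hL.coeFn_toLp.symm, ?_⟩, hL.coeFn_toLp⟩
  have hm : AEStronglyMeasurable (fun ξ : EuclideanSpace ℝ (Fin d) => ‖ξ‖ ^ s • G ξ) volume :=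
    ((continuous_norm.rpow_const fun _ => Or.inr hs).smul G.continuous).aestronglyMeasurable
  simp only [hG]
  obtain ⟨n, hn⟩ := exists_nat_ge s
  have hd : MemLp (fun ξ : EuclideanSpace ℝ (Fin d) => ‖G ξ‖ + ‖ξ‖ ^ n * ‖G ξ‖) 2 volume := by
    refine (G.memLp 2).norm.add ?_
    have hc : Continuous fun ξ : EuclideanSpace ℝ (Fin d) => ‖ξ‖ ^ n * ‖G ξ‖ := by fun_prop
    obtain ⟨C, hC⟩ := G.decay n 0
    have hi := G.integrable_pow_mul volume n
    rw [memLp_two_iff_integrable_sq hc.aestronglyMeasurable]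
    refine (hi.const_mul C).mono' (hc.pow 2).aestronglyMeasurable
      (Filter.Eventually.of_forall fun ξ => ?_)
    have := hC.2 ξ
    rw [norm_iteratedFDeriv_zero] at this
    rw [Real.norm_of_nonneg (by positivity), sq]
    gcongr
  refine hd.mono hm (Filter.Eventually.of_forall fun ξ => ?_)
  rw [norm_smul, Real.norm_of_nonneg (by positivity), Real.norm_of_nonneg (by positivity)]
  have : ‖ξ‖ ^ s ≤ 1 + ‖ξ‖ ^ n := by
    rcases le_total ‖ξ‖ 1 with h | h
    · exact (Real.rpow_le_one (norm_nonneg _) h hs).trans (by simp)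
    · calc ‖ξ‖ ^ s ≤ ‖ξ‖ ^ (n : ℝ) := Real.rpow_le_rpow_of_exponent_le h hn
        _ = ‖ξ‖ ^ n := Real.rpow_natCast _ _
        _ ≤ _ := by simp
  nlinarith [norm_nonneg (G ξ)]

/-- For `d ≥ 1` the seminorm of `H̊^s(ℝᵈ)` is a norm. -/
theorem HomSobolev.eq_zero_of_norm {d : ℕ} {s : ℝ} (hd : 1 ≤ d)
    (u : HomSobolev d s) (hu : ‖u‖ = 0) : u = 0 := by
  have : Nonempty (Fin d) := ⟨⟨0, hd⟩⟩
  have h0 : u.memLp_fourier.toLp _ = 0 := norm_eq_zero.mp hu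
  have h1 : u.fourier =ᵐ[volume] 0 := by
    have := (MemLp.toLp_eq_toLp_iff u.memLp_fourier (MemLp.zero)).mp
      (h0.trans (MemLp.toLp_zero _).symm)
    have hne : ∀ᵐ ξ : EuclideanSpace ℝ (Fin d), ξ ≠ 0 := by
      simp [ae_iff]
    filter_upwards [this, hne] with ξ h hξ
    have h' : ‖ξ‖ ^ s ≠ 0 := (Real.rpow_pos_of_pos (norm_pos_iff.mpr hξ) s).ne'
    have h'' : ‖ξ‖ ^ s • u.fourier ξ = 0 := h
    exact (smul_eq_zero.mp h'').resolve_left h'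
  have hz : ∀ φ : 𝓢(EuclideanSpace ℝ (Fin d), ℂ),
      Integrable (fun x => (u.toLp x : ℂ) * φ x) ∧ ∫ x, (u.toLp x : ℂ) * φ x = 0 := by
    intro φ
    let e : EuclideanSpace ℝ (Fin d) ≃L[ℝ] EuclideanSpace ℝ (Fin d) :=
      ContinuousLinearEquiv.smulLeft (Units.mk0 (2 * Real.pi) (by positivity))
    have hc : (((2 * Real.pi) ^ (-(d : ℝ) / 2) : ℝ) : ℂ) ≠ 0 := by
      exact_mod_cast (by positivity : (2 * Real.pi) ^ (-(d : ℝ) / 2) ≠ 0)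
    let ψ : 𝓢(EuclideanSpace ℝ (Fin d), ℂ) := (((2 * Real.pi) ^ (-(d : ℝ) / 2) : ℝ) : ℂ)⁻¹ •
      FourierTransform.fourierInv (SchwartzMap.compCLMOfContinuousLinearEquiv ℂ e φ)
    have hψ : ∀ x, unitaryFourier ψ x = φ x := by
      intro x
      rw [unitaryFourier_eq]
      have : FourierTransform.fourier (ψ : EuclideanSpace ℝ (Fin d) → ℂ)
          = (FourierTransform.fourier ψ : 𝓢(EuclideanSpace ℝ (Fin d), ℂ)) := rfl
      rw [this]
      simp only [ψ, FourierTransform.fourier_smul, FourierTransform.fourier_fourierInv_eq]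
      have h3 : e ((2 * Real.pi)⁻¹ • x) = x := by
        change (2 * Real.pi) • ((2 * Real.pi)⁻¹ • x) = x
        rw [smul_smul, mul_inv_cancel₀ (by positivity), one_smul]
      change _ * (_ * φ (e _)) = _
      rw [h3, mul_inv_cancel_left₀ hc]
    obtain ⟨a1, a2, a3⟩ := u.hasFourierTransform_fourier.2 ψ
    simp only [hψ] at a2 a3
    refine ⟨a2, a3 ▸ ?_⟩
    rw [integral_eq_zero_of_ae]
    filter_upwards [h1] with x hx
    simp [hx]
  have hloc : LocallyIntegrable (fun x => (u.toLp x : ℂ)) := by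
    rw [locallyIntegrable_iff]
    intro K hK
    obtain ⟨R, hR, hKR⟩ := hK.isBounded.subset_closedBall_lt 0 (0 : EuclideanSpace ℝ (Fin d))
    let χ : ContDiffBump (0 : EuclideanSpace ℝ (Fin d)) := ⟨R, R + 1, hR, by linarith⟩
    have c1 : HasCompactSupport (Complex.ofRealCLM ∘ χ) := χ.hasCompactSupport.comp_left rfl
    have c2 : ContDiff ℝ ∞ (Complex.ofRealCLM ∘ χ) := Complex.ofRealCLM.contDiff.comp χ.contDiff
    refine ((hz (c1.toSchwartzMap c2)).1.integrableOn (s := K)).congr_fun (fun x hx => ?_)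
      hK.measurableSet
    have : χ x = 1 := χ.one_of_mem_closedBall (hKR hx)
    simp [this]
  have hu0 : ∀ᵐ x ∂(volume : Measure (EuclideanSpace ℝ (Fin d))), (u.toLp x : ℂ) = 0 := by
    apply ae_eq_zero_of_integral_contDiff_smul_eq_zero hloc
    intro w w_smooth w_cpt
    have hw₁ : HasCompactSupport (Complex.ofRealCLM ∘ w) := w_cpt.comp_left rfl
    have hw₂ : ContDiff ℝ ∞ (Complex.ofRealCLM ∘ w) := by fun_prop
    rw [← (hz (hw₁.toSchwartzMap hw₂)).2]
    refine integral_congr_ae (Filter.Eventually.of_forall fun x => ?_)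
    simp [mul_comm]
  have : u.toLp = 0 := by
    apply Lp.ext
    filter_upwards [hu0, Lp.coeFn_zero ℝ (ENNReal.ofReal (2 * d / (d - 2 * s)))
      (volume : Measure (EuclideanSpace ℝ (Fin d)))] with x hx h0
    rw [h0]
    simpa using hx
  exact Subtype.ext this

/-! Formally the claim is ‖T‖² = ⟨T, I_{2s} * T⟩, with I_{2s} * T the Riesz representative of T. The
pairing is not known in advance to be an absolutely convergent integral, so T·(I_{2s} * T) is
localized by cutoffs k(εx); an exact Fourier formula is proved for the localized energies, and the
bound from below by -|f| is used when ε → 0.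

Extending T from the image of H̊^s in L² without increasing its norm gives a Hermitian H ∈ L² with
‖H‖₂ = ‖T‖ and ∫ τφ = ∫ H(ξ) (2π|ξ|)^s 𝓕φ(ξ) dξ for test functions φ
(`HomSobolev.exists_fourier_pairing`). To use only test functions, the kernel |x|^{2s-n} is written
as a superposition ∫ t^{n-2s-1} k(tx) dt of dilates of one radial bump k. For fixed t, k(ε·)(k(t·) *
τ) is a test function, and the formula can be applied twice (`integral_mul_cutoff_mul_convolution`).
Integrating in t, with K = 𝓕k, turns the localized energy into B_ε(H, H) = ∫∫ H(ξ) |ξ|^s ε^{-n}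
K((ξ+η)/ε) |η|^{-s} H(η) dξ dη (`bumpMellin_mul_integral_cutoff_energy`). The constant is found by
testing with a Gaussian (`rieszConstant_mul_bumpFourierMellin`).

Two estimates justify this. The range of q makes the localized energy absolutely convergent
(`integrable_indicator_mul_norm_rpow_mul`). The condition 2s < n makes B_ε bounded on L² uniformly
in ε (`exists_lintegral_multiplier_le`), which says that multiplication by k(ε·) is uniformly
bounded on H̊^s.

Since ∫ K = k(0) = 1, the kernels ε^{-n} K(·/ε) form an approximate identity, and B_ε(H, H) → ∫
H(-η) H(η) dη = ‖H‖₂² (`tendsto_integral_dilatedIntegrand`). Fatou applied to T·(I_{2s} * T) + |f| ≥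
0 gives integrability, and dominated convergence identifies the limit
(`integrable_and_integral_eq_of_tendsto_cutoff`). -/

/-! ### A radial bump and its Fourier transform. -/

section RadialBump

open Real Set
open scoped FourierTransform

variable {E : Type*} [NormedAddCommGroup E]

/-- A smooth radial function with values in `[0, 1]`, equal to `1` at the origin and supported in
the closed unit ball. -/
noncomputable def radialBump (x : E) : ℝ := Real.smoothTransition (1 - ‖x‖ ^ 2)

theorem radialBump_nonneg (x : E) : 0 ≤ radialBump x := Real.smoothTransition.nonneg _

theorem radialBump_le_one (x : E) : radialBump x ≤ 1 := Real.smoothTransition.le_one _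

theorem radialBump_zero : radialBump (0 : E) = 1 := by
  simp [radialBump, Real.smoothTransition.one_of_one_le]

theorem radialBump_eq_zero {x : E} (hx : 1 ≤ ‖x‖) : radialBump x = 0 :=
  Real.smoothTransition.zero_of_nonpos (by nlinarith)

theorem radialBump_neg (x : E) : radialBump (-x) = radialBump x := by simp [radialBump]

variable [InnerProductSpace ℝ E]

theorem contDiff_radialBump_smul (r : ℝ) : ContDiff ℝ ∞ fun x : E => radialBump (r • x) := by
  unfold radialBump
  exact Real.smoothTransition.contDiff.comp
    (contDiff_const.sub ((contDiff_const_smul r).norm_sq ℝ))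

theorem continuous_radialBump : Continuous (radialBump : E → ℝ) := by
  simpa using (contDiff_radialBump_smul (E := E) 1).continuous

variable [FiniteDimensional ℝ E]

theorem hasCompactSupport_radialBump_smul {r : ℝ} (hr : 0 < r) :
    HasCompactSupport fun x : E => radialBump (r • x) := by
  refine HasCompactSupport.of_support_subset_isCompact (isCompact_closedBall (0 : E) r⁻¹) ?_
  intro x hx
  by_contra h
  apply hx
  apply radialBump_eq_zero
  rw [mem_closedBall_zero_iff, not_le] at h
  rw [norm_smul, Real.norm_of_nonneg hr.le]
  calc (1 : ℝ) = r * r⁻¹ := (mul_inv_cancel₀ hr.ne').symm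
    _ ≤ r * ‖x‖ := by gcongr

/-- The dilation `x ↦ k(r x)` of the radial bump `k`, as a complex Schwartz function. -/
noncomputable def bumpSchwartz (E : Type*) [NormedAddCommGroup E] [InnerProductSpace ℝ E]
    [FiniteDimensional ℝ E] {r : ℝ} (hr : 0 < r) : 𝓢(E, ℂ) :=
  HasCompactSupport.toSchwartzMap (f := fun x : E => (radialBump (r • x) : ℂ))
    ((hasCompactSupport_radialBump_smul hr).comp_left (g := Complex.ofReal) rfl)
    (Complex.ofRealCLM.contDiff.comp (contDiff_radialBump_smul r))

theorem bumpSchwartz_apply {r : ℝ} (hr : 0 < r) (x : E) :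
    bumpSchwartz E hr x = (radialBump (r • x) : ℂ) := rfl

variable [MeasurableSpace E] [BorelSpace E]

/-- The Fourier transform of the radial bump. -/
noncomputable def bumpFourier (E : Type*) [NormedAddCommGroup E] [InnerProductSpace ℝ E]
    [FiniteDimensional ℝ E] [MeasurableSpace E] [BorelSpace E] : 𝓢(E, ℂ) :=
  𝓕 (bumpSchwartz E one_pos)

theorem bumpFourier_apply (ξ : E) :
    bumpFourier E ξ = 𝓕 (fun x : E => (radialBump x : ℂ)) ξ := by
  have : (bumpSchwartz E one_pos : E → ℂ) = fun x => (radialBump x : ℂ) := by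
    ext x
    simp [bumpSchwartz_apply]
  rw [bumpFourier, SchwartzMap.fourier_coe, this]

/-- The Fourier transform of a dilation of the radial bump. -/
theorem fourier_radialBump_smul {r : ℝ} (hr : 0 < r) (ξ : E) :
    𝓕 (fun x : E => (radialBump (r • x) : ℂ)) ξ =
      ((r ^ Module.finrank ℝ E)⁻¹ : ℝ) * bumpFourier E (r⁻¹ • ξ) := by
  rw [bumpFourier_apply, Real.fourier_eq, Real.fourier_eq]
  have := Measure.integral_comp_smul (volume : Measure E)
    (fun y : E => 𝐞 (-inner ℝ y (r⁻¹ • ξ)) • (radialBump y : ℂ)) r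
  rw [abs_of_pos (by positivity)] at this
  rw [← Complex.real_smul, ← this]
  refine integral_congr_ae (Filter.Eventually.of_forall fun x => ?_)
  simp only [inner_smul_left, inner_smul_right, RCLike.conj_to_real]
  rw [inv_mul_cancel_left₀ hr.ne']

/-- The reflection in the hyperplane orthogonal to ξ - η exchanges the two vectors, preserves the
bump, and commutes with 𝓕. Integrals of the transform over dilations thus reduce to a single ray. -/
theorem bumpFourier_eq_of_norm_eq {ξ η : E} (h : ‖ξ‖ = ‖η‖) :
    bumpFourier E ξ = bumpFourier E η := by
  have h1 := Real.fourier_comp_linearIsometry ((ℝ ∙ (ξ - η))ᗮ.reflection)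
    (fun x : E => (radialBump x : ℂ)) ξ
  rw [Submodule.reflection_sub h] at h1
  have h2 : (fun x : E => (radialBump x : ℂ)) ∘ ((ℝ ∙ (ξ - η))ᗮ.reflection) =
      fun x => (radialBump x : ℂ) := by
    ext x
    simp [radialBump]
  rw [bumpFourier_apply, bumpFourier_apply, ← h1, h2]

/-- Fourier inversion at the origin. This is the mass of the approximate identity, so no constant is
left in the limit ε → 0. -/
theorem integral_bumpFourier : ∫ ξ, bumpFourier E ξ = 1 := by
  have h : 𝓕⁻ (bumpFourier E) 0 = bumpSchwartz E one_pos 0 := by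
    rw [bumpFourier, FourierTransform.fourierInv_fourier_eq]
  rw [SchwartzMap.fourierInv_coe, Real.fourierInv_eq'] at h
  simpa [bumpSchwartz_apply, radialBump_zero] using h

end RadialBump

/-! ### Mellin integrals under scaling and inversion of the variable. -/

section Mellin

open Set

variable {F : Type*} [NormedAddCommGroup F] [NormedSpace ℝ F]

theorem integral_rpow_smul_comp_mul (f : ℝ → F) (p : ℝ) {r : ℝ} (hr : 0 < r) :
    ∫ t in Ioi (0 : ℝ), t ^ (p - 1) • f (t * r) = r ^ (-p) • ∫ t in Ioi (0 : ℝ), t ^ (p - 1) • f t := by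
  have h := integral_comp_mul_left_Ioi (fun t : ℝ => t ^ (p - 1) • f t) 0 hr
  rw [mul_zero] at h
  have h2 : ∫ t in Ioi (0 : ℝ), (r * t) ^ (p - 1) • f (r * t) =
      r ^ (p - 1) • ∫ t in Ioi (0 : ℝ), t ^ (p - 1) • f (t * r) := by
    rw [← integral_smul]
    refine setIntegral_congr_fun measurableSet_Ioi fun t ht => ?_
    rw [Real.mul_rpow hr.le (le_of_lt ht), smul_smul, mul_comm r t]
  rw [h2] at h
  have h3 : r ^ (-p) = (r ^ (p - 1))⁻¹ * r⁻¹ := by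
    rw [← Real.rpow_neg_one r, ← Real.rpow_neg hr.le, ← Real.rpow_add hr]
    ring_nf
  rw [h3, mul_smul, ← h, inv_smul_smul₀ (Real.rpow_pos_of_pos hr _).ne']

theorem integrableOn_rpow_smul_comp_mul {f : ℝ → F} {p : ℝ}
    (hf : IntegrableOn (fun t : ℝ => t ^ (p - 1) • f t) (Ioi 0)) {r : ℝ} (hr : 0 < r) :
    IntegrableOn (fun t : ℝ => t ^ (p - 1) • f (t * r)) (Ioi 0) := by
  have h := (integrableOn_Ioi_comp_mul_left_iff (fun t : ℝ => t ^ (p - 1) • f t) 0 hr).mpr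
    (by simpa using hf)
  have h' : IntegrableOn ((r ^ (p - 1))⁻¹ • fun t : ℝ => (r * t) ^ (p - 1) • f (r * t)) (Ioi 0) :=
    h.smul _
  refine h'.congr_fun (fun t ht => ?_) measurableSet_Ioi
  simp only [Pi.smul_apply]
  rw [Real.mul_rpow hr.le (le_of_lt ht), mul_smul,
    inv_smul_smul₀ (Real.rpow_pos_of_pos hr _).ne', mul_comm]

/-- The left side is the integrand, Jacobian included, that `integral_comp_rpow_Ioi` produces for
the substitution t ↦ t⁻¹. -/
theorem rpow_smul_comp_inv_eq (f : ℝ → F) (p : ℝ) {t : ℝ} (ht : 0 < t) :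
    (|(-1 : ℝ)| * t ^ ((-1 : ℝ) - 1)) • ((t ^ (-1 : ℝ)) ^ (p - 1) • f (t ^ (-1 : ℝ))) =
      t ^ (-p - 1) • f t⁻¹ := by
  rw [abs_neg, abs_one, one_mul, smul_smul, ← Real.rpow_mul ht.le, ← Real.rpow_add ht,
    Real.rpow_neg_one]
  ring_nf

theorem integral_rpow_smul_comp_inv (f : ℝ → F) (p : ℝ) :
    ∫ t in Ioi (0 : ℝ), t ^ (-p - 1) • f t⁻¹ = ∫ t in Ioi (0 : ℝ), t ^ (p - 1) • f t := by
  rw [← integral_comp_rpow_Ioi (fun t : ℝ => t ^ (p - 1) • f t) (by norm_num : (-1 : ℝ) ≠ 0)]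
  exact setIntegral_congr_fun measurableSet_Ioi fun t ht => (rpow_smul_comp_inv_eq f p ht).symm

theorem integrableOn_rpow_smul_comp_inv {f : ℝ → F} {p : ℝ}
    (hf : IntegrableOn (fun t : ℝ => t ^ (p - 1) • f t) (Ioi 0)) :
    IntegrableOn (fun t : ℝ => t ^ (-p - 1) • f t⁻¹) (Ioi 0) :=
  ((integrableOn_Ioi_comp_rpow_iff (fun t : ℝ => t ^ (p - 1) • f t)
    (by norm_num : (-1 : ℝ) ≠ 0)).mpr hf).congr_fun
    (fun _ ht => rpow_smul_comp_inv_eq f p ht) measurableSet_Ioi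

/-- Near 0 boundedness and p > 0 suffice; beyond 1 the decay exponent m exceeds p. -/
theorem integrableOn_rpow_smul_of_decay {f : ℝ → F} (hf : Continuous f) {p : ℝ} (hp : 0 < p)
    {C₀ : ℝ} (h0 : ∀ t, 0 < t → ‖f t‖ ≤ C₀) {m : ℝ} (hm : p < m) {C : ℝ}
    (h1 : ∀ t, 1 < t → ‖f t‖ ≤ C * t ^ (-m)) :
    IntegrableOn (fun t : ℝ => t ^ (p - 1) • f t) (Ioi 0) := by
  have hmeas : ∀ s : Set ℝ, MeasurableSet s → s ⊆ Ioi 0 →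
      AEStronglyMeasurable (fun t : ℝ => t ^ (p - 1) • f t) (volume.restrict s) := by
    intro s hs hs0
    refine ContinuousOn.aestronglyMeasurable (ContinuousOn.smul ?_ hf.continuousOn) hs
    exact continuousOn_id.rpow_const fun t ht => Or.inl (ne_of_gt (hs0 ht))
  rw [← Ioc_union_Ioi_eq_Ioi (zero_le_one : (0 : ℝ) ≤ 1)]
  refine IntegrableOn.union ?_ ?_
  · have hi : IntegrableOn (fun t : ℝ => t ^ (p - 1)) (Ioc 0 1) :=
      (intervalIntegrable_iff_integrableOn_Ioc_of_le zero_le_one).mp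
        (intervalIntegral.intervalIntegrable_rpow' (by linarith))
    refine (hi.const_mul C₀).mono' (hmeas _ measurableSet_Ioc fun t ht => ht.1) ?_
    filter_upwards [ae_restrict_mem measurableSet_Ioc] with t ht
    have := Real.rpow_nonneg ht.1.le (p - 1)
    rw [norm_smul, Real.norm_of_nonneg this, mul_comm]
    exact mul_le_mul_of_nonneg_right (h0 t ht.1) this
  · have hi : IntegrableOn (fun t : ℝ => t ^ (p - 1 - m)) (Ioi 1) :=
      integrableOn_Ioi_rpow_of_lt (by linarith) one_pos
    refine (hi.const_mul C).mono' (hmeas _ measurableSet_Ioi fun t ht =>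
      mem_Ioi.mpr (lt_trans one_pos ht)) ?_
    filter_upwards [ae_restrict_mem measurableSet_Ioi] with t ht
    have ht0 : (0 : ℝ) < t := lt_trans one_pos ht
    have := Real.rpow_nonneg ht0.le (p - 1)
    rw [norm_smul, Real.norm_of_nonneg this, mul_comm]
    calc ‖f t‖ * t ^ (p - 1) ≤ C * t ^ (-m) * t ^ (p - 1) :=
          mul_le_mul_of_nonneg_right (h1 t ht) this
      _ = C * t ^ (p - 1 - m) := by
          rw [mul_assoc, ← Real.rpow_add ht0]
          ring_nf

end Mellin

/-! ### Powers of the norm as superpositions of dilated bumps. -/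

section Subordination

open Real Set
open scoped FourierTransform

/-- `∫₀^∞ t^{p-1} k(t) dt` for the profile `k` of the radial bump. -/
noncomputable def bumpMellin (p : ℝ) : ℝ :=
  ∫ t in Ioi (0 : ℝ), t ^ (p - 1) • Real.smoothTransition (1 - t ^ 2)

theorem integrableOn_bumpMellin {p : ℝ} (hp : 0 < p) :
    IntegrableOn (fun t : ℝ => t ^ (p - 1) • Real.smoothTransition (1 - t ^ 2)) (Ioi 0) := by
  refine integrableOn_rpow_smul_of_decay (C₀ := 1) (C := 0) (m := p + 1)
    (Real.smoothTransition.continuous.comp (by fun_prop)) hp (fun t _ => ?_) (by linarith)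
    (fun t ht => ?_)
  · rw [Function.comp_apply, Real.norm_of_nonneg (Real.smoothTransition.nonneg _)]
    exact Real.smoothTransition.le_one _
  · rw [Function.comp_apply, Real.smoothTransition.zero_of_nonpos (by nlinarith)]
    simp

theorem bumpMellin_pos {p : ℝ} (hp : 0 < p) : 0 < bumpMellin p := by
  unfold bumpMellin
  rw [setIntegral_pos_iff_support_of_nonneg_ae _ (integrableOn_bumpMellin hp)]
  · have : Ioo (0 : ℝ) 1 ⊆
        (Function.support fun t : ℝ => t ^ (p - 1) • Real.smoothTransition (1 - t ^ 2)) ∩ Ioi 0 := by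
      intro t ht
      refine ⟨?_, ht.1⟩
      have h1 := Real.rpow_pos_of_pos ht.1 (p - 1)
      have h2 : 0 < Real.smoothTransition (1 - t ^ 2) :=
        Real.smoothTransition.pos_of_pos (by nlinarith [ht.1, ht.2])
      exact (mul_pos h1 h2).ne'
    refine lt_of_lt_of_le ?_ (measure_mono this)
    simp
  · filter_upwards [ae_restrict_mem measurableSet_Ioi] with t ht
    exact mul_nonneg (Real.rpow_nonneg (le_of_lt ht) _) (Real.smoothTransition.nonneg _)

variable {E : Type*} [NormedAddCommGroup E] [InnerProductSpace ℝ E]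

theorem radialBump_smul_eq {t : ℝ} (ht : 0 < t) (x : E) :
    radialBump (t • x) = Real.smoothTransition (1 - (t * ‖x‖) ^ 2) := by
  rw [radialBump, norm_smul, Real.norm_of_nonneg ht.le]

theorem integrableOn_rpow_mul_radialBump {p : ℝ} (hp : 0 < p) {x : E} (hx : x ≠ 0) :
    IntegrableOn (fun t : ℝ => t ^ (p - 1) * radialBump (t • x)) (Ioi 0) := by
  refine (integrableOn_rpow_smul_comp_mul (integrableOn_bumpMellin hp)
    (norm_pos_iff.mpr hx)).congr_fun (fun t ht => ?_) measurableSet_Ioi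
  simp only [radialBump_smul_eq ht, smul_eq_mul]

/-- Homogeneity under t ↦ t‖x‖. With p = n - α this represents the Riesz kernel. The superposed
functions are compactly supported, unlike heat kernels, so convolving them with a test function
gives a test function again. -/
theorem integral_rpow_mul_radialBump (p : ℝ) {x : E} (hx : x ≠ 0) :
    ∫ t in Ioi (0 : ℝ), t ^ (p - 1) * radialBump (t • x) = bumpMellin p * ‖x‖ ^ (-p) := by
  have h := integral_rpow_smul_comp_mul (fun t => Real.smoothTransition (1 - t ^ 2)) p
    (norm_pos_iff.mpr hx)
  rw [smul_eq_mul, mul_comm] at h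
  rw [bumpMellin, ← h]
  refine setIntegral_congr_fun measurableSet_Ioi fun t ht => ?_
  rw [radialBump_smul_eq ht, smul_eq_mul]

variable [FiniteDimensional ℝ E] [MeasurableSpace E] [BorelSpace E]

theorem integrableOn_rpow_smul_bumpFourier {p : ℝ} (hp : 0 < p) {e : E} (he : ‖e‖ = 1) :
    IntegrableOn (fun t : ℝ => t ^ (p - 1) • bumpFourier E (t • e)) (Ioi 0) := by
  obtain ⟨m, hm⟩ := exists_nat_gt p
  obtain ⟨C₀, h0, hC₀⟩ := (bumpFourier E).decay 0 0
  obtain ⟨C, h1, hC⟩ := (bumpFourier E).decay m 0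
  refine integrableOn_rpow_smul_of_decay (C₀ := C₀) (C := C) (m := m)
    ((bumpFourier E).continuous.comp (by fun_prop)) hp (fun t _ => ?_) hm (fun t ht => ?_)
  · simpa using hC₀ (t • e)
  · have := hC (t • e)
    have ht0 : (0 : ℝ) < t := one_pos.trans ht
    rw [norm_iteratedFDeriv_zero, norm_smul, he, mul_one, Real.norm_of_nonneg ht0.le] at this
    rw [Real.rpow_neg ht0.le, Real.rpow_natCast, ← div_eq_mul_inv, le_div_iff₀ (by positivity),
      mul_comm]
    exact this

/-- `∫₀^∞ t^{p-1} K(t e) dt` for the Fourier transform `K` of the radial bump. -/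
noncomputable def bumpFourierMellin (p : ℝ) (e : E) : ℂ :=
  ∫ t in Ioi (0 : ℝ), t ^ (p - 1) • bumpFourier E (t • e)

theorem bumpFourier_inv_smul_eq {e : E} (he : ‖e‖ = 1) (t : ℝ) (η : E) :
    bumpFourier E (t⁻¹ • η) = bumpFourier E ((t⁻¹ * ‖η‖) • e) := by
  apply bumpFourier_eq_of_norm_eq
  rw [norm_smul, norm_smul, he, mul_one, norm_mul, norm_norm]

theorem integrableOn_rpow_smul_bumpFourier_inv {p : ℝ} (hp : 0 < p) {η : E} (hη : η ≠ 0) :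
    IntegrableOn (fun t : ℝ => t ^ (-p - 1) • bumpFourier E (t⁻¹ • η)) (Ioi 0) := by
  have he : ‖‖η‖⁻¹ • η‖ = 1 := norm_smul_inv_norm (𝕜 := ℝ) hη
  refine (integrableOn_rpow_smul_comp_inv (integrableOn_rpow_smul_comp_mul
    (integrableOn_rpow_smul_bumpFourier hp he) (norm_pos_iff.mpr hη))).congr_fun
    (fun t ht => ?_) measurableSet_Ioi
  simp only
  rw [bumpFourier_inv_smul_eq he t]

/-- The Fourier counterpart of the subordination formula: the weight t^{n-p-1} times the factor
t^{-n} from the transform of a dilation is t^{-p-1}. By radial symmetry any unit vector `e` may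
carry the constant. -/
theorem integral_rpow_smul_bumpFourier_inv (p : ℝ) {e : E} (he : ‖e‖ = 1) {η : E} (hη : η ≠ 0) :
    ∫ t in Ioi (0 : ℝ), t ^ (-p - 1) • bumpFourier E (t⁻¹ • η) =
      ‖η‖ ^ (-p) • bumpFourierMellin p e := by
  rw [bumpFourierMellin, ← integral_rpow_smul_comp_mul _ p (norm_pos_iff.mpr hη),
    ← integral_rpow_smul_comp_inv (fun t => bumpFourier E ((t * ‖η‖) • e))]
  refine setIntegral_congr_fun measurableSet_Ioi fun t ht => ?_
  rw [bumpFourier_inv_smul_eq he t]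

/-- The transform of the bump need not be nonnegative, so the absolute integrals needed for Fubini
have a constant of their own. -/
theorem integral_rpow_mul_norm_bumpFourier_inv (p : ℝ) {e : E} (he : ‖e‖ = 1) {η : E}
    (hη : η ≠ 0) :
    ∫ t in Ioi (0 : ℝ), t ^ (-p - 1) * ‖bumpFourier E (t⁻¹ • η)‖ =
      ‖η‖ ^ (-p) * ∫ t in Ioi (0 : ℝ), t ^ (p - 1) * ‖bumpFourier E (t • e)‖ := by
  have h1 := integral_rpow_smul_comp_mul (fun t => ‖bumpFourier E (t • e)‖) p
    (norm_pos_iff.mpr hη)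
  rw [← integral_rpow_smul_comp_inv] at h1
  simp only [smul_eq_mul] at h1
  rw [← h1]
  refine setIntegral_congr_fun measurableSet_Ioi fun t ht => ?_
  rw [bumpFourier_inv_smul_eq he t]

end Subordination

/-! ### The Riesz normalization, computed with a Gaussian. -/

section RieszConstant

open Real Set
open scoped FourierTransform

variable {E : Type*} [NormedAddCommGroup E] [InnerProductSpace ℝ E] [FiniteDimensional ℝ E]
  [MeasurableSpace E] [BorelSpace E]


theorem integrable_norm_rpow_mul_gaussian [Nontrivial E] {β : ℝ}
    (hβ : -(Module.finrank ℝ E : ℝ) < β) :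
    Integrable fun x : E => ‖x‖ ^ β * Real.exp (-π * ‖x‖ ^ 2) := by
  rw [integrable_fun_norm_addHaar (volume : Measure E)
    (f := fun r : ℝ => r ^ β * Real.exp (-π * r ^ 2))]
  have hn : 1 ≤ Module.finrank ℝ E := Module.finrank_pos
  refine (integrableOn_rpow_mul_exp_neg_mul_sq (s := Module.finrank ℝ E - 1 + β) Real.pi_pos
    (by linarith)).congr_fun (fun r hr => ?_) measurableSet_Ioi
  simp only [smul_eq_mul]
  rw [Real.rpow_add hr, ← Nat.cast_pred hn, Real.rpow_natCast, mul_assoc]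

theorem integral_norm_rpow_mul_gaussian [Nontrivial E] {β : ℝ}
    (hβ : -(Module.finrank ℝ E : ℝ) < β) :
    ∫ x : E, ‖x‖ ^ β * Real.exp (-π * ‖x‖ ^ 2) =
      (Module.finrank ℝ E * (volume : Measure E).real (Metric.ball 0 1) / 2) *
        (π ^ (-((Module.finrank ℝ E + β) / 2)) * Real.Gamma ((Module.finrank ℝ E + β) / 2)) := by
  rw [integral_fun_norm_addHaar (volume : Measure E)
    (f := fun r : ℝ => r ^ β * Real.exp (-π * r ^ 2))]
  have hn : 1 ≤ Module.finrank ℝ E := Module.finrank_pos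
  have h := integral_rpow_mul_exp_neg_mul_rpow (p := 2) (q := Module.finrank ℝ E - 1 + β)
    two_pos (by linarith) Real.pi_pos
  have h2 : ∫ y in Ioi (0 : ℝ), y ^ (Module.finrank ℝ E - 1) • (y ^ β * Real.exp (-π * y ^ 2)) =
      ∫ y in Ioi (0 : ℝ), y ^ ((Module.finrank ℝ E : ℝ) - 1 + β) * Real.exp (-π * y ^ (2 : ℝ)) := by
    refine setIntegral_congr_fun measurableSet_Ioi fun r hr => ?_
    simp only [smul_eq_mul]
    rw [Real.rpow_add hr, ← Nat.cast_pred hn, Real.rpow_natCast, mul_assoc, Real.rpow_two]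
  rw [h2, h, nsmul_eq_mul, smul_eq_mul]
  have h3 : (Module.finrank ℝ E : ℝ) - 1 + β + 1 = Module.finrank ℝ E + β := by ring
  rw [h3, neg_div]
  ring

theorem integral_fourier_mul_eq_of_integrable {f g : E → ℂ} (hf : Integrable f)
    (hg : Integrable g) : ∫ ξ, 𝓕 f ξ * g ξ = ∫ x, f x * 𝓕 g x := by
  have := VectorFourier.integral_fourierIntegral_smul_eq_flip (μ := (volume : Measure E))
    (ν := volume) (L := innerₗ E) (f := f) (g := g) Real.continuous_fourierChar
    (by simpa using continuous_inner) hf hg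
  rwa [flip_innerₗ] at this

theorem integrable_gaussian : Integrable fun x : E => Real.exp (-π * ‖x‖ ^ 2) := by
  have := (GaussianFourier.integrable_cexp_neg_mul_sq_norm_add (b := (π : ℂ))
    (by simpa using Real.pi_pos) 0 (0 : E)).norm
  refine this.congr (Filter.Eventually.of_forall fun x => ?_)
  simp [Complex.norm_exp, ← Complex.ofReal_pow]

theorem fourier_gaussian_eq_self (ξ : E) :
    𝓕 (fun x : E => ((Real.exp (-π * ‖x‖ ^ 2) : ℝ) : ℂ)) ξ = (Real.exp (-π * ‖ξ‖ ^ 2) : ℝ) := by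
  have := fourier_gaussian_innerProductSpace (b := (π : ℂ)) (by simpa using Real.pi_pos) ξ
  have hpi : (π : ℂ) ≠ 0 := by exact_mod_cast Real.pi_ne_zero
  rw [div_self hpi, Complex.one_cpow, one_mul] at this
  push_cast
  rw [this]
  congr 1
  field_simp

/-- Moving 𝓕 from one factor to the other, since this Gaussian is its own Fourier transform. -/
theorem integral_radialBump_smul_mul_gaussian {t : ℝ} (ht : 0 < t) :
    ∫ x : E, (radialBump (t • x) : ℂ) * (Real.exp (-π * ‖x‖ ^ 2) : ℝ) =
      ∫ ξ : E, ((t ^ Module.finrank ℝ E)⁻¹ : ℝ) * bumpFourier E (t⁻¹ • ξ) *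
        (Real.exp (-π * ‖ξ‖ ^ 2) : ℝ) := by
  have h := integral_fourier_mul_eq_of_integrable (bumpSchwartz E ht).integrable
    (integrable_gaussian (E := E)).ofReal
  simp only [fourier_gaussian_eq_self, RCLike.ofReal_eq_complex_ofReal] at h
  refine Eq.trans (Eq.symm h) ?_
  refine integral_congr_ae (Filter.Eventually.of_forall fun ξ => ?_)
  simp only
  rw [← fourier_radialBump_smul ht]
  rfl

variable [Nontrivial E]

theorem ae_ne_zero :
    ∀ᵐ x : E, x ≠ 0 := by
  simp [ae_iff]

/-- The preceding identity is integrated against t^{n-α-1} dt, and Fubini is applied on both sides.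
The two Mellin constants thereby become comparable through explicit Gaussian moments, without either
being computed. -/
theorem bumpMellin_mul_integral_eq {α : ℝ} (hα : 0 < α) (hα' : α < Module.finrank ℝ E) {e : E}
    (he : ‖e‖ = 1) :
    ((bumpMellin (Module.finrank ℝ E - α) *
      ∫ x : E, ‖x‖ ^ (α - Module.finrank ℝ E) * Real.exp (-π * ‖x‖ ^ 2) : ℝ) : ℂ) =
    ((∫ ξ : E, ‖ξ‖ ^ (-α) * Real.exp (-π * ‖ξ‖ ^ 2) : ℝ) : ℂ) * bumpFourierMellin α e := by
  set n := Module.finrank ℝ E with hn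
  set g : E → ℝ := fun x => Real.exp (-π * ‖x‖ ^ 2) with hg
  have hg0 : ∀ x, 0 < g x := fun x => Real.exp_pos _
  have hgm : Measurable g := by
    rw [hg]
    fun_prop
  set ν : Measure ℝ := volume.restrict (Ioi 0)
  have hp : 0 < n - α := by linarith
  have hkm : Measurable (radialBump : E → ℝ) := continuous_radialBump.measurable
  have hKm : Measurable (bumpFourier E) := (bumpFourier E).continuous.measurable
  -- the physical side
  let f₁ : E → ℝ → ℂ := fun x t => ((t ^ ((n : ℝ) - α - 1) * radialBump (t • x) * g x : ℝ) : ℂ)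
  have hf₁ : Integrable (Function.uncurry f₁) (volume.prod ν) := by
    have hm : Measurable (Function.uncurry f₁) := by
      simp only [f₁, Function.uncurry_def]
      fun_prop
    rw [integrable_prod_iff hm.aestronglyMeasurable]
    constructor
    · filter_upwards [ae_ne_zero (E := E)] with x hx
      exact ((integrableOn_rpow_mul_radialBump hp hx).mul_const (g x)).ofReal (𝕜 := ℂ)
    · refine ((integrable_norm_rpow_mul_gaussian (E := E) (β := α - n)
        (by linarith)).const_mul (bumpMellin (n - α))).congr ?_
      filter_upwards [ae_ne_zero (E := E)] with x hx
      have h1 : ∫ t, ‖Function.uncurry f₁ (x, t)‖ ∂ν =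
          ∫ t in Ioi (0 : ℝ), t ^ ((n : ℝ) - α - 1) * radialBump (t • x) * g x := by
        refine setIntegral_congr_fun measurableSet_Ioi fun t ht => ?_
        have := Real.rpow_nonneg (le_of_lt ht) ((n : ℝ) - α - 1)
        have := radialBump_nonneg (t • x)
        simp only [f₁, Function.uncurry_apply_pair, Complex.norm_real]
        exact Real.norm_of_nonneg (mul_nonneg (by positivity) (hg0 x).le)
      rw [h1, integral_mul_const, integral_rpow_mul_radialBump _ hx, neg_sub, mul_assoc]
  -- the Fourier side
  let f₂ : E → ℝ → ℂ := fun ξ t => (t ^ (-α - 1) • bumpFourier E (t⁻¹ • ξ)) * (g ξ : ℂ)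
  have hf₂ : Integrable (Function.uncurry f₂) (volume.prod ν) := by
    have hm : Measurable (Function.uncurry f₂) := by
      simp only [f₂, Function.uncurry_def]
      fun_prop
    rw [integrable_prod_iff hm.aestronglyMeasurable]
    constructor
    · filter_upwards [ae_ne_zero (E := E)] with x hx
      exact (integrableOn_rpow_smul_bumpFourier_inv hα hx).mul_const (g x : ℂ)
    · refine ((integrable_norm_rpow_mul_gaussian (E := E) (β := -α)
        (by linarith)).mul_const
          (∫ t in Ioi (0 : ℝ), t ^ (α - 1) * ‖bumpFourier E (t • e)‖)).congr ?_
      filter_upwards [ae_ne_zero (E := E)] with x hx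
      have h1 : ∫ t, ‖Function.uncurry f₂ (x, t)‖ ∂ν =
          ∫ t in Ioi (0 : ℝ), t ^ (-α - 1) * ‖bumpFourier E (t⁻¹ • x)‖ * g x := by
        refine setIntegral_congr_fun measurableSet_Ioi fun t ht => ?_
        have := Real.rpow_nonneg (le_of_lt ht) (-α - 1)
        simp only [f₂, Function.uncurry_apply_pair, norm_mul, norm_smul, Complex.norm_real]
        rw [Real.norm_of_nonneg (hg0 x).le, Real.norm_of_nonneg this]
      rw [h1, integral_mul_const, integral_rpow_mul_norm_bumpFourier_inv _ he hx]
      ring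
  have e1 : ∫ x, ∫ t, f₁ x t ∂ν = ((bumpMellin (n - α) * ∫ x, ‖x‖ ^ (α - n) * g x : ℝ) : ℂ) := by
    rw [← integral_const_mul, ← integral_complex_ofReal]
    refine integral_congr_ae ?_
    filter_upwards [ae_ne_zero (E := E)] with x hx
    simp only [f₁]
    rw [integral_complex_ofReal, integral_mul_const, integral_rpow_mul_radialBump _ hx, neg_sub,
      mul_assoc]
  have e2 : ∫ x, ∫ t, f₂ x t ∂ν =
      ((∫ ξ : E, ‖ξ‖ ^ (-α) * g ξ : ℝ) : ℂ) * bumpFourierMellin α e := by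
    rw [← integral_complex_ofReal, ← integral_mul_const]
    refine integral_congr_ae ?_
    filter_upwards [ae_ne_zero (E := E)] with x hx
    simp only [f₂]
    rw [integral_mul_const, integral_rpow_smul_bumpFourier_inv _ he hx, Complex.real_smul]
    push_cast
    ring
  rw [← e1, ← e2, integral_integral_swap hf₁, integral_integral_swap hf₂]
  refine setIntegral_congr_fun measurableSet_Ioi fun t ht => ?_
  have ht' : 0 < t := ht
  have h := congrArg (fun z : ℂ => ((t ^ ((n : ℝ) - α - 1) : ℝ) : ℂ) * z)
    (integral_radialBump_smul_mul_gaussian (E := E) ht')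
  simp only [← integral_const_mul] at h
  simp only [f₁, f₂]
  refine Eq.trans ?_ (h.trans ?_)
  · refine integral_congr_ae (Filter.Eventually.of_forall fun x => ?_)
    simp only [hg]
    push_cast
    ring
  · refine integral_congr_ae (Filter.Eventually.of_forall fun x => ?_)
    have : t ^ ((n : ℝ) - α - 1) * (t ^ n)⁻¹ = t ^ (-α - 1) := by
      rw [← Real.rpow_natCast, ← Real.rpow_neg ht'.le, ← Real.rpow_add ht']
      ring_nf
    simp only [hg, Complex.real_smul, ← this]
    push_cast
    ring

/-- The normalization of the Riesz kernel in terms of the radial bump. -/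
theorem rieszConstant_mul_bumpFourierMellin {α : ℝ} (hα : 0 < α)
    (hα' : α < Module.finrank ℝ E) {e : E} (he : ‖e‖ = 1) :
    ((Real.Gamma ((Module.finrank ℝ E - α) / 2) /
      (π ^ ((Module.finrank ℝ E : ℝ) / 2) * 2 ^ α * Real.Gamma (α / 2)) * (2 * π) ^ α : ℝ) : ℂ) *
      bumpFourierMellin α e = (bumpMellin (Module.finrank ℝ E - α) : ℂ) := by
  have h := bumpMellin_mul_integral_eq hα hα' he
  rw [integral_norm_rpow_mul_gaussian (by linarith), integral_norm_rpow_mul_gaussian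
    (by linarith)] at h
  set n := Module.finrank ℝ E with hn
  -- The sphere measure factor occurs in both Gaussian moments and only has to be nonzero.
  set c : ℝ := n * (volume : Measure E).real (Metric.ball 0 1) / 2
  have hc : 0 < c := by
    have h1 : 0 < n := Module.finrank_pos
    have h2 : 0 < (volume : Measure E).real (Metric.ball 0 1) :=
      ENNReal.toReal_pos (Metric.measure_ball_pos _ _ one_pos).ne' measure_ball_lt_top.ne
    positivity
  have e1 : ((n : ℝ) + (α - n)) / 2 = α / 2 := by ring
  have e2 : ((n : ℝ) + -α) / 2 = (n - α) / 2 := by ring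
  rw [e1, e2] at h
  have G1 : 0 < Real.Gamma (α / 2) := Real.Gamma_pos_of_pos (by linarith)
  have G2 : 0 < Real.Gamma ((n - α) / 2) := Real.Gamma_pos_of_pos (by linarith)
  have P1 : 0 < π ^ (-(α / 2)) := Real.rpow_pos_of_pos Real.pi_pos _
  have hD : ((c * (π ^ (-(α / 2)) * Real.Gamma (α / 2)) : ℝ) : ℂ) ≠ 0 := by
    exact_mod_cast (by positivity : c * (π ^ (-(α / 2)) * Real.Gamma (α / 2)) ≠ 0)
  apply mul_right_cancel₀ hD
  rw [← Complex.ofReal_mul (bumpMellin _), h, mul_right_comm, ← Complex.ofReal_mul]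
  congr 2
  have e3 : (2 * π) ^ α = 2 ^ α * π ^ α := Real.mul_rpow zero_le_two Real.pi_pos.le
  have e4 : π ^ α * π ^ (-(α / 2)) = π ^ (-(((n : ℝ) - α) / 2)) * π ^ ((n : ℝ) / 2) := by
    rw [← Real.rpow_add Real.pi_pos, ← Real.rpow_add Real.pi_pos]
    ring_nf
  have P2 : 0 < π ^ ((n : ℝ) / 2) := Real.rpow_pos_of_pos Real.pi_pos _
  have P3 : (0 : ℝ) < 2 ^ α := Real.rpow_pos_of_pos two_pos _
  rw [e3]
  field_simp
  linear_combination e4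

end RieszConstant

/-! ### Functionals on H̊^s as Hermitian L² functions. -/

section DualRepresentation

open Real Set
open scoped FourierTransform ComplexConjugate

theorem unitaryFourier_conj {d : ℕ} (w : EuclideanSpace ℝ (Fin d) → ℝ)
    (ξ : EuclideanSpace ℝ (Fin d)) :
    unitaryFourier (fun x => (w (-x) : ℂ)) ξ = conj (unitaryFourier (fun x => (w x : ℂ)) ξ) := by
  rw [unitaryFourier, unitaryFourier, map_mul, Complex.conj_ofReal, ← integral_conj,
    ← integral_neg_eq_self]
  congr 2
  ext x
  simp [← Complex.exp_conj]

/-- The Fourier transform of a real function is Hermitian. -/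
theorem HasFourierTransform.ae_neg_eq_conj {d : ℕ} {u : EuclideanSpace ℝ (Fin d) → ℝ}
    {g : EuclideanSpace ℝ (Fin d) → ℂ} (h : HasFourierTransform u g) :
    ∀ᵐ ξ, g (-ξ) = conj (g ξ) := by
  have hloc : LocallyIntegrable (fun ξ => g ξ - conj (g (-ξ))) := by
    refine h.1.sub ?_
    rw [locallyIntegrable_iff]
    intro K hK
    have h1 : IntegrableOn g (-K) := h.1.integrableOn_isCompact hK.neg
    have h2 : IntegrableOn (fun ξ => g (-ξ)) K := by
      have := (Measure.measurePreserving_neg (volume : Measure (EuclideanSpace ℝ (Fin d)))).integrableOn_comp_preimage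
        (MeasurableEquiv.neg _).measurableEmbedding (f := g) (s := -K)
      simp only [neg_preimage, neg_neg] at this
      exact this.mpr h1
    exact Complex.conjCLE.toContinuousLinearMap.integrable_comp h2
  have key : ∀ᵐ ξ ∂(volume : Measure (EuclideanSpace ℝ (Fin d))), g ξ - conj (g (-ξ)) = 0 := by
    apply ae_eq_zero_of_integral_contDiff_smul_eq_zero hloc
    intro w hw hw'
    have c1 : HasCompactSupport (fun x => (w x : ℂ)) := hw'.comp_left (g := Complex.ofReal) rfl
    have c2 : ContDiff ℝ ∞ (fun x => (w x : ℂ)) := Complex.ofRealCLM.contDiff.comp hw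
    have n1 : HasCompactSupport (fun x => (w (-x) : ℂ)) :=
      c1.comp_homeomorph (Homeomorph.neg _)
    have n2 : ContDiff ℝ ∞ (fun x => (w (-x) : ℂ)) := c2.comp contDiff_neg
    obtain ⟨a1, a2, a3⟩ := h.2 (c1.toSchwartzMap c2)
    obtain ⟨b1, b2, b3⟩ := h.2 (n1.toSchwartzMap n2)
    have a1' : Integrable fun ξ => g ξ * (w ξ : ℂ) := a1
    have b1' : Integrable fun ξ => g ξ * (w (-ξ) : ℂ) := b1
    have a3' : ∫ ξ, g ξ * (w ξ : ℂ) = ∫ x, (u x : ℂ) * unitaryFourier (fun x => (w x : ℂ)) x := a3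
    have b3' : ∫ ξ, g ξ * (w (-ξ) : ℂ) =
      ∫ x, (u x : ℂ) * unitaryFourier (fun x => (w (-x) : ℂ)) x := b3
    -- Reflecting the real function w conjugates its transform. As u is real, its pairing with the
    -- transform of w(-·) is the conjugate of its pairing with that of w.
    have e : ∫ ξ, conj (g (-ξ)) * (w ξ : ℂ) = ∫ ξ, g ξ * (w ξ : ℂ) := by
      rw [← integral_neg_eq_self, a3', ← Complex.conj_conj (∫ x, (u x : ℂ) * _), ← integral_conj]
      simp only [map_mul, Complex.conj_ofReal, ← unitaryFourier_conj]
      rw [← b3', ← integral_conj]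
      simp
    have i2 : Integrable fun ξ => conj (g (-ξ)) * (w ξ : ℂ) := by
      have := Complex.conjCLE.toContinuousLinearMap.integrable_comp b1'.comp_neg
      simpa using this
    have := integral_sub a1' i2
    rw [e, sub_self] at this
    rw [← this]
    refine integral_congr_ae (Filter.Eventually.of_forall fun ξ => ?_)
    simp only [Complex.real_smul]
    ring
  filter_upwards [key] with ξ hξ
  rw [sub_eq_zero] at hξ
  rw [hξ, Complex.conj_conj]

/-- The Riesz representation of a functional on `H̊^s` by an element of `L²`. -/
theorem HomSobolev.exists_L2_representation {d : ℕ} (hd : 1 ≤ d) {s : ℝ}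
    (T : StrongDual ℝ (HomSobolev d s)) :
    ∃ G : Lp ℂ 2 (volume : Measure (EuclideanSpace ℝ (Fin d))), ‖G‖ ≤ ‖T‖ ∧
      ∀ v : HomSobolev d s, T v = inner ℝ G (HomSobolev.toL2 d s v) := by
  have hinj : Function.Injective (HomSobolev.toL2 d s) := by
    rw [injective_iff_map_eq_zero]
    intro v hv
    apply HomSobolev.eq_zero_of_norm hd
    change ‖HomSobolev.toL2 d s v‖ = 0
    rw [hv, norm_zero]
  -- Definiteness of the norm lets T be transported to the range of `toL2`.
  let e := LinearEquiv.ofInjective (HomSobolev.toL2 d s) hinj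
  let f : StrongDual ℝ (LinearMap.range (HomSobolev.toL2 d s)) :=
    LinearMap.mkContinuous (T.toLinearMap ∘ₗ e.symm.toLinearMap) ‖T‖ (by
      intro p
      obtain ⟨v, rfl⟩ := e.surjective p
      simp only [LinearMap.comp_apply, LinearEquiv.coe_coe, LinearEquiv.symm_apply_apply]
      exact T.le_opNorm v)
  have hf : ‖f‖ ≤ ‖T‖ := LinearMap.mkContinuous_norm_le _ (norm_nonneg _) _
  -- Closedness of the range is not needed: Hahn–Banach extends to all of L² with the same norm, and
  -- the Riesz theorem is applied there.
  obtain ⟨g, hg, hgn⟩ := exists_extension_norm_eq _ f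
  refine ⟨(InnerProductSpace.toDual ℝ _).symm g, ?_, fun v => ?_⟩
  · rw [LinearIsometryEquiv.norm_map, hgn]
    exact hf
  · rw [InnerProductSpace.toDual_symm_apply]
    have h1 : ((e v : LinearMap.range (HomSobolev.toL2 d s)) : Lp ℂ 2 volume) =
      HomSobolev.toL2 d s v := rfl
    rw [← h1, hg]
    simp [f]

theorem integral_norm_sq_eq_norm_toLp_sq {X : Type*} [MeasurableSpace X] {μ : Measure X}
    {f : X → ℂ} (hf : MemLp f 2 μ) : ∫ x, ‖f x‖ ^ 2 ∂μ = ‖hf.toLp f‖ ^ 2 := by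
  rw [← real_inner_self_eq_norm_sq, L2.inner_def]
  refine integral_congr_ae ?_
  filter_upwards [hf.coeFn_toLp] with x hx
  rw [hx, real_inner_self_eq_norm_sq]

theorem memLp_conj {X : Type*} [MeasurableSpace X] {μ : Measure X} {p : ℝ≥0∞}
    {f : X → ℂ} (hf : MemLp f p μ) : MemLp (fun x => conj (f x)) p μ :=
  hf.star

theorem norm_integral_mul_le_norm_toLp {X : Type*} [MeasurableSpace X] {μ : Measure X}
    {f g : X → ℂ} (hf : MemLp f 2 μ) (hg : MemLp g 2 μ) :
    ‖∫ x, f x * g x ∂μ‖ ≤ ‖hf.toLp f‖ * ‖hg.toLp g‖ := by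
  have h1 : ‖(memLp_conj hf).toLp _‖ = ‖hf.toLp f‖ := by
    rw [Lp.norm_toLp, Lp.norm_toLp]
    congr 1
    exact eLpNorm_congr_norm_ae (Filter.Eventually.of_forall fun x => by simp)
  rw [← h1]
  refine le_trans (le_of_eq ?_) (norm_inner_le_norm (𝕜 := ℂ) ((memLp_conj hf).toLp _) (hg.toLp g))
  rw [L2.inner_def]
  congr 1
  refine integral_congr_ae ?_
  filter_upwards [(memLp_conj hf).coeFn_toLp, hg.coeFn_toLp] with x h1 h2
  rw [h1, h2]
  simp [mul_comm]

/-- A functional on `H̊^s` is represented by a Hermitian function in `L²` with the same norm. -/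
theorem HomSobolev.exists_hermitian_representation {d : ℕ} (hd : 1 ≤ d) {s : ℝ}
    (T : StrongDual ℝ (HomSobolev d s)) :
    ∃ H : EuclideanSpace ℝ (Fin d) → ℂ, MemLp H 2 volume ∧ (∀ ξ, H (-ξ) = conj (H ξ)) ∧
      ∫ ξ, ‖H ξ‖ ^ 2 = ‖T‖ ^ 2 ∧
      ∀ v : HomSobolev d s, (T v : ℂ) = ∫ ξ, H ξ * (‖ξ‖ ^ s • v.fourier ξ) := by
  obtain ⟨G, hG, hT⟩ := HomSobolev.exists_L2_representation hd T
  -- The half-sum of conj G(ξ) and G(-ξ) is Hermitian. Since v is real, |ξ|^s 𝓕v is Hermitian as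
  -- well, so the pairings with the two terms are conjugate and the half-sum gives the real part,
  -- which is T v.
  let A : EuclideanSpace ℝ (Fin d) → ℂ := fun ξ => conj (G ξ)
  let B : EuclideanSpace ℝ (Fin d) → ℂ := fun ξ => G (-ξ)
  have hA : MemLp A 2 volume := memLp_conj (Lp.memLp G)
  have hmp := Measure.measurePreserving_neg (volume : Measure (EuclideanSpace ℝ (Fin d)))
  have hB : MemLp B 2 volume := (Lp.memLp G).comp_measurePreserving hmp
  have hH : MemLp ((2⁻¹ : ℂ) • (A + B)) 2 volume := (hA.add hB).const_smul _
  have hAn : ‖hA.toLp A‖ = ‖G‖ := by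
    rw [Lp.norm_toLp, Lp.norm_def]
    congr 1
    exact eLpNorm_congr_norm_ae (Filter.Eventually.of_forall fun x => by simp [A])
  have hBn : ‖hB.toLp B‖ = ‖G‖ := by
    rw [Lp.norm_toLp, Lp.norm_def]
    congr 1
    exact eLpNorm_comp_measurePreserving (Lp.aestronglyMeasurable G) hmp
  have hHn : ‖hH.toLp _‖ ≤ ‖T‖ := by
    rw [MemLp.toLp_const_smul _ (hA.add hB), MemLp.toLp_add hA hB]
    calc ‖(2⁻¹ : ℂ) • (hA.toLp A + hB.toLp B)‖ ≤ ‖(2⁻¹ : ℂ)‖ * ‖hA.toLp A + hB.toLp B‖ :=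
          norm_smul_le _ _
      _ ≤ ‖(2⁻¹ : ℂ)‖ * (‖hA.toLp A‖ + ‖hB.toLp B‖) := by
          gcongr
          exact norm_add_le _ _
      _ = ‖G‖ := by
          rw [hAn, hBn, norm_inv, RCLike.norm_ofNat]
          ring
      _ ≤ ‖T‖ := hG
  have hrep : ∀ v : HomSobolev d s,
      (T v : ℂ) = ∫ ξ, ((2⁻¹ : ℂ) • (A + B)) ξ * (‖ξ‖ ^ s • v.fourier ξ) := by
    intro v
    let w : EuclideanSpace ℝ (Fin d) → ℂ := fun ξ => ‖ξ‖ ^ s • v.fourier ξ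
    have hw : MemLp w 2 volume := v.memLp_fourier
    have hws : ∀ᵐ ξ, w (-ξ) = conj (w ξ) := by
      filter_upwards [v.hasFourierTransform_fourier.ae_neg_eq_conj] with ξ hξ
      simp [w, hξ]
    have iA : Integrable (fun ξ => A ξ * w ξ) := hA.integrable_mul hw
    have iB : Integrable (fun ξ => B ξ * w ξ) := hB.integrable_mul hw
    have e1 : ∫ ξ, B ξ * w ξ = conj (∫ ξ, A ξ * w ξ) := by
      rw [← integral_conj, ← integral_neg_eq_self]
      refine integral_congr_ae ?_
      filter_upwards [hws] with ξ hξ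
      simp [A, B, hξ]
    have e2 : (T v : ℂ) = ((∫ ξ, A ξ * w ξ).re : ℂ) := by
      rw [hT v, L2.inner_def]
      congr 1
      have : ∫ ξ, inner ℝ (G ξ) ((HomSobolev.toL2 d s v) ξ) = ∫ ξ, (A ξ * w ξ).re := by
        refine integral_congr_ae ?_
        have : (HomSobolev.toL2 d s v : EuclideanSpace ℝ (Fin d) → ℂ) =ᵐ[volume] w :=
          hw.coeFn_toLp
        filter_upwards [this] with ξ hξ
        rw [hξ, Complex.inner, mul_comm]
      rw [this]
      exact integral_re iA
    have e3 : ∫ ξ, ((2⁻¹ : ℂ) • (A + B)) ξ * w ξ =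
        2⁻¹ * ((∫ ξ, A ξ * w ξ) + ∫ ξ, B ξ * w ξ) := by
      rw [← integral_add iA iB, ← integral_const_mul]
      refine integral_congr_ae (Filter.Eventually.of_forall fun ξ => ?_)
      simp only [Pi.smul_apply, Pi.add_apply, smul_eq_mul]
      ring
    rw [e2, e3, e1, Complex.add_conj]
    push_cast
    ring
  refine ⟨(2⁻¹ : ℂ) • (A + B), hH, fun ξ => ?_, ?_, hrep⟩
  · simp only [A, B, Pi.smul_apply, Pi.add_apply, smul_eq_mul, map_mul, map_add, map_inv₀, neg_neg,
      map_ofNat, Complex.conj_conj, add_comm]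
  · rw [integral_norm_sq_eq_norm_toLp_sq hH]
    congr 1
    -- Symmetrizing did not increase the norm; conversely, Cauchy–Schwarz in the representation
    -- bounds ‖T‖ by the L² norm.
    refine le_antisymm hHn (T.opNorm_le_bound (norm_nonneg _) fun v => ?_)
    have h := norm_integral_mul_le_norm_toLp hH v.memLp_fourier
    rw [← hrep v, Complex.norm_real] at h
    exact h

/-- A regular distribution in the dual of `H̊^s` tested with real test functions. -/
theorem HomSobolev.integral_mul_test_eq {d : ℕ} {s : ℝ} (hs : 0 ≤ s)
    {T : StrongDual ℝ (HomSobolev d s)} {τ : EuclideanSpace ℝ (Fin d) → ℝ}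
    (hT : HomSobolev.IsRegularDistribution T τ) {H : EuclideanSpace ℝ (Fin d) → ℂ}
    (hH : ∀ v : HomSobolev d s, (T v : ℂ) = ∫ ξ, H ξ * (‖ξ‖ ^ s • v.fourier ξ))
    {φ : EuclideanSpace ℝ (Fin d) → ℝ} (h1 : ContDiff ℝ ∞ φ) (h2 : HasCompactSupport φ) :
    ∫ x, (τ x : ℂ) * φ x =
      ∫ ξ, ((2 * π) ^ ((d : ℝ) / 2) : ℝ) * H ((2 * π) • ξ) * (((2 * π * ‖ξ‖) ^ s : ℝ) : ℂ) *
        𝓕 (fun x => (φ x : ℂ)) ξ := by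
  obtain ⟨u, hu⟩ := HomSobolev.exists_of_test (d := d) hs φ h1 h2
  have hw₁ : HasCompactSupport (fun x => (φ x : ℂ)) := h2.comp_left (g := Complex.ofReal) rfl
  have hw₂ : ContDiff ℝ ∞ (fun x => (φ x : ℂ)) := Complex.ofRealCLM.contDiff.comp h1
  have hF := hasFourierTransform_of_schwartz φ (hw₁.toSchwartzMap hw₂) (fun x => rfl)
  have hF' := u.hasFourierTransform_fourier.ae_unique (hF.congr hu.symm)
  have h := hT φ h1 h2 u hu
  have e1 : ∫ x, (τ x : ℂ) * φ x = (T u : ℂ) := by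
    rw [h, ← integral_complex_ofReal]
    push_cast
    rfl
  have e2 : ∫ ξ, H ξ * (‖ξ‖ ^ s • u.fourier ξ) =
      ∫ ξ, H ξ * (‖ξ‖ ^ s • unitaryFourier (fun x => (φ x : ℂ)) ξ) := by
    refine integral_congr_ae ?_
    filter_upwards [hF'] with ξ hξ
    rw [hξ]
    rfl
  -- The substitution ξ ↦ 2πξ passes from the unitary transform to 𝓕. Its Jacobian (2π)^d times the
  -- normalization (2π)^{-d/2} leaves the factor (2π)^{d/2}.
  have e3 := Measure.integral_comp_smul (volume : Measure (EuclideanSpace ℝ (Fin d)))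
    (fun ξ => H ξ * (‖ξ‖ ^ s • unitaryFourier (fun x => (φ x : ℂ)) ξ)) (2 * π)
  have hp : (0 : ℝ) < 2 * π := by positivity
  rw [finrank_euclideanSpace_fin, abs_of_pos (by positivity), eq_inv_smul_iff₀ (by positivity),
    ← integral_smul] at e3
  rw [e1, hH, e2, ← e3]
  refine integral_congr_ae (Filter.Eventually.of_forall fun ξ => ?_)
  simp only
  rw [unitaryFourier_eq, smul_smul, inv_mul_cancel₀ hp.ne', one_smul, norm_smul,
    Real.norm_of_nonneg hp.le]
  have e4 : (2 * π) ^ ((d : ℝ) / 2) = (2 * π) ^ d * (2 * π) ^ (-(d : ℝ) / 2) := by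
    rw [← Real.rpow_natCast, ← Real.rpow_add hp]
    ring_nf
  rw [e4]
  simp only [Complex.real_smul]
  push_cast
  ring

end DualRepresentation

/-! ### Schwartz functions with a weight |ξ|^s. -/

section SchwartzWeights

variable {E : Type*} [NormedAddCommGroup E] [InnerProductSpace ℝ E]

theorem rpow_le_one_add_pow {r s : ℝ} (hr : 0 ≤ r) (hs : 0 ≤ s) {n : ℕ} (hn : s ≤ n) :
    r ^ s ≤ 1 + r ^ n := by
  rcases le_total r 1 with h | h
  · exact (Real.rpow_le_one hr h hs).trans (by simp [pow_nonneg hr])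
  · calc r ^ s ≤ r ^ (n : ℝ) := Real.rpow_le_rpow_of_exponent_le h hn
      _ = r ^ n := Real.rpow_natCast _ _
      _ ≤ _ := by simp

theorem SchwartzMap.continuous_rpow_norm_mul {s : ℝ} (hs : 0 ≤ s) (G : 𝓢(E, ℂ)) :
    Continuous fun ξ : E => ((‖ξ‖ ^ s : ℝ) : ℂ) * G ξ :=
  (Complex.continuous_ofReal.comp (continuous_norm.rpow_const fun _ => Or.inr hs)).mul G.continuous

theorem SchwartzMap.norm_rpow_norm_mul_le {s : ℝ} (hs : 0 ≤ s) (G : 𝓢(E, ℂ)) :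
    ∃ C, ∀ ξ : E, ‖((‖ξ‖ ^ s : ℝ) : ℂ) * G ξ‖ ≤ C := by
  obtain ⟨n, hn⟩ := exists_nat_ge s
  obtain ⟨C₀, -, h0⟩ := G.decay 0 0
  obtain ⟨C, -, h1⟩ := G.decay n 0
  refine ⟨C₀ + C, fun ξ => ?_⟩
  have a := h0 ξ
  have b := h1 ξ
  have c := rpow_le_one_add_pow (norm_nonneg ξ) hs hn
  rw [norm_iteratedFDeriv_zero] at a b
  rw [norm_mul, Complex.norm_real, Real.norm_of_nonneg (by positivity)]
  nlinarith [norm_nonneg (G ξ)]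

variable [FiniteDimensional ℝ E] [MeasurableSpace E] [BorelSpace E]

theorem SchwartzMap.integrable_rpow_norm_mul {s : ℝ} (hs : 0 ≤ s) (G : 𝓢(E, ℂ)) :
    Integrable fun ξ : E => ((‖ξ‖ ^ s : ℝ) : ℂ) * G ξ := by
  obtain ⟨n, hn⟩ := exists_nat_ge s
  refine ((G.integrable (μ := volume)).norm.add (G.integrable_pow_mul volume n)).mono'
    (G.continuous_rpow_norm_mul hs).aestronglyMeasurable (Filter.Eventually.of_forall fun ξ => ?_)
  have c := rpow_le_one_add_pow (norm_nonneg ξ) hs hn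
  rw [norm_mul, Complex.norm_real, Real.norm_of_nonneg (by positivity)]
  simp only [Pi.add_apply]
  nlinarith [norm_nonneg (G ξ)]

theorem SchwartzMap.memLp_two_rpow_norm_mul {s : ℝ} (hs : 0 ≤ s) (G : 𝓢(E, ℂ)) :
    MemLp (fun ξ : E => ((‖ξ‖ ^ s : ℝ) : ℂ) * G ξ) 2 := by
  obtain ⟨C, hC⟩ := G.norm_rpow_norm_mul_le hs
  have hm := (G.continuous_rpow_norm_mul hs)
  rw [memLp_two_iff_integrable_sq_norm hm.aestronglyMeasurable]
  refine ((G.integrable_rpow_norm_mul hs).norm.const_mul C).mono'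
    (hm.norm.pow 2).aestronglyMeasurable (Filter.Eventually.of_forall fun ξ => ?_)
  rw [Real.norm_of_nonneg (by positivity), sq]
  exact mul_le_mul_of_nonneg_right (hC ξ) (norm_nonneg _)

theorem MeasureTheory.MemLp.comp_smul_two {H : E → ℂ} (hH : MemLp H 2 volume) {r : ℝ}
    (hr : r ≠ 0) : MemLp (fun ξ => H (r • ξ)) 2 volume := by
  have hm : AEStronglyMeasurable (fun ξ : E => H (r • ξ)) volume :=
    hH.1.comp_quasiMeasurePreserving (Measure.quasiMeasurePreserving_smul volume hr)
  rw [memLp_two_iff_integrable_sq_norm hm]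
  exact ((memLp_two_iff_integrable_sq_norm hH.1).mp hH).comp_smul hr

end SchwartzWeights

/-! ### The Fourier formula for τ against complex test functions. -/

section DualPairing

open Real Set
open scoped FourierTransform ComplexConjugate

/-- A regular distribution `τ` in the dual of `H̊^s` has Fourier transform `(2π|ξ|)^s H(-ξ)` with a
Hermitian function `H ∈ L²`, tested with complex test functions. -/
theorem HomSobolev.exists_fourier_pairing {d : ℕ} (hd : 1 ≤ d) {s : ℝ} (hs : 0 ≤ s)
    {T : StrongDual ℝ (HomSobolev d s)} {τ : EuclideanSpace ℝ (Fin d) → ℝ}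
    (hτ : LocallyIntegrable τ) (hT : HomSobolev.IsRegularDistribution T τ) :
    ∃ H : EuclideanSpace ℝ (Fin d) → ℂ, MemLp H 2 volume ∧ (∀ ξ, H (-ξ) = conj (H ξ)) ∧
      ∫ ξ, ‖H ξ‖ ^ 2 = ‖T‖ ^ 2 ∧
      ∀ φ : EuclideanSpace ℝ (Fin d) → ℂ, ContDiff ℝ ∞ φ → HasCompactSupport φ →
        ∫ x, (τ x : ℂ) * φ x = ∫ ξ, H ξ * (((2 * π * ‖ξ‖) ^ s : ℝ) : ℂ) * 𝓕 φ ξ := by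
  obtain ⟨H, hH, hHs, hHn, hrep⟩ := HomSobolev.exists_hermitian_representation hd T
  have hp : (0 : ℝ) < 2 * π := by positivity
  set c : ℝ := (2 * π) ^ ((d : ℝ) / 2) with hc
  -- c² is the Jacobian of the dilation by 2π, so the rescaled function keeps the L² norm of H.
  have hc2 : c ^ 2 = (2 * π) ^ d := by
    rw [hc, ← Real.rpow_natCast, ← Real.rpow_mul hp.le, ← Real.rpow_natCast]
    congr 1
    push_cast
    ring
  have hL : MemLp (fun ξ => (c : ℂ) * H ((2 * π) • ξ)) 2 volume :=
    (hH.comp_smul_two hp.ne').const_mul _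
  refine ⟨fun ξ => (c : ℂ) * H ((2 * π) • ξ), hL, fun ξ => ?_, ?_, fun φ h1 h2 => ?_⟩
  · simp [hHs]
  · have h := Measure.integral_comp_smul (volume : Measure (EuclideanSpace ℝ (Fin d)))
      (fun ξ => ‖H ξ‖ ^ 2) (2 * π)
    rw [finrank_euclideanSpace_fin, abs_of_pos (by positivity), hHn,
      eq_inv_smul_iff₀ (by positivity), ← hc2, ← integral_smul] at h
    rw [← h]
    refine integral_congr_ae (Filter.Eventually.of_forall fun ξ => ?_)
    simp only [norm_mul, Complex.norm_real, mul_pow, smul_eq_mul, Real.norm_eq_abs, sq_abs]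
  -- The distribution is given on real test functions only. Complex ones, needed later for modulated
  -- cutoffs, are reached by linearity through real and imaginary parts.
  · have r1 : ContDiff ℝ ∞ (fun x => (φ x).re) := Complex.reCLM.contDiff.comp h1
    have r2 : HasCompactSupport (fun x => (φ x).re) := h2.comp_left (g := Complex.re) rfl
    have i1 : ContDiff ℝ ∞ (fun x => (φ x).im) := Complex.imCLM.contDiff.comp h1
    have i2 : HasCompactSupport (fun x => (φ x).im) := h2.comp_left (g := Complex.im) rfl
    have hint : ∀ ψ : EuclideanSpace ℝ (Fin d) → ℝ, ContDiff ℝ ∞ ψ → HasCompactSupport ψ →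
        Integrable (fun x => (τ x : ℂ) * ψ x) ∧ Integrable (fun x => (ψ x : ℂ)) ∧
        Integrable fun ξ => ((c : ℂ) * H ((2 * π) • ξ)) * (((2 * π * ‖ξ‖) ^ s : ℝ) : ℂ) *
          𝓕 (fun x => (ψ x : ℂ)) ξ := by
      intro ψ p1 p2
      have q1 : ContDiff ℝ ∞ (fun x => (ψ x : ℂ)) := Complex.ofRealCLM.contDiff.comp p1
      have q2 : HasCompactSupport (fun x => (ψ x : ℂ)) := p2.comp_left (g := Complex.ofReal) rfl
      refine ⟨?_, q1.continuous.integrable_of_hasCompactSupport q2, ?_⟩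
      · have := (hτ.integrable_smul_left_of_hasCompactSupport p1.continuous p2).ofReal (𝕜 := ℂ)
        refine this.congr (Filter.Eventually.of_forall fun x => ?_)
        simp [mul_comm]
      · have := (hL.integrable_mul ((𝓕 (q2.toSchwartzMap q1)).memLp_two_rpow_norm_mul hs)).const_mul
          ((((2 * π) ^ s : ℝ)) : ℂ)
        refine this.congr (Filter.Eventually.of_forall fun x => ?_)
        simp only [Pi.mul_apply]
        rw [Real.mul_rpow hp.le (norm_nonneg _), SchwartzMap.fourier_coe]
        push_cast
        have : (q2.toSchwartzMap q1 : EuclideanSpace ℝ (Fin d) → ℂ) = fun x => (ψ x : ℂ) := rfl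
        rw [this]
        ring
    obtain ⟨a1, a2, a3⟩ := hint _ r1 r2
    obtain ⟨b1, b2, b3⟩ := hint _ i1 i2
    have e1 : 𝓕 φ = fun ξ => 𝓕 (fun x => ((φ x).re : ℂ)) ξ +
        Complex.I * 𝓕 (fun x => ((φ x).im : ℂ)) ξ := by
      ext ξ
      have := (Real.fourierIntegral_convergent_iff ξ).mpr a2
      have hb := (Real.fourierIntegral_convergent_iff ξ).mpr b2
      rw [Real.fourier_eq, Real.fourier_eq, Real.fourier_eq, ← integral_const_mul,
        ← integral_add this (hb.const_mul _)]
      refine integral_congr_ae (Filter.Eventually.of_forall fun x => ?_)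
      simp only [Circle.smul_def, smul_eq_mul]
      conv_lhs => rw [← Complex.re_add_im (φ x)]
      ring
    have e2 : ∫ x, (τ x : ℂ) * φ x = ∫ x, (τ x : ℂ) * (φ x).re +
        Complex.I * ((τ x : ℂ) * (φ x).im) := by
      refine integral_congr_ae (Filter.Eventually.of_forall fun x => ?_)
      simp only
      conv_lhs => rw [← Complex.re_add_im (φ x)]
      ring
    rw [e2, integral_add a1 (b1.const_mul _), integral_const_mul,
      HomSobolev.integral_mul_test_eq hs hT hrep r1 r2,
      HomSobolev.integral_mul_test_eq hs hT hrep i1 i2, ← integral_const_mul,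
      ← integral_add a3 (b3.const_mul _), e1]
    refine integral_congr_ae (Filter.Eventually.of_forall fun x => ?_)
    simp only
    ring

end DualPairing

/-! ### Absolute convergence of the localized Riesz energy. -/

section RieszIntegrability

open Real Set

variable {E : Type*} [NormedAddCommGroup E] [InnerProductSpace ℝ E] [FiniteDimensional ℝ E]
  [MeasurableSpace E] [BorelSpace E] [Nontrivial E]

theorem integrableOn_norm_rpow_ball {β : ℝ} (hβ : -(Module.finrank ℝ E : ℝ) < β) (R : ℝ) :
    IntegrableOn (fun x : E => ‖x‖ ^ β) (Metric.ball 0 R) := by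
  rw [integrableOn_fun_norm_addHaar (volume : Measure E) (f := fun r : ℝ => r ^ β)]
  have hn : 1 ≤ Module.finrank ℝ E := Module.finrank_pos
  have h1 : IntegrableOn (fun r : ℝ => r ^ ((Module.finrank ℝ E : ℝ) - 1 + β)) (Ioo 0 R) := by
    rcases le_total R 0 with hR | hR
    · rw [Ioo_eq_empty (not_lt.mpr hR)]
      exact integrableOn_empty
    · exact ((intervalIntegrable_iff_integrableOn_Ioo_of_le hR).mp
        (intervalIntegral.intervalIntegrable_rpow' (by linarith)))
  refine h1.congr_fun (fun r hr => ?_) measurableSet_Ioo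
  simp only [smul_eq_mul]
  rw [Real.rpow_add hr.1, ← Nat.cast_pred hn, Real.rpow_natCast]

theorem integrableOn_norm_rpow_compl_ball {β : ℝ} (hβ : β < -(Module.finrank ℝ E : ℝ)) {R : ℝ}
    (hR : 0 < R) : IntegrableOn (fun x : E => ‖x‖ ^ β) (Metric.ball 0 R)ᶜ := by
  have hn : 1 ≤ Module.finrank ℝ E := Module.finrank_pos
  have h0 : IntegrableOn (fun r : ℝ => r ^ ((Module.finrank ℝ E : ℝ) - 1 + β)) (Ici R) :=
    (integrableOn_Ici_iff_integrableOn_Ioi).mpr (integrableOn_Ioi_rpow_of_lt (by linarith) hR)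
  rw [← integrable_indicator_iff Metric.isOpen_ball.measurableSet.compl]
  have h1 : ((Metric.ball (0 : E) R)ᶜ.indicator fun x : E => ‖x‖ ^ β) =
      fun x : E => (Ici R).indicator (fun r : ℝ => r ^ β) ‖x‖ := by
    ext x
    simp [indicator]
  rw [h1, integrable_fun_norm_addHaar (volume : Measure E)
    (f := fun r => (Ici R).indicator (fun r : ℝ => r ^ β) r)]
  have h2 : Integrable ((Ici R).indicator
      fun r : ℝ => r ^ ((Module.finrank ℝ E : ℝ) - 1 + β)) :=
    (integrable_indicator_iff measurableSet_Ici).mpr h0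
  refine h2.integrableOn.congr_fun (fun r hr => ?_) measurableSet_Ioi
  simp only [smul_eq_mul, indicator]
  split_ifs
  · rw [Real.rpow_add hr, ← Nat.cast_pred hn, Real.rpow_natCast]
  · simp

/-- A pointwise form of Young's convolution inequality. -/
theorem mul_mul_le_rpow_add {a b c r p : ℝ} (ha : 0 ≤ a) (hb : 0 ≤ b) (hc : 0 ≤ c) (hr : 1 < r)
    (hr2 : r ≤ 2) (hp : p = r / (2 * (r - 1))) :
    a * c * b ≤ a ^ r * b ^ r + a ^ r * c ^ p + b ^ r * c ^ p := by
  have hr0 : 0 < r := by linarith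
  have hr1 : 0 < r - 1 := by linarith
  have w1 : 0 ≤ 2 / r - 1 := by
    rw [sub_nonneg, le_div_iff₀ hr0]
    linarith
  have w2 : 0 ≤ 1 - 1 / r := by
    rw [sub_nonneg, div_le_iff₀ hr0]
    linarith
  have p1 : 0 ≤ a ^ r * b ^ r := by positivity
  have p2 : 0 ≤ a ^ r * c ^ p := by positivity
  have p3 : 0 ≤ b ^ r * c ^ p := by positivity
  -- The weights sum to 1 and give a and b the exponent r(2/r - 1) + r(1 - 1/r) = 1. The exponent of
  -- c is 2p(1 - 1/r) = 1, which dictates the value of p.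
  have h := Real.geom_mean_le_arith_mean3_weighted w1 w2 w2 p1 p2 p3 (by field_simp; ring)
  have e : (a ^ r * b ^ r) ^ (2 / r - 1) * (a ^ r * c ^ p) ^ (1 - 1 / r) *
      (b ^ r * c ^ p) ^ (1 - 1 / r) = a * c * b := by
    have hpp : p * (1 - 1 / r) = 1 / 2 := by
      rw [hp]
      field_simp
    rw [Real.mul_rpow (by positivity) (by positivity), Real.mul_rpow (by positivity) (by positivity),
      Real.mul_rpow (by positivity) (by positivity), ← Real.rpow_mul ha, ← Real.rpow_mul ha,
      ← Real.rpow_mul hb, ← Real.rpow_mul hb, ← Real.rpow_mul hc, hpp]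
    have ea : ∀ x : ℝ, 0 ≤ x → x ^ (r * (2 / r - 1)) * x ^ (r * (1 - 1 / r)) = x := by
      intro x hx
      have s1 : r * (2 / r - 1) + r * (1 - 1 / r) = 1 := by
        field_simp
        ring
      rw [← Real.rpow_add_of_nonneg hx (by positivity) (by positivity), s1, Real.rpow_one]
    have ec : c ^ ((1 : ℝ) / 2) * c ^ ((1 : ℝ) / 2) = c := by
      rw [← Real.sqrt_eq_rpow, Real.mul_self_sqrt hc]
    calc _ = (a ^ (r * (2 / r - 1)) * a ^ (r * (1 - 1 / r))) *
          (c ^ ((1 : ℝ) / 2) * c ^ ((1 : ℝ) / 2)) *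
          (b ^ (r * (2 / r - 1)) * b ^ (r * (1 - 1 / r))) := by ring
      _ = _ := by rw [ea a ha, ea b hb, ec]
  rw [e] at h
  have w1' : 2 / r - 1 ≤ 1 := by
    rw [tsub_le_iff_right, div_le_iff₀ hr0]
    linarith
  have w2' : 1 - 1 / r ≤ 1 := by
    have : 0 ≤ 1 / r := by positivity
    linarith
  nlinarith

/-- The mutual Riesz energy of `τ ∈ L^q` and its localization is absolutely convergent. -/
theorem integrable_indicator_mul_norm_rpow_mul {α : ℝ} (hα : 0 < α)
    (hα' : α < Module.finrank ℝ E) {q : ℝ}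
    (hq : 2 * (Module.finrank ℝ E : ℝ) / (Module.finrank ℝ E + α) < q)
    (hq' : q < (Module.finrank ℝ E : ℝ) / α) {τ : E → ℝ} (hτ : MemLp τ (ENNReal.ofReal q) volume)
    (R : ℝ) :
    Integrable (fun z : E × E => (Metric.ball 0 R).indicator (fun x => |τ x| + 1) z.1 *
      ‖z.1 - z.2‖ ^ (α - Module.finrank ℝ E) * |τ z.2|) (volume.prod volume) := by
  set n : ℝ := (Module.finrank ℝ E : ℝ) with hn
  have hn0 : 0 < n := hα.trans hα'
  have hq1 : 1 < q := by
    refine lt_of_le_of_lt ?_ hq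
    rw [le_div_iff₀ (by linarith)]
    linarith
  have hq0 : 0 < q := by linarith
  -- exponents
  set r : ℝ := min q 2 with hr
  have hr1 : 1 < r := lt_min hq1 (by norm_num)
  have hr2 : r ≤ 2 := min_le_right _ _
  have hrq : r ≤ q := min_le_left _ _
  have hrn : 2 * n < r * (n + α) := by
    rw [div_lt_iff₀ (by linarith)] at hq
    rcases min_choice q 2 with h | h
    · rw [hr, h]
      exact hq
    · rw [hr, h]
      linarith
  obtain ⟨p, hp⟩ : ∃ p : ℝ, p = r / (2 * (r - 1)) := ⟨_, rfl⟩
  -- Equivalent to r > 2n/(n + α): the kernel to the power p is integrable near the origin. Capping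
  -- r at 2 keeps this because α > 0.
  have hpn : -n < (α - n) * p := by
    rw [hp, mul_div_assoc', lt_div_iff₀ (by linarith)]
    nlinarith
  have hpos : 0 < p := by
    rw [hp]
    have : 0 < r - 1 := by linarith
    positivity
  have hconj : q.HolderConjugate (Real.conjExponent q) := Real.HolderConjugate.conjExponent hq1
  set q' := Real.conjExponent q with hq'def
  -- Equivalent to q < n/α: the kernel to the power q' is integrable at infinity.
  have hqn : (α - n) * q' < -n := by
    have : q' = q / (q - 1) := rfl
    rw [this, mul_div_assoc', div_lt_iff₀ (by linarith)]
    rw [lt_div_iff₀ hα] at hq'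
    nlinarith
  -- the dominating functions
  set g : E → ℝ := fun x => |τ x| + 1 with hg
  have hg0 : ∀ x, 0 ≤ g x := fun x => by positivity
  have hball : volume (Metric.ball (0 : E) (R + 1)) ≠ ⊤ := measure_ball_lt_top.ne
  have hfin : IsFiniteMeasure (volume.restrict (Metric.ball (0 : E) (R + 1))) :=
    ⟨by simpa using hball.lt_top⟩
  have hgL : MemLp g (ENNReal.ofReal q) (volume.restrict (Metric.ball (0 : E) (R + 1))) :=
    (hτ.restrict _).norm.add (memLp_const 1)
  set b : E → ℝ := (Metric.ball (0 : E) (R + 1)).indicator fun x => g x ^ r with hb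
  set h : E → ℝ := (Metric.ball (0 : E) (R + 1)).indicator g with hh
  have hbi : Integrable b := by
    rw [hb, integrable_indicator_iff Metric.isOpen_ball.measurableSet]
    have h1 := (hgL.mono_exponent (ENNReal.ofReal_le_ofReal hrq)).integrable_norm_rpow
      (by simp; linarith) (by simp)
    rw [ENNReal.toReal_ofReal (by linarith)] at h1
    refine h1.congr (Filter.Eventually.of_forall fun x => ?_)
    simp only [Real.norm_of_nonneg (hg0 x)]
  have hhi : Integrable h := by
    rw [hh, integrable_indicator_iff Metric.isOpen_ball.measurableSet]
    exact hgL.integrable (by simpa using hq1.le)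
  have hτq : Integrable fun x => |τ x| ^ q := by
    have h1 := hτ.integrable_norm_rpow (by simpa using hq0) (by simp)
    rwa [ENNReal.toReal_ofReal hq0.le] at h1
  set k₁ : E → ℝ := (Metric.ball (0 : E) 1).indicator fun x => ‖x‖ ^ ((α - n) * p) with hk₁
  set k₂ : E → ℝ := (Metric.ball (0 : E) 1)ᶜ.indicator fun x => ‖x‖ ^ ((α - n) * q') with hk₂
  have hk₁i : Integrable k₁ := (integrable_indicator_iff Metric.isOpen_ball.measurableSet).mpr
    (integrableOn_norm_rpow_ball hpn 1)
  have hk₂i : Integrable k₂ := (integrable_indicator_iff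
    Metric.isOpen_ball.measurableSet.compl).mpr (integrableOn_norm_rpow_compl_ball hqn one_pos)
  have conv1 : ∀ u k : E → ℝ, Integrable u → Integrable k →
      Integrable (fun z : E × E => u z.2 * k (z.1 - z.2)) (volume.prod volume) := fun u k hu hk =>
    hu.convolution_integrand (ContinuousLinearMap.mul ℝ ℝ) hk
  have conv2 : ∀ u k : E → ℝ, Integrable u → Integrable k → (∀ x, k (-x) = k x) →
      Integrable (fun z : E × E => u z.1 * k (z.1 - z.2)) (volume.prod volume) := by
    intro u k hu hk hsymm
    refine (conv1 u k hu hk).swap.congr (Filter.Eventually.of_forall fun z => ?_)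
    simp only [Function.comp_apply, Prod.fst_swap, Prod.snd_swap]
    rw [← hsymm, neg_sub]
  have s1 : ∀ x, k₁ (-x) = k₁ x := fun x => by simp [hk₁, indicator]
  have s2 : ∀ x, k₂ (-x) = k₂ x := fun x => by simp [hk₂, indicator]
  -- The first three terms dominate the part |x - y| < 1 through the three-term Young inequality.
  -- The last two dominate the far part through Young's inequality with exponents q and q'.
  have hdom := (((((hbi.mul_prod hbi).add (conv2 b k₁ hbi hk₁i s1)).add (conv1 b k₁ hbi hk₁i)).add
    (conv2 h k₂ hhi hk₂i s2)).add (hhi.mul_prod hτq))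
  refine hdom.mono' ?_ (Filter.Eventually.of_forall fun z => ?_)
  · have hτm := hτ.1
    have hgm : AEStronglyMeasurable g volume := hτm.norm.add_const 1
    have m1 := (hgm.indicator (Metric.isOpen_ball (x := (0 : E)) (ε := R)).measurableSet).comp_fst
      (ν := (volume : Measure E))
    have m2 := (hτm.norm).comp_snd (μ := (volume : Measure E))
    have m3 : Measurable fun z : E × E => ‖z.1 - z.2‖ ^ (α - n) := by fun_prop
    exact (m1.mul m3.aestronglyMeasurable).mul m2
  · obtain ⟨x, y⟩ := z
    have nb : ∀ x, 0 ≤ b x := fun x => indicator_nonneg (fun x _ => by positivity) x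
    have nh : ∀ x, 0 ≤ h x := fun x => indicator_nonneg (fun x _ => hg0 x) x
    have nk₁ : ∀ x, 0 ≤ k₁ x := fun x => indicator_nonneg (fun x _ => by positivity) x
    have nk₂ : ∀ x, 0 ≤ k₂ x := fun x => indicator_nonneg (fun x _ => by positivity) x
    have t1 := mul_nonneg (nb x) (nb y)
    have t2 := mul_nonneg (nb x) (nk₁ (x - y))
    have t3 := mul_nonneg (nb y) (nk₁ (x - y))
    have t4 := mul_nonneg (nh x) (nk₂ (x - y))
    have t5 := mul_nonneg (nh x) (by positivity : 0 ≤ |τ y| ^ q)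
    simp only [Pi.add_apply]
    by_cases hx : x ∈ Metric.ball (0 : E) R
    · have hx' : x ∈ Metric.ball (0 : E) (R + 1) := Metric.ball_subset_ball (by linarith) hx
      rw [indicator_of_mem hx, Real.norm_of_nonneg (by positivity)]
      by_cases hxy : x - y ∈ Metric.ball (0 : E) 1
      -- A point within distance 1 of the ball of radius R stays in the ball of radius R + 1, where
      -- g^r is integrable because r ≤ q.
      · have hy : y ∈ Metric.ball (0 : E) (R + 1) := by
          rw [mem_ball_zero_iff] at *
          have := norm_sub_norm_le y x
          rw [norm_sub_rev] at this
          linarith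
        have key := mul_mul_le_rpow_add (hg0 x) (hg0 y)
          (by positivity : 0 ≤ ‖x - y‖ ^ (α - n)) hr1 hr2 hp
        rw [← Real.rpow_mul (norm_nonneg _)] at key
        have eb : ∀ x ∈ Metric.ball (0 : E) (R + 1), b x = g x ^ r := fun x hx =>
          indicator_of_mem hx _
        have ek : k₁ (x - y) = ‖x - y‖ ^ ((α - n) * p) := indicator_of_mem hxy _
        rw [← eb x hx', ← eb y hy, ← ek] at key
        have : g x * ‖x - y‖ ^ (α - n) * |τ y| ≤ g x * ‖x - y‖ ^ (α - n) * g y := by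
          have : |τ y| ≤ g y := by simp [hg]
          have := hg0 x
          gcongr
        linarith
      · have ek : k₂ (x - y) = ‖x - y‖ ^ ((α - n) * q') := indicator_of_mem (by simpa using hxy) _
        have eh : h x = g x := indicator_of_mem hx' _
        have key := Real.young_inequality_of_nonneg (abs_nonneg (τ y))
          (by positivity : 0 ≤ ‖x - y‖ ^ (α - n)) hconj
        rw [← Real.rpow_mul (norm_nonneg _), ← ek] at key
        have d1 : |τ y| ^ q / q ≤ |τ y| ^ q := div_le_self (by positivity) hq1.le
        have d2 : k₂ (x - y) / q' ≤ k₂ (x - y) := div_le_self (nk₂ _) hconj.symm.lt.le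
        have : g x * ‖x - y‖ ^ (α - n) * |τ y| ≤ h x * k₂ (x - y) + h x * |τ y| ^ q := by
          rw [eh, ← mul_add, mul_assoc]
          refine mul_le_mul_of_nonneg_left ?_ (hg0 x)
          linarith
        linarith
    · rw [indicator_of_notMem hx, zero_mul, zero_mul, norm_zero]
      linarith

end RieszIntegrability

/-! ### Uniform boundedness of multiplication by dilated cutoffs. -/

section MultiplierBound

open Real Set

theorem ENNReal.mul_le_sq_add_sq (a b : ℝ≥0∞) : a * b ≤ a ^ 2 + b ^ 2 := by
  rcases le_total a b with h | h
  · calc a * b ≤ b * b := by gcongr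
      _ = b ^ 2 := (sq b).symm
      _ ≤ _ := le_add_self
  · calc a * b ≤ a * a := by gcongr
      _ = a ^ 2 := (sq a).symm
      _ ≤ _ := le_self_add

theorem ENNReal.add_rpow_le_two_rpow_mul (a b : ℝ≥0∞) {s : ℝ} (hs : 0 ≤ s) :
    (a + b) ^ s ≤ 2 ^ s * (a ^ s + b ^ s) := by
  have h : ∀ c : ℝ≥0∞, a ≤ c → b ≤ c → (a + b) ^ s ≤ 2 ^ s * c ^ s := fun c ha hb => by
    rw [← ENNReal.mul_rpow_of_nonneg _ _ hs]
    refine ENNReal.rpow_le_rpow ?_ hs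
    rw [two_mul]
    exact add_le_add ha hb
  rcases le_total a b with hab | hab
  · exact (h b hab le_rfl).trans (by gcongr; exact le_add_self)
  · exact (h a le_rfl hab).trans (by gcongr; exact le_self_add)

variable {E : Type*} [NormedAddCommGroup E]

theorem enorm_rpow_norm {x : E} {p : ℝ} (h : x ≠ 0 ∨ 0 ≤ p) :
    ‖((‖x‖ ^ p : ℝ) : ℂ)‖ₑ = ‖x‖ₑ ^ p := by
  have h0 : ‖((‖x‖ ^ p : ℝ) : ℂ)‖ₑ = ENNReal.ofReal (‖x‖ ^ p) := by
    rw [← ofReal_norm, Complex.norm_real, Real.norm_of_nonneg (by positivity)]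
  rw [h0, ← ofReal_norm]
  rcases h with h | h
  · exact (ENNReal.ofReal_rpow_of_pos (norm_pos_iff.mpr h)).symm
  · exact (ENNReal.ofReal_rpow_of_nonneg (norm_nonneg x) h).symm

variable [InnerProductSpace ℝ E]

/-- In |εz - η|^s ≤ 2^s((ε|z|)^s + |η|^s) the second term cancels |η|^{-s}. The first leaves
(ε/|η|)^s, which is at most 1 unless |η| < ε. There the singular weight is attached to `a`, and for
m = dim E the powers of ε are distributed so that the weight on the ball and ε^m a² have integrals
independent of ε. Up to constants, every summand is a function of z or of η times a² or b², so each
integral factors. -/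
theorem multiplier_pointwise_le {s ε : ℝ} (hs : 0 ≤ s) (hε : 0 < ε) (z : E) {η : E} (hη : η ≠ 0)
    (G a b : ℝ≥0∞) (m : ℝ) :
    G * (a * ‖ε • z - η‖ₑ ^ s) * (‖η‖ₑ ^ (-s) * b) ≤
      2 ^ s * (((G * a ^ 2 + G * b ^ 2) + (‖z‖ₑ ^ s * G * a ^ 2 + ‖z‖ₑ ^ s * G * b ^ 2)) +
        ((ENNReal.ofReal ε ^ (2 * s - m) *
          (Metric.ball (0 : E) ε).indicator (fun η => ‖η‖ₑ ^ (-(2 * s))) η) *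
            (ENNReal.ofReal ε ^ m * a ^ 2) + (‖z‖ₑ ^ s * G) ^ 2 * b ^ 2)) := by
  have hε0 : ENNReal.ofReal ε ≠ 0 := by simpa using hε
  have hεt : ENNReal.ofReal ε ≠ ⊤ := ENNReal.ofReal_ne_top
  have hη0 : ‖η‖ₑ ≠ 0 := by simpa using hη
  have hηt : ‖η‖ₑ ≠ ⊤ := enorm_ne_top
  have h1 : ‖ε • z - η‖ₑ ^ s ≤ 2 ^ s * ((ENNReal.ofReal ε * ‖z‖ₑ) ^ s + ‖η‖ₑ ^ s) := by
    refine le_trans (ENNReal.rpow_le_rpow ?_ hs) (ENNReal.add_rpow_le_two_rpow_mul _ _ hs)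
    refine (enorm_sub_le).trans ?_
    rw [enorm_smul, Real.enorm_of_nonneg hε.le]
  have h2 : ‖η‖ₑ ^ s * ‖η‖ₑ ^ (-s) = 1 := by
    rw [← ENNReal.rpow_add _ _ hη0 hηt, add_neg_cancel, ENNReal.rpow_zero]
  set W := ‖z‖ₑ ^ s * G with hW
  calc G * (a * ‖ε • z - η‖ₑ ^ s) * (‖η‖ₑ ^ (-s) * b)
      ≤ G * (a * (2 ^ s * ((ENNReal.ofReal ε * ‖z‖ₑ) ^ s + ‖η‖ₑ ^ s))) * (‖η‖ₑ ^ (-s) * b) := by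
        gcongr
    _ = 2 ^ s * (G * (a * b) * (‖η‖ₑ ^ s * ‖η‖ₑ ^ (-s)) +
          W * (a * b) * (ENNReal.ofReal ε ^ s * ‖η‖ₑ ^ (-s))) := by
        rw [ENNReal.mul_rpow_of_nonneg _ _ hs, hW]
        ring
    _ ≤ _ := by
        rw [h2, mul_one, add_assoc]
        gcongr
        · rw [← mul_add]
          gcongr
          exact ENNReal.mul_le_sq_add_sq a b
        · by_cases hB : η ∈ Metric.ball (0 : E) ε
          · refine le_trans ?_ le_add_self
            rw [indicator_of_mem hB]
            have h3 := ENNReal.mul_le_sq_add_sq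
              (a * (ENNReal.ofReal ε ^ (s - m / 2) * ‖η‖ₑ ^ (-s) * ENNReal.ofReal ε ^ (m / 2)))
              (W * b)
            have h4 : ENNReal.ofReal ε ^ (s - m / 2) * ENNReal.ofReal ε ^ (m / 2) =
                ENNReal.ofReal ε ^ s := by
              rw [← ENNReal.rpow_add _ _ hε0 hεt, sub_add_cancel]
            have sq2 : ∀ (x : ℝ≥0∞) (t : ℝ), (x ^ t) ^ 2 = x ^ (2 * t) := fun x t => by
              rw [← ENNReal.rpow_natCast, ← ENNReal.rpow_mul]
              congr 1
              push_cast
              ring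
            refine le_trans (le_of_eq ?_) (h3.trans (le_of_eq ?_))
            · rw [← h4]
              ring
            · rw [mul_pow, mul_pow, mul_pow, mul_pow, sq2, sq2, sq2]
              ring_nf
          · refine le_trans ?_ le_self_add
            rw [← mul_add]
            have h5 : ENNReal.ofReal ε ^ s * ‖η‖ₑ ^ (-s) ≤ 1 := by
              rw [← h2]
              gcongr
              rw [mem_ball_zero_iff, not_lt] at hB
              rw [← ofReal_norm]
              exact ENNReal.ofReal_le_ofReal hB
            calc W * (a * b) * (ENNReal.ofReal ε ^ s * ‖η‖ₑ ^ (-s)) ≤ W * (a * b) * 1 := by gcongr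
              _ ≤ _ := by
                rw [mul_one]
                gcongr
                exact ENNReal.mul_le_sq_add_sq a b

variable [FiniteDimensional ℝ E] [MeasurableSpace E] [BorelSpace E]

theorem lintegral_comp_smul_sub (f : E → ℝ≥0∞) {ε : ℝ} (hε : 0 < ε)
    (η : E) :
    ENNReal.ofReal (ε ^ Module.finrank ℝ E) * ∫⁻ z, f (ε • z - η) = ∫⁻ z, f z := by
  have h := lintegral_sub_right_eq_self (μ := (volume : Measure E)) f η
  have hmap := Measure.map_addHaar_smul (volume : Measure E) hε.ne'
  have h2 : ∫⁻ z, f (ε • z - η) = ∫⁻ z, f (z - η) ∂(Measure.map (ε • ·) volume) :=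
    ((Homeomorph.smulOfNeZero ε hε.ne').toMeasurableEquiv.measurableEmbedding.lintegral_map
      (fun z => f (z - η))).symm
  rw [h2, hmap, lintegral_smul_measure, h, smul_eq_mul, ← mul_assoc, ← ENNReal.ofReal_mul (by positivity),
    abs_of_pos (by positivity), mul_inv_cancel₀ (by positivity), ENNReal.ofReal_one, one_mul]

/-- The exponent 2s - n is the one that makes the weight scale invariant. This is where uniformity
in ε at low frequencies comes from; finiteness of the integral, from 2s < n, is a separate matter.
-/
theorem lintegral_ball_enorm_rpow {s ε : ℝ} (hε : 0 < ε) :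
    ENNReal.ofReal ε ^ (2 * s - Module.finrank ℝ E) *
      ∫⁻ η in Metric.ball (0 : E) ε, ‖η‖ₑ ^ (-(2 * s)) =
      ∫⁻ η in Metric.ball (0 : E) 1, ‖η‖ₑ ^ (-(2 * s)) := by
  have h := lintegral_comp_smul_sub
    ((Metric.ball (0 : E) ε).indicator fun η => ‖η‖ₑ ^ (-(2 * s))) hε 0
  simp only [sub_zero] at h
  have hε0 : ENNReal.ofReal ε ≠ 0 := by simpa using hε
  have e : ∀ z : E, (Metric.ball (0 : E) ε).indicator (fun η => ‖η‖ₑ ^ (-(2 * s))) (ε • z) =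
      ENNReal.ofReal ε ^ (-(2 * s)) *
        (Metric.ball (0 : E) 1).indicator (fun η => ‖η‖ₑ ^ (-(2 * s))) z := by
    intro z
    have hm : ε • z ∈ Metric.ball (0 : E) ε ↔ z ∈ Metric.ball (0 : E) 1 := by
      rw [mem_ball_zero_iff, mem_ball_zero_iff, norm_smul, Real.norm_of_nonneg hε.le]
      constructor
      · intro h
        by_contra h'
        nlinarith
      · intro h
        nlinarith
    by_cases hz : z ∈ Metric.ball (0 : E) 1
    · rw [indicator_of_mem hz, indicator_of_mem (hm.mpr hz), enorm_smul,
        ENNReal.mul_rpow_of_ne_top enorm_ne_top enorm_ne_top, Real.enorm_of_nonneg hε.le]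
    · rw [indicator_of_notMem hz, indicator_of_notMem (fun h => hz (hm.mp h)), mul_zero]
  rw [lintegral_indicator Metric.isOpen_ball.measurableSet] at h
  simp only [e] at h
  rw [lintegral_const_mul' _ _ (ENNReal.rpow_ne_top_of_ne_zero hε0 ENNReal.ofReal_ne_top),
    lintegral_indicator Metric.isOpen_ball.measurableSet] at h
  rw [← h, ← mul_assoc, ← mul_assoc, ← Real.rpow_natCast, ← ENNReal.ofReal_rpow_of_pos hε,
    ← ENNReal.rpow_add _ _ hε0 ENNReal.ofReal_ne_top,
    ← ENNReal.rpow_add _ _ hε0 ENNReal.ofReal_ne_top]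
  ring_nf
  simp

variable [Nontrivial E]

theorem lintegral_unit_ball_enorm_rpow_ne_top {s : ℝ} (hs : s < (Module.finrank ℝ E : ℝ) / 2) :
    ∫⁻ η in Metric.ball (0 : E) 1, ‖η‖ₑ ^ (-(2 * s)) ≠ ⊤ := by
  have h := (integrableOn_norm_rpow_ball (E := E) (β := -(2 * s)) (by linarith) 1).ofReal
    (𝕜 := ℂ)
  have h2 := h.2
  rw [hasFiniteIntegral_iff_enorm] at h2
  refine ne_of_lt (lt_of_le_of_lt (le_of_eq ?_) h2)
  refine lintegral_congr_ae (ae_restrict_of_ae ?_)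
  filter_upwards [ae_ne_zero (E := E)] with x hx
  exact (enorm_rpow_norm (Or.inl hx)).symm

/-- Multiplication by a dilated Schwartz cutoff is bounded on the homogeneous Sobolev space,
uniformly in the dilation; here in terms of Fourier transforms. -/
theorem exists_lintegral_multiplier_le {s : ℝ} (hs : 0 ≤ s)
    (hs' : s < (Module.finrank ℝ E : ℝ) / 2) (G : 𝓢(E, ℂ)) :
    ∃ C : ℝ≥0∞, C ≠ ⊤ ∧ ∀ ε : ℝ, 0 < ε → ∀ f g : E → ℝ≥0∞, Measurable f → Measurable g →
      ∫⁻ p : E × E, ‖G p.1‖ₑ * (f (ε • p.1 - p.2) * ‖ε • p.1 - p.2‖ₑ ^ s) *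
        (‖p.2‖ₑ ^ (-s) * g p.2) ∂(volume.prod volume) ≤
      C * ((∫⁻ x, f x ^ 2) + ∫⁻ x, g x ^ 2) := by
  have hGm : Measurable G := G.continuous.measurable
  set W : E → ℝ≥0∞ := fun z => ‖z‖ₑ ^ s * ‖G z‖ₑ with hW
  have hWm : Measurable W := by fun_prop
  have hWe : ∀ z, W z = ‖((‖z‖ ^ s : ℝ) : ℂ) * G z‖ₑ := fun z => by
    rw [enorm_mul, enorm_rpow_norm (Or.inr hs)]
  set A := ∫⁻ z, ‖G z‖ₑ with hA
  set B := ∫⁻ z, W z with hB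
  set D := ∫⁻ z, W z ^ 2 with hD
  set c := ∫⁻ η in Metric.ball (0 : E) 1, ‖η‖ₑ ^ (-(2 * s)) with hc
  have hAt : A ≠ ⊤ := (G.integrable (μ := volume)).2.ne
  have hBt : B ≠ ⊤ := by
    simp only [hB, hWe]
    exact (G.integrable_rpow_norm_mul hs).2.ne
  have hDt : D ≠ ⊤ := by
    have h := G.memLp_two_rpow_norm_mul hs
    have h2 := ((memLp_two_iff_integrable_sq_norm h.1).mp h).2.ne
    simpa only [hD, hWe, enorm_pow, enorm_norm] using h2
  have hct : c ≠ ⊤ := lintegral_unit_ball_enorm_rpow_ne_top hs'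
  refine ⟨2 ^ s * ((A + B) + (c + D)), ?_, fun ε hε f g hf hg => ?_⟩
  · refine ENNReal.mul_ne_top (ENNReal.rpow_ne_top_of_nonneg hs (by simp)) ?_
    simp [hAt, hBt, hct, hDt]
  set n := Module.finrank ℝ E with hn
  have hεn : ENNReal.ofReal ε ^ (n : ℝ) = ENNReal.ofReal (ε ^ n) := by
    rw [ENNReal.rpow_natCast, ENNReal.ofReal_pow hε.le]
  have hae : ∀ᵐ p : E × E ∂(volume.prod volume), p.2 ≠ 0 :=
    Measure.quasiMeasurePreserving_snd.ae (ae_ne_zero (E := E))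
  set ρ : E → ℝ≥0∞ := fun η => ENNReal.ofReal ε ^ (2 * s - (n : ℝ)) *
    (Metric.ball (0 : E) ε).indicator (fun η => ‖η‖ₑ ^ (-(2 * s))) η with hρ
  have hρm : Measurable ρ := by
    refine Measurable.const_mul (Measurable.indicator ?_ Metric.isOpen_ball.measurableSet) _
    fun_prop
  have hρi : ∫⁻ η, ρ η = c := by
    rw [hρ, lintegral_const_mul _ (Measurable.indicator (by fun_prop)
      Metric.isOpen_ball.measurableSet), lintegral_indicator Metric.isOpen_ball.measurableSet,
      lintegral_ball_enorm_rpow hε]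
  have i1 : ∀ u : E → ℝ≥0∞, Measurable u →
      ∫⁻ p : E × E, u p.1 * f (ε • p.1 - p.2) ^ 2 ∂(volume.prod volume) =
        (∫⁻ z, u z) * ∫⁻ x, f x ^ 2 := by
    intro u hu
    rw [lintegral_prod _ (by fun_prop)]
    have : ∀ z, ∫⁻ η, u z * f (ε • z - η) ^ 2 = u z * ∫⁻ x, f x ^ 2 := fun z => by
      rw [lintegral_const_mul _ (by fun_prop),
        lintegral_sub_left_eq_self (fun x => f x ^ 2) (ε • z)]
    simp only [this]
    rw [lintegral_mul_const _ hu]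
  have i2 : ∀ u : E → ℝ≥0∞, Measurable u →
      ∫⁻ p : E × E, u p.1 * g p.2 ^ 2 ∂(volume.prod volume) =
        (∫⁻ z, u z) * ∫⁻ x, g x ^ 2 := by
    intro u hu
    exact lintegral_prod_mul hu.aemeasurable (hg.pow_const 2).aemeasurable
  -- Here z is integrated first, for fixed η: the factor ε^n absorbs the Jacobian of z ↦ εz - η, and
  -- the weight in η then integrates to c.
  have i3 : ∫⁻ p : E × E, ρ p.2 * (ENNReal.ofReal ε ^ (n : ℝ) * f (ε • p.1 - p.2) ^ 2)
      ∂(volume.prod volume) = c * ∫⁻ x, f x ^ 2 := by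
    rw [lintegral_prod_symm _ (by fun_prop)]
    have : ∀ η, ∫⁻ z, ρ η * (ENNReal.ofReal ε ^ (n : ℝ) * f (ε • z - η) ^ 2) =
        ρ η * ∫⁻ x, f x ^ 2 := fun η => by
      rw [lintegral_const_mul _ (by fun_prop), lintegral_const_mul _ (by fun_prop), hεn,
        lintegral_comp_smul_sub (fun x => f x ^ 2) hε η]
    simp only [this]
    rw [lintegral_mul_const _ hρm, hρi]
  calc _ ≤ ∫⁻ p : E × E, 2 ^ s * (((‖G p.1‖ₑ * f (ε • p.1 - p.2) ^ 2 + ‖G p.1‖ₑ * g p.2 ^ 2) +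
          (W p.1 * f (ε • p.1 - p.2) ^ 2 + W p.1 * g p.2 ^ 2)) +
          (ρ p.2 * (ENNReal.ofReal ε ^ (n : ℝ) * f (ε • p.1 - p.2) ^ 2) +
            W p.1 ^ 2 * g p.2 ^ 2)) ∂(volume.prod volume) := by
        refine lintegral_mono_ae ?_
        filter_upwards [hae] with p hp
        exact multiplier_pointwise_le hs hε p.1 hp _ _ _ n
    _ = 2 ^ s * (((A * ∫⁻ x, f x ^ 2) + (A * ∫⁻ x, g x ^ 2) +
          ((B * ∫⁻ x, f x ^ 2) + (B * ∫⁻ x, g x ^ 2))) +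
          ((c * ∫⁻ x, f x ^ 2) + (D * ∫⁻ x, g x ^ 2))) := by
        rw [lintegral_const_mul _ (by fun_prop), lintegral_add_left (by fun_prop),
          lintegral_add_left (by fun_prop), lintegral_add_left (by fun_prop),
          lintegral_add_left (by fun_prop), lintegral_add_left (by fun_prop),
          i1 W hWm, i2 W hWm, i1 (fun z => ‖G z‖ₑ) (by fun_prop),
          i2 (fun z => ‖G z‖ₑ) (by fun_prop), i2 (fun z => W z ^ 2) (by fun_prop), i3]
    _ ≤ 2 ^ s * ((A * ((∫⁻ x, f x ^ 2) + ∫⁻ x, g x ^ 2) + B * ((∫⁻ x, f x ^ 2) + ∫⁻ x, g x ^ 2)) +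
          (c * ((∫⁻ x, f x ^ 2) + ∫⁻ x, g x ^ 2) + D * ((∫⁻ x, f x ^ 2) + ∫⁻ x, g x ^ 2))) := by
        rw [mul_add A, mul_add B]
        gcongr
        · exact le_self_add
        · exact le_add_self
    _ = _ := by ring

end MultiplierBound

/-! ### The dilated bilinear forms and their limit as ε → 0. -/

section DilationLimit

open Real Set Filter Topology

variable {E : Type*} [NormedAddCommGroup E]

theorem norm_rpow_neg_mul_le {s : ℝ} (x : E) (z : ℂ) :
    ‖((‖x‖ ^ (-s) : ℝ) : ℂ) * z‖ ≤ ‖x‖ ^ (-(2 * s)) + ‖z‖ ^ 2 := by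
  rw [norm_mul, Complex.norm_real, Real.norm_of_nonneg (by positivity)]
  have : ‖x‖ ^ (-s) * ‖x‖ ^ (-s) ≤ ‖x‖ ^ (-(2 * s)) := by
    rcases eq_or_ne x 0 with rfl | hx
    · rcases eq_or_ne s 0 with rfl | hs
      · simp
      · have h1 : -s ≠ 0 := neg_ne_zero.mpr hs
        simp [Real.zero_rpow h1]
        positivity
    · rw [← Real.rpow_add (norm_pos_iff.mpr hx)]
      ring_nf
      exact le_rfl
  nlinarith [sq_nonneg (‖x‖ ^ (-s) - ‖z‖), sq_nonneg (‖x‖ ^ (-s)), sq_nonneg (‖z‖)]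

variable [InnerProductSpace ℝ E] [FiniteDimensional ℝ E] [MeasurableSpace E] [BorelSpace E]

/-- The integrand of the form `(f, g) ↦ ∫∫ |ξ|^s f(ξ) ε⁻ⁿ G((ξ+η)/ε) |η|^{-s} g(η) dξ dη`
in the variables `((ξ+η)/ε, η)`. -/
noncomputable def dilatedIntegrand (s : ℝ) (G : 𝓢(E, ℂ)) (ε : ℝ) (f g : E → ℂ) (p : E × E) : ℂ :=
  G p.1 * (f (ε • p.1 - p.2) * ((‖ε • p.1 - p.2‖ ^ s : ℝ) : ℂ)) *
    (((‖p.2‖ ^ (-s) : ℝ) : ℂ) * g p.2)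

theorem measurable_dilatedIntegrand {s : ℝ} (G : 𝓢(E, ℂ)) (ε : ℝ) {f g : E → ℂ}
    (hf : Measurable f) (hg : Measurable g) : Measurable (dilatedIntegrand s G ε f g) := by
  have hGm : Measurable G := G.continuous.measurable
  unfold dilatedIntegrand
  fun_prop

theorem lintegral_enorm_sq_eq {X : Type*} [MeasurableSpace X] {μ : Measure X} {f : X → ℂ}
    (hf : MemLp f 2 μ) : ∫⁻ x, ‖f x‖ₑ ^ 2 ∂μ = ENNReal.ofReal (∫ x, ‖f x‖ ^ 2 ∂μ) := by
  rw [ofReal_integral_eq_lintegral_ofReal ((memLp_two_iff_integrable_sq_norm hf.1).mp hf)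
    (Eventually.of_forall fun x => by positivity)]
  refine lintegral_congr fun x => ?_
  rw [ENNReal.ofReal_pow (norm_nonneg _), ofReal_norm]

theorem exists_continuous_integral_norm_sq_sub_le {f : E → ℂ} (hf : MemLp f 2 volume) {δ : ℝ}
    (hδ : 0 < δ) : ∃ g : E → ℂ, HasCompactSupport g ∧ Continuous g ∧ MemLp g 2 volume ∧
      ∫ x, ‖(f - g) x‖ ^ 2 ≤ δ := by
  obtain ⟨g, h1, h2, h3, h4⟩ := hf.exists_hasCompactSupport_eLpNorm_sub_le (by simp)
    (ε := ENNReal.ofReal (√δ)) (by simpa using hδ)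
  refine ⟨g, h1, h3, h4, ?_⟩
  rw [integral_norm_sq_eq_norm_toLp_sq (hf.sub h4), Lp.norm_toLp]
  calc (eLpNorm (f - g) 2 volume).toReal ^ 2 ≤ (√δ) ^ 2 := by
        gcongr
        exact ENNReal.toReal_le_of_le_ofReal (Real.sqrt_nonneg _) h2
    _ = δ := Real.sq_sqrt hδ.le

theorem norm_integral_neg_mul_le {f g : E → ℂ} (hf : MemLp f 2 volume) (hg : MemLp g 2 volume) :
    ‖∫ η, f (-η) * g η‖ ≤ (∫ x, ‖f x‖ ^ 2) + ∫ x, ‖g x‖ ^ 2 := by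
  have hfi := ((memLp_two_iff_integrable_sq_norm hf.1).mp hf).comp_neg
  have hgi := (memLp_two_iff_integrable_sq_norm hg.1).mp hg
  rw [← integral_neg_eq_self (fun x => ‖f x‖ ^ 2), ← integral_add hfi hgi]
  refine norm_integral_le_of_norm_le (hfi.add hgi) (Eventually.of_forall fun η => ?_)
  rw [norm_mul]
  nlinarith [sq_nonneg (‖f (-η)‖ - ‖g η‖), norm_nonneg (f (-η)), norm_nonneg (g η)]

variable [Nontrivial E]

theorem exists_norm_integral_dilatedIntegrand_le {s : ℝ} (hs : 0 ≤ s)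
    (hs' : s < (Module.finrank ℝ E : ℝ) / 2) (G : 𝓢(E, ℂ)) :
    ∃ C : ℝ, 0 ≤ C ∧ ∀ ε : ℝ, 0 < ε → ∀ f g : E → ℂ, Measurable f → Measurable g →
      MemLp f 2 volume → MemLp g 2 volume →
      Integrable (dilatedIntegrand s G ε f g) (volume.prod volume) ∧
      ‖∫ p, dilatedIntegrand s G ε f g p ∂(volume.prod volume)‖ ≤
        C * ((∫ x, ‖f x‖ ^ 2) + ∫ x, ‖g x‖ ^ 2) := by
  obtain ⟨C, hC, h⟩ := exists_lintegral_multiplier_le hs hs' G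
  refine ⟨C.toReal, ENNReal.toReal_nonneg, fun ε hε f g hf hg hf2 hg2 => ?_⟩
  have h1 := h ε hε (fun x => ‖f x‖ₑ) (fun x => ‖g x‖ₑ) hf.enorm hg.enorm
  rw [lintegral_enorm_sq_eq hf2, lintegral_enorm_sq_eq hg2, ← ENNReal.ofReal_add
    (integral_nonneg fun _ => by positivity) (integral_nonneg fun _ => by positivity),
    ← ENNReal.ofReal_toReal hC, ← ENNReal.ofReal_mul ENNReal.toReal_nonneg] at h1
  have h2 : ∫⁻ p, ‖dilatedIntegrand s G ε f g p‖ₑ ∂(volume.prod volume) ≤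
      ENNReal.ofReal (C.toReal * ((∫ x, ‖f x‖ ^ 2) + ∫ x, ‖g x‖ ^ 2)) := by
    refine le_trans (le_of_eq (lintegral_congr_ae ?_)) h1
    filter_upwards [Measure.quasiMeasurePreserving_snd.ae (ae_ne_zero (E := E))] with p hp
    simp only [dilatedIntegrand, enorm_mul, enorm_rpow_norm (Or.inr hs),
      enorm_rpow_norm (Or.inl hp)]
  have hint : Integrable (dilatedIntegrand s G ε f g) (volume.prod volume) :=
    ⟨(measurable_dilatedIntegrand G ε hf hg).aestronglyMeasurable,
      lt_of_le_of_lt h2 ENNReal.ofReal_lt_top⟩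
  refine ⟨hint, ?_⟩
  refine ENNReal.ofReal_le_ofReal_iff (mul_nonneg ENNReal.toReal_nonneg (add_nonneg
    (integral_nonneg fun _ => by positivity) (integral_nonneg fun _ => by positivity))) |>.mp ?_
  rw [ofReal_norm]
  exact (enorm_integral_le_lintegral_enorm _).trans h2

/-- By AM–GM the function is bounded by |x|^{-2s} + |g|², and |x|^{-2s} is locally integrable for 2s
< n. -/
theorem integrableOn_norm_rpow_neg_mul {s : ℝ} (hs' : s < (Module.finrank ℝ E : ℝ) / 2) {g : E → ℂ}
    (hg : Measurable g) (hg2 : MemLp g 2 volume) (R : ℝ) :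
    IntegrableOn (fun x : E => ((‖x‖ ^ (-s) : ℝ) : ℂ) * g x) (Metric.ball 0 R) := by
  have h1 := (integrableOn_norm_rpow_ball (E := E) (β := -(2 * s)) (by linarith) R)
  have h2 := ((memLp_two_iff_integrable_sq_norm hg2.1).mp hg2).integrableOn
    (s := Metric.ball (0 : E) R)
  exact (h1.add h2).mono' (by fun_prop : Measurable _).aestronglyMeasurable
    (Eventually.of_forall fun x => norm_rpow_neg_mul_le x (g x))

theorem locallyIntegrable_norm_rpow_neg_mul {s : ℝ} (hs' : s < (Module.finrank ℝ E : ℝ) / 2)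
    {g : E → ℂ} (hg : Measurable g) (hg2 : MemLp g 2 volume) :
    LocallyIntegrable (fun x : E => ((‖x‖ ^ (-s) : ℝ) : ℂ) * g x) := by
  rw [locallyIntegrable_iff]
  intro K hK
  obtain ⟨R, hR⟩ := hK.isBounded.subset_ball (0 : E)
  exact (integrableOn_norm_rpow_neg_mul hs' hg hg2 R).mono_set hR

/-- The inner integral over η is the convolution Φ of F = f|·|^s, continuous with compact support,
with u = |·|^{-s} g, locally integrable, evaluated at εz. As Φ is continuous and bounded, dominated
convergence against G replaces Φ(εz) by Φ(0), where the two weights cancel. -/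
theorem tendsto_integral_dilatedIntegrand_of_continuous {s : ℝ} (hs : 0 < s)
    (hs' : s < (Module.finrank ℝ E : ℝ) / 2) (G : 𝓢(E, ℂ)) {f g : E → ℂ} (hf : Continuous f)
    (hfc : HasCompactSupport f) (hg : Measurable g) (hg2 : MemLp g 2 volume) {ε : ℕ → ℝ}
    (hε : ∀ k, 0 < ε k) (hε0 : Tendsto ε atTop (𝓝 0)) :
    Tendsto (fun k => ∫ p, dilatedIntegrand s G (ε k) f g p ∂(volume.prod volume)) atTop
      (𝓝 ((∫ z, G z) * ∫ η, f (-η) * g η)) := by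
  have hf2 : MemLp f 2 volume := hf.memLp_of_hasCompactSupport hfc
  obtain ⟨C, -, hC⟩ := exists_norm_integral_dilatedIntegrand_le hs.le hs' G
  -- the inner integral is a convolution
  set F : E → ℂ := fun ξ => f ξ * ((‖ξ‖ ^ s : ℝ) : ℂ) with hF
  have hFc : Continuous F := hf.mul
    (Complex.continuous_ofReal.comp (continuous_norm.rpow_const fun _ => Or.inr hs.le))
  have hFs : HasCompactSupport F := hfc.mul_right
  set u : E → ℂ := fun η => ((‖η‖ ^ (-s) : ℝ) : ℂ) * g η with hu
  have hul : LocallyIntegrable u := locallyIntegrable_norm_rpow_neg_mul hs' hg hg2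
  set Φ : E → ℂ := fun w => ∫ η, F (w - η) * u η with hΦ
  have hΦc : Continuous Φ := by
    have := hFs.continuous_convolution_right (ContinuousLinearMap.mul ℝ ℂ) hul hFc (μ := volume)
    refine this.congr fun w => ?_
    rw [hΦ, convolution_def]
    refine integral_congr_ae (Eventually.of_forall fun η => ?_)
    simp [mul_comm]
  obtain ⟨M, hM⟩ := hFs.exists_bound_of_continuous hFc
  have hF2 : MemLp F 2 volume := hFc.memLp_of_hasCompactSupport hFs
  have hFi := (memLp_two_iff_integrable_sq_norm hF2.1).mp hF2
  have hgi := (memLp_two_iff_integrable_sq_norm hg2.1).mp hg2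
  have hui : Integrable ((Metric.ball (0 : E) 1).indicator fun η => ‖u η‖) :=
    (integrable_indicator_iff Metric.isOpen_ball.measurableSet).mpr
      (integrableOn_norm_rpow_neg_mul hs' hg hg2 1).norm
  -- On the unit ball F is bounded by M and u is integrable; outside it |u| ≤ |g| and AM–GM applies,
  -- with a bound independent of the translation w.
  set M' : ℝ := M * (∫ η, (Metric.ball (0 : E) 1).indicator (fun η => ‖u η‖) η) +
    ((∫ η, ‖F η‖ ^ 2) + ∫ η, ‖g η‖ ^ 2) with hM'
  have hΦb : ∀ w, ‖Φ w‖ ≤ M' := by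
    intro w
    have hFw : Integrable fun η => ‖F (w - η)‖ ^ 2 := hFi.comp_sub_left w
    have hsum : Integrable fun η => ‖F (w - η)‖ ^ 2 + ‖g η‖ ^ 2 := hFw.add hgi
    have hdom := (hui.const_mul M).add hsum
    have e : ∫ η, (M * (Metric.ball (0 : E) 1).indicator (fun η => ‖u η‖) η +
        (‖F (w - η)‖ ^ 2 + ‖g η‖ ^ 2)) = M' := by
      rw [integral_add (hui.const_mul M) hsum, integral_add hFw hgi, integral_const_mul,
        integral_sub_left_eq_self (fun η => ‖F η‖ ^ 2) volume w]
    rw [← e]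
    refine norm_integral_le_of_norm_le hdom (Eventually.of_forall fun η => ?_)
    rw [norm_mul]
    have n1 : 0 ≤ ‖F (w - η)‖ ^ 2 := by positivity
    have n2 : 0 ≤ ‖g η‖ ^ 2 := by positivity
    have hM0 : 0 ≤ M := (norm_nonneg _).trans (hM 0)
    by_cases hη : η ∈ Metric.ball (0 : E) 1
    · rw [indicator_of_mem hη]
      have := mul_le_mul_of_nonneg_right (hM (w - η)) (norm_nonneg (u η))
      linarith
    · rw [indicator_of_notMem hη, mul_zero, zero_add]
      have h1 : ‖u η‖ ≤ ‖g η‖ := by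
        rw [hu, norm_mul, Complex.norm_real, Real.norm_of_nonneg (by positivity)]
        refine mul_le_of_le_one_left (norm_nonneg _) ?_
        rw [mem_ball_zero_iff, not_lt] at hη
        exact Real.rpow_le_one_of_one_le_of_nonpos hη (by linarith)
      have h2 := mul_le_mul_of_nonneg_left h1 (norm_nonneg (F (w - η)))
      nlinarith [sq_nonneg (‖F (w - η)‖ - ‖g η‖)]
  have e1 : ∀ k, ∫ p, dilatedIntegrand s G (ε k) f g p ∂(volume.prod volume) =
      ∫ z, G z * Φ (ε k • z) := by
    intro k
    rw [integral_prod _ (hC (ε k) (hε k) f g hf.measurable hg hf2 hg2).1]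
    refine integral_congr_ae (Eventually.of_forall fun z => ?_)
    simp only [dilatedIntegrand, hΦ, mul_assoc]
    rw [integral_const_mul]
    simp only [hF, hu, mul_assoc]
  have e2 : (∫ z, G z) * ∫ η, f (-η) * g η = ∫ z, G z * Φ 0 := by
    rw [integral_mul_const]
    congr 1
    refine integral_congr_ae ?_
    filter_upwards [ae_ne_zero (E := E)] with η hη
    have : (‖η‖ ^ s : ℝ) * (‖η‖ ^ (-s) : ℝ) = 1 := by
      rw [← Real.rpow_add (norm_pos_iff.mpr hη), add_neg_cancel, Real.rpow_zero]
    simp only [hF, hu, zero_sub, norm_neg]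
    calc f (-η) * g η = f (-η) * g η * ((‖η‖ ^ s * ‖η‖ ^ (-s) : ℝ) : ℂ) := by
          rw [this]
          simp
      _ = _ := by
          push_cast
          ring
  simp only [e1]
  rw [e2]
  refine tendsto_integral_of_dominated_convergence (fun z => ‖G z‖ * M')
    (fun k => (G.continuous.mul (hΦc.comp (continuous_const_smul _))).aestronglyMeasurable)
    ((G.integrable (μ := volume)).norm.mul_const _) (fun k => Eventually.of_forall fun z => ?_)
    (Eventually.of_forall fun z => ?_)
  · rw [norm_mul]
    exact mul_le_mul_of_nonneg_left (hΦb _) (norm_nonneg _)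
  · refine Tendsto.const_mul _ ?_
    have : Tendsto (fun k => ε k • z) atTop (𝓝 0) := by
      simpa using hε0.smul_const z
    exact (hΦc.tendsto 0).comp this

/-- Multiplication by dilated cutoffs converges weakly to a multiple of the identity. -/
theorem tendsto_integral_dilatedIntegrand {s : ℝ} (hs : 0 < s)
    (hs' : s < (Module.finrank ℝ E : ℝ) / 2) (G : 𝓢(E, ℂ)) {f g : E → ℂ} (hf : Measurable f)
    (hf2 : MemLp f 2 volume) (hg : Measurable g) (hg2 : MemLp g 2 volume) {ε : ℕ → ℝ}
    (hε : ∀ k, 0 < ε k) (hε0 : Tendsto ε atTop (𝓝 0)) :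
    Tendsto (fun k => ∫ p, dilatedIntegrand s G (ε k) f g p ∂(volume.prod volume)) atTop
      (𝓝 ((∫ z, G z) * ∫ η, f (-η) * g η)) := by
  obtain ⟨C, hC0, hC⟩ := exists_norm_integral_dilatedIntegrand_le hs.le hs' G
  set c := ∫ z, G z with hc
  set N : ℝ := ∫ x, ‖g x‖ ^ 2 with hN
  have hN0 : 0 ≤ N := integral_nonneg fun _ => by positivity
  set D := C + ‖c‖ with hD
  have hD0 : 0 ≤ D := by positivity
  -- the difference of the form and its limit, as a bounded bilinear form
  have key : ∀ k (r : ℝ), 0 < r → ∀ h : E → ℂ, Measurable h → MemLp h 2 volume →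
      ‖(∫ p, dilatedIntegrand s G (ε k) h g p ∂(volume.prod volume)) - c * ∫ η, h (-η) * g η‖ ≤
        D * (r⁻¹ ^ 2 * (∫ x, ‖h x‖ ^ 2) + r ^ 2 * N) := by
    intro k r hr h hh hh2
    have hrc : (r : ℂ) ≠ 0 := by exact_mod_cast hr.ne'
    have hh' : MemLp (fun x => ((r⁻¹ : ℝ) : ℂ) * h x) 2 volume := hh2.const_mul _
    have hg' : MemLp (fun x => (r : ℂ) * g x) 2 volume := hg2.const_mul _
    -- The forms are bilinear, hence unchanged under (h, g) ↦ (r⁻¹h, rg). A bound by a sum of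
    -- squares thus becomes one in which the term with g can be made small.
    have b1 := (hC (ε k) (hε k) _ _ (hh.const_mul _) (hg.const_mul _) hh' hg').2
    have b2 := norm_integral_neg_mul_le hh' hg'
    have e1 : ∀ p, dilatedIntegrand s G (ε k) (fun x => ((r⁻¹ : ℝ) : ℂ) * h x)
        (fun x => (r : ℂ) * g x) p = dilatedIntegrand s G (ε k) h g p := by
      intro p
      simp only [dilatedIntegrand]
      push_cast
      field_simp
    have e2 : ∀ η, ((r⁻¹ : ℝ) : ℂ) * h (-η) * ((r : ℂ) * g η) = h (-η) * g η := by
      intro η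
      push_cast
      field_simp
    have n1 : (∫ x, ‖((r⁻¹ : ℝ) : ℂ) * h x‖ ^ 2) = r⁻¹ ^ 2 * ∫ x, ‖h x‖ ^ 2 := by
      rw [← integral_const_mul]
      refine integral_congr_ae (Eventually.of_forall fun x => ?_)
      simp only [norm_mul, Complex.norm_real, mul_pow, Real.norm_eq_abs, sq_abs]
    have n2 : (∫ x, ‖(r : ℂ) * g x‖ ^ 2) = r ^ 2 * N := by
      rw [hN, ← integral_const_mul]
      refine integral_congr_ae (Eventually.of_forall fun x => ?_)
      simp only [norm_mul, Complex.norm_real, mul_pow, Real.norm_eq_abs, sq_abs]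
    simp only [e1, e2, n1, n2] at b1 b2
    calc _ ≤ ‖∫ p, dilatedIntegrand s G (ε k) h g p ∂(volume.prod volume)‖ +
          ‖c * ∫ η, h (-η) * g η‖ := norm_sub_le _ _
      _ ≤ C * (r⁻¹ ^ 2 * (∫ x, ‖h x‖ ^ 2) + r ^ 2 * N) +
          ‖c‖ * (r⁻¹ ^ 2 * (∫ x, ‖h x‖ ^ 2) + r ^ 2 * N) := by
          rw [norm_mul]
          gcongr
      _ = _ := by rw [hD, add_mul]
  rw [Metric.tendsto_atTop]
  intro δ hδ
  -- First r is chosen to make the term with g small; only then is f approximated, to an accuracy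
  -- that compensates for r⁻².
  obtain ⟨r, hr, hr'⟩ : ∃ r : ℝ, 0 < r ∧ D * (r ^ 2 * N) < δ / 3 := by
    have : Tendsto (fun r : ℝ => D * (r ^ 2 * N)) (𝓝[>] 0) (𝓝 0) := by
      have h1 : Continuous fun r : ℝ => D * (r ^ 2 * N) := by fun_prop
      have := (h1.tendsto 0).mono_left (nhdsWithin_le_nhds (s := Ioi 0))
      simpa using this
    obtain ⟨r, h1, h2⟩ := ((this.eventually (gt_mem_nhds (by positivity : (0 : ℝ) < δ / 3))).and
      self_mem_nhdsWithin).exists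
    exact ⟨r, h2, h1⟩
  obtain ⟨a, ha, ha'⟩ : ∃ a : ℝ, 0 < a ∧ D * (r⁻¹ ^ 2 * a) ≤ δ / 3 := by
    -- The summand 1 keeps the denominator positive when D = 0.
    refine ⟨δ / 3 / (D * r⁻¹ ^ 2 + 1), by positivity, ?_⟩
    rw [← mul_assoc, mul_div_assoc', div_le_iff₀ (by positivity)]
    nlinarith
  obtain ⟨w, hw1, hw2, hw3, hw4⟩ := exists_continuous_integral_norm_sq_sub_le hf2 ha
  have hlim := tendsto_integral_dilatedIntegrand_of_continuous hs hs' G hw2 hw1 hg hg2 hε hε0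
  rw [Metric.tendsto_atTop] at hlim
  obtain ⟨K, hK⟩ := hlim (δ / 3) (by positivity)
  refine ⟨K, fun k hk => ?_⟩
  have h1 := hK k hk
  have h2 := key k r hr (f - w) (hf.sub hw2.measurable) (hf2.sub hw3)
  have i1 := (hC (ε k) (hε k) f g hf hg hf2 hg2).1
  have i2 := (hC (ε k) (hε k) w g hw2.measurable hg hw3 hg2).1
  have j1 : Integrable fun η => f (-η) * g η :=
    (hf2.comp_measurePreserving (Measure.measurePreserving_neg _)).integrable_mul hg2
  have j2 : Integrable fun η => w (-η) * g η :=
    (hw3.comp_measurePreserving (Measure.measurePreserving_neg _)).integrable_mul hg2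
  have e1 : ∫ p, dilatedIntegrand s G (ε k) (f - w) g p ∂(volume.prod volume) =
      (∫ p, dilatedIntegrand s G (ε k) f g p ∂(volume.prod volume)) -
        ∫ p, dilatedIntegrand s G (ε k) w g p ∂(volume.prod volume) := by
    rw [← integral_sub i1 i2]
    refine integral_congr_ae (Eventually.of_forall fun p => ?_)
    simp only [dilatedIntegrand, Pi.sub_apply]
    ring
  have e2 : ∫ η, (f - w) (-η) * g η = (∫ η, f (-η) * g η) - ∫ η, w (-η) * g η := by
    rw [← integral_sub j1 j2]
    refine integral_congr_ae (Eventually.of_forall fun p => ?_)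
    simp only [Pi.sub_apply]
    ring
  rw [e1, e2] at h2
  have h3 : D * (r⁻¹ ^ 2 * (∫ x, ‖(f - w) x‖ ^ 2) + r ^ 2 * N) < δ / 3 + δ / 3 := by
    rw [mul_add]
    refine add_lt_add_of_le_of_lt (le_trans ?_ ha') hr'
    gcongr
  rw [dist_eq_norm] at h1 ⊢
  set A1 := ∫ p, dilatedIntegrand s G (ε k) f g p ∂(volume.prod volume)
  set A2 := ∫ p, dilatedIntegrand s G (ε k) w g p ∂(volume.prod volume)
  set B1 := ∫ η, f (-η) * g η
  set B2 := ∫ η, w (-η) * g η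
  have e3 : A1 - c * B1 = (A1 - A2 - c * (B1 - B2)) + (A2 - c * B2) := by ring
  rw [e3]
  refine lt_of_le_of_lt (norm_add_le _ _) ?_
  linarith

end DilationLimit

/-! ### Testing τ with its own cut off mollification. -/

section CutoffPairing

open Real Set Filter
open scoped FourierTransform

variable {E : Type*} [NormedAddCommGroup E] [InnerProductSpace ℝ E]

theorem norm_le_inv_of_radialBump_ne_zero {r : ℝ} (hr : 0 < r) {x : E}
    (hx : radialBump (r • x) ≠ 0) : ‖x‖ ≤ r⁻¹ := by
  by_contra h
  apply hx
  apply radialBump_eq_zero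
  rw [not_le] at h
  rw [norm_smul, Real.norm_of_nonneg hr.le]
  calc (1 : ℝ) = r * r⁻¹ := (mul_inv_cancel₀ hr.ne').symm
    _ ≤ r * ‖x‖ := by gcongr

/-- The function `x ↦ exp(-2πi x·ξ)` cut off by a dilated bump. -/
noncomputable def cutoffCharacter (ε : ℝ) (ξ : E) (x : E) : ℂ :=
  (radialBump (ε • x) : ℂ) * 𝐞 (-inner ℝ x ξ)

theorem contDiff_cutoffCharacter (ε : ℝ) (ξ : E) : ContDiff ℝ ∞ (cutoffCharacter ε ξ) := by
  refine (Complex.ofRealCLM.contDiff.comp (contDiff_radialBump_smul ε)).mul ?_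
  simp only [Real.fourierChar_apply]
  refine Complex.contDiff_exp.comp (ContDiff.mul (Complex.ofRealCLM.contDiff.comp ?_) contDiff_const)
  exact contDiff_const.mul (contDiff_id.inner ℝ contDiff_const).neg

theorem norm_cutoffCharacter (ε : ℝ) (ξ x : E) :
    ‖cutoffCharacter ε ξ x‖ = radialBump (ε • x) := by
  rw [cutoffCharacter, norm_mul, Circle.norm_coe, mul_one, Complex.norm_real,
    Real.norm_of_nonneg (radialBump_nonneg _)]

variable [FiniteDimensional ℝ E]

theorem hasCompactSupport_cutoffCharacter {ε : ℝ} (hε : 0 < ε) (ξ : E) :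
    HasCompactSupport (cutoffCharacter ε ξ) :=
  ((hasCompactSupport_radialBump_smul hε).comp_left (g := Complex.ofReal) rfl).mul_right

variable [MeasurableSpace E] [BorelSpace E]

/-- The two bumps confine y to the ball of radius ε⁻¹ + r⁻¹, so local integrability of τ suffices
for Fubini. -/
theorem integrable_cutoff_mul_bump_mul {τ : E → ℝ} (hτ : LocallyIntegrable τ) {r ε : ℝ} (hr : 0 < r)
    (hε : 0 < ε) : Integrable (fun p : E × E => (radialBump (ε • p.1) : ℝ) *
      (radialBump (r • (p.1 - p.2)) * τ p.2)) (volume.prod volume) := by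
  have hB : IntegrableOn τ (Metric.closedBall (0 : E) (ε⁻¹ + r⁻¹)) :=
    hτ.integrableOn_isCompact (isCompact_closedBall _ _)
  have hB' := (integrable_indicator_iff Metric.isClosed_closedBall.measurableSet).mpr hB.norm
  have hχ : Integrable fun x : E => (radialBump (ε • x) : ℝ) :=
    (contDiff_radialBump_smul ε).continuous.integrable_of_hasCompactSupport
      (hasCompactSupport_radialBump_smul hε)
  refine (hχ.mul_prod hB').mono' ?_ (Eventually.of_forall fun p => ?_)
  · have hk := continuous_radialBump (E := E)
    have m1 : Continuous fun p : E × E => (radialBump (ε • p.1) : ℝ) := by fun_prop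
    have m2 : Continuous fun p : E × E => (radialBump (r • (p.1 - p.2)) : ℝ) := by fun_prop
    exact m1.aestronglyMeasurable.mul (m2.aestronglyMeasurable.mul hτ.aestronglyMeasurable.comp_snd)
  · have n1 := radialBump_nonneg (ε • p.1)
    have n2 := radialBump_nonneg (r • (p.1 - p.2))
    have n3 : 0 ≤ (Metric.closedBall (0 : E) (ε⁻¹ + r⁻¹)).indicator (fun a => ‖τ a‖) p.2 :=
      indicator_nonneg (fun _ _ => norm_nonneg _) _
    rw [norm_mul, norm_mul, Real.norm_of_nonneg n1, Real.norm_of_nonneg n2]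
    rcases eq_or_ne (radialBump (ε • p.1)) 0 with h1 | h1
    · simp [h1]
    refine mul_le_mul_of_nonneg_left ?_ n1
    rcases eq_or_ne (radialBump (r • (p.1 - p.2))) 0 with h2 | h2
    · simpa [h2] using n3
    have h3 : p.2 ∈ Metric.closedBall (0 : E) (ε⁻¹ + r⁻¹) := by
      rw [mem_closedBall_zero_iff]
      have := norm_le_norm_add_norm_sub p.1 p.2
      have := norm_le_inv_of_radialBump_ne_zero hε h1
      have := norm_le_inv_of_radialBump_ne_zero hr h2
      linarith
    rw [indicator_of_mem h3]
    exact mul_le_of_le_one_left (norm_nonneg _) (radialBump_le_one _)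

theorem fourier_cutoffCharacter {ε : ℝ} (hε : 0 < ε) (ξ η : E) :
    𝓕 (cutoffCharacter ε ξ) η =
      ((ε ^ Module.finrank ℝ E)⁻¹ : ℝ) * bumpFourier E (ε⁻¹ • (ξ + η)) := by
  rw [← fourier_radialBump_smul hε, Real.fourier_eq, Real.fourier_eq]
  refine integral_congr_ae (Eventually.of_forall fun x => ?_)
  simp only [cutoffCharacter, inner_add_right, neg_add, AddChar.map_add_eq_mul, Circle.smul_def,
    smul_eq_mul, Circle.coe_mul]
  ring

/-- The cut off, mollified function `k(ε·) (k(r·) * τ)`. -/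
noncomputable def cutoffMollified (τ : E → ℝ) (r ε : ℝ) (x : E) : ℂ :=
  (radialBump (ε • x) : ℂ) * ((∫ y, radialBump (r • (x - y)) * τ y : ℝ) : ℂ)

/-- The Fourier transform of the cut off, mollified function `k(ε·) (k(r·) * τ)`. -/
theorem fourier_cutoff_mul_convolution {τ : E → ℝ} (hτ : LocallyIntegrable τ) {r ε : ℝ}
    (hr : 0 < r) (hε : 0 < ε) (ξ : E) :
    𝓕 (cutoffMollified τ r ε) ξ =
      ∫ y, (τ y : ℂ) *
        ((fun x => (radialBump (r • x) : ℂ)) ⋆[ContinuousLinearMap.mul ℂ ℂ, volume]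
          cutoffCharacter ε ξ) y := by
  have hint : Integrable (Function.uncurry fun x y => cutoffCharacter ε ξ x *
      ((radialBump (r • (x - y)) : ℂ) * (τ y : ℂ))) (volume.prod volume) := by
    refine (integrable_cutoff_mul_bump_mul hτ hr hε).mono ?_ (Eventually.of_forall fun p => ?_)
    · have hk := continuous_radialBump (E := E)
      have m1 : Continuous fun p : E × E => cutoffCharacter ε ξ p.1 :=
        (contDiff_cutoffCharacter ε ξ).continuous.comp continuous_fst
      have m2 : Continuous fun p : E × E => (radialBump (r • (p.1 - p.2)) : ℂ) := by fun_prop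
      have m3 : AEStronglyMeasurable (fun y => (τ y : ℂ)) volume :=
        Complex.continuous_ofReal.comp_aestronglyMeasurable hτ.aestronglyMeasurable
      exact m1.aestronglyMeasurable.mul (m2.aestronglyMeasurable.mul m3.comp_snd)
    · simp only [Function.uncurry_def, norm_mul, norm_cutoffCharacter, Complex.norm_real,
        Real.norm_of_nonneg (radialBump_nonneg _)]
      exact le_rfl
  have e1 : 𝓕 (cutoffMollified τ r ε) ξ =
      ∫ x, ∫ y, cutoffCharacter ε ξ x * ((radialBump (r • (x - y)) : ℂ) * (τ y : ℂ)) := by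
    rw [Real.fourier_eq]
    refine integral_congr_ae (Eventually.of_forall fun x => ?_)
    simp only
    rw [integral_const_mul, cutoffMollified, ← integral_complex_ofReal]
    simp only [cutoffCharacter, Circle.smul_def, smul_eq_mul, Complex.ofReal_mul]
    ring
  -- After the exchange, the value of the transform at ξ is τ tested with the convolution of the
  -- bump and a cut off character. The bump being even gives the convolution its standard form.
  rw [e1, integral_integral_swap hint]
  refine integral_congr_ae (Eventually.of_forall fun y => ?_)
  simp only [convolution_def, ContinuousLinearMap.mul_apply']
  rw [← integral_const_mul, ← integral_sub_left_eq_self _ volume y]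
  refine integral_congr_ae (Eventually.of_forall fun x => ?_)
  have : radialBump (r • (y - x - y)) = radialBump (r • x) := by
    rw [sub_sub_cancel_left, smul_neg, radialBump_neg]
  simp only [this]
  ring

/-- Testing a distribution with Fourier transform `H(-ξ) w(ξ)` with `k(ε·) (k(r·) * τ)`. -/
theorem integral_mul_cutoff_mul_convolution {τ : E → ℝ} (hτ : LocallyIntegrable τ) {H : E → ℂ}
    {w : E → ℂ} (hpair : ∀ φ : E → ℂ, ContDiff ℝ ∞ φ → HasCompactSupport φ →
        ∫ x, (τ x : ℂ) * φ x = ∫ ξ, H ξ * w ξ * 𝓕 φ ξ) {r ε : ℝ} (hr : 0 < r) (hε : 0 < ε) :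
    ∫ x, (τ x : ℂ) * cutoffMollified τ r ε x =
      ∫ ξ, H ξ * w ξ * ∫ η, H η * w η *
        ((((r ^ Module.finrank ℝ E)⁻¹ : ℝ) * bumpFourier E (r⁻¹ • η)) *
          (((ε ^ Module.finrank ℝ E)⁻¹ : ℝ) * bumpFourier E (ε⁻¹ • (ξ + η)))) := by
  have hkr := contDiff_radialBump_smul (E := E) r
  have hkr' := hasCompactSupport_radialBump_smul (E := E) hr
  have hkrC : ContDiff ℝ ∞ fun x : E => (radialBump (r • x) : ℂ) :=
    Complex.ofRealCLM.contDiff.comp hkr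
  have hkrC' : HasCompactSupport fun x : E => (radialBump (r • x) : ℂ) :=
    hkr'.comp_left (g := Complex.ofReal) rfl
  have hconv : ContDiff ℝ ∞ fun x => ∫ y, radialBump (r • (x - y)) * τ y := by
    have := hkr'.contDiff_convolution_right (ContinuousLinearMap.mul ℝ ℝ) hτ hkr (μ := volume)
    convert! this using 1
    ext x
    rw [convolution_def]
    refine integral_congr_ae (Eventually.of_forall fun y => ?_)
    simp [mul_comm]
  -- First use of the Fourier formula for τ: the outer factor is tested with the cut off
  -- mollification, which is smooth with compact support.
  rw [hpair (cutoffMollified τ r ε) ((Complex.ofRealCLM.contDiff.comp (contDiff_radialBump_smul ε)).mul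
    (Complex.ofRealCLM.contDiff.comp hconv))
    (((hasCompactSupport_radialBump_smul hε).comp_left (g := Complex.ofReal) rfl).mul_right)]
  refine integral_congr_ae (Eventually.of_forall fun ξ => ?_)
  simp only
  congr 1
  have h1 := contDiff_cutoffCharacter ε ξ
  have h2 := hasCompactSupport_cutoffCharacter hε ξ
  refine (fourier_cutoff_mul_convolution hτ hr hε ξ).trans ?_
  have hc : ContDiff ℝ ∞ ((fun x => (radialBump (r • x) : ℂ))
      ⋆[ContinuousLinearMap.mul ℂ ℂ, volume] cutoffCharacter ε ξ) :=
    hkrC'.contDiff_convolution_left (ContinuousLinearMap.mul ℝ ℂ) hkrC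
      h1.continuous.locallyIntegrable
  -- Second use: for fixed ξ the transform of the cut off mollification is τ paired with a complex
  -- test function, whose own transform is a product by the convolution theorem.
  rw [hpair _ hc (hkrC'.convolution (ContinuousLinearMap.mul ℂ ℂ) h2)]
  refine integral_congr_ae (Eventually.of_forall fun η => ?_)
  simp only
  rw [Real.fourier_mul_convolution_eq (hkrC.continuous.integrable_of_hasCompactSupport hkrC')
    (h1.continuous.integrable_of_hasCompactSupport h2), fourier_cutoffCharacter hε,
    fourier_radialBump_smul hr]

end CutoffPairing

/-! ### The localized energy on the Fourier side. -/

section EnergyIdentity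

open Real Set Filter

variable {E : Type*} [NormedAddCommGroup E] [InnerProductSpace ℝ E] [FiniteDimensional ℝ E]
  [MeasurableSpace E] [BorelSpace E]

theorem integrable_of_comp_smul_sub {f : E → ℂ} {ε : ℝ} (hε : 0 < ε) {η : E}
    (hf : Integrable fun z => f (ε • z - η)) : Integrable f := by
  have h := (hf.comp_smul (inv_ne_zero hε.ne')).comp_add_right η
  refine h.congr (Eventually.of_forall fun x => ?_)
  simp only
  rw [smul_inv_smul₀ hε.ne', add_sub_cancel_right]

theorem integral_comp_smul_sub {F : Type*} [NormedAddCommGroup F] [NormedSpace ℝ F] (f : E → F)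
    {ε : ℝ} (hε : 0 < ε) (η : E) :
    ∫ z, (ε ^ Module.finrank ℝ E) • f (ε • z - η) = ∫ ξ, f ξ := by
  have h := Measure.integral_comp_smul (volume : Measure E) (fun z => f (z - η)) ε
  rw [abs_of_pos (by positivity), integral_sub_right_eq_self] at h
  rw [integral_smul, h, smul_inv_smul₀ (by positivity)]

/-- For each fixed η the map z ↦ εz - η has Jacobian ε^n. Going through these slices transfers
absolute integrability from the dilated variables, where the multiplier bound is available, back to
(ξ, η). -/
theorem integrable_and_integral_eq_of_shear {P : E × E → ℂ} (hP : Measurable P) {ε : ℝ}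
    (hε : 0 < ε) (hint : Integrable (fun p : E × E => (ε ^ Module.finrank ℝ E) •
      P (ε • p.1 - p.2, p.2)) (volume.prod volume)) :
    Integrable P (volume.prod volume) ∧ ∫ p, P p ∂(volume.prod volume) =
      ∫ p : E × E, (ε ^ Module.finrank ℝ E) • P (ε • p.1 - p.2, p.2) ∂(volume.prod volume) := by
  have hc : 0 < ε ^ Module.finrank ℝ E := by positivity
  have h1 := (integrable_prod_iff' hint.1).mp hint
  have hPi : Integrable P (volume.prod volume) := by
    rw [integrable_prod_iff' hP.aestronglyMeasurable]
    constructor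
    · filter_upwards [h1.1] with η hη
      exact integrable_of_comp_smul_sub (f := fun ξ => P (ξ, η)) hε
        ((integrable_smul_iff hc.ne' _).mp hη)
    · refine h1.2.congr (Eventually.of_forall fun η => ?_)
      simp only [norm_smul, Real.norm_of_nonneg hc.le]
      exact integral_comp_smul_sub (fun ξ => ‖P (ξ, η)‖) hε η
  refine ⟨hPi, ?_⟩
  rw [integral_prod_symm _ hPi, integral_prod_symm _ hint]
  refine integral_congr_ae (Eventually.of_forall fun η => ?_)
  exact (integral_comp_smul_sub (fun ξ => P (ξ, η)) hε η).symm

variable [Nontrivial E]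

/-- The energy of `τ` and its localization in terms of the Fourier transform of `τ`. -/
theorem bumpMellin_mul_integral_cutoff_energy {s : ℝ} (hs : 0 < s)
    (hs' : s < (Module.finrank ℝ E : ℝ) / 2) {τ : E → ℝ} (hτ : LocallyIntegrable τ) {ε : ℝ}
    (hε : 0 < ε)
    (hI : Integrable (fun z : E × E => radialBump (ε • z.1) * |τ z.1| *
      ‖z.1 - z.2‖ ^ (2 * s - Module.finrank ℝ E) * |τ z.2|) (volume.prod volume))
    {H : E → ℂ} (hH : Measurable H) (hH2 : MemLp H 2 volume)
    (hpair : ∀ φ : E → ℂ, ContDiff ℝ ∞ φ → HasCompactSupport φ →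
      ∫ x, (τ x : ℂ) * φ x =
        ∫ ξ, H ξ * (((2 * π * ‖ξ‖) ^ s : ℝ) : ℂ) * FourierTransform.fourier φ ξ)
    {e : E} (he : ‖e‖ = 1) :
    (bumpMellin (Module.finrank ℝ E - 2 * s) : ℂ) *
      ((∫ z : E × E, radialBump (ε • z.1) * τ z.1 * ‖z.1 - z.2‖ ^ (2 * s - Module.finrank ℝ E) *
        τ z.2 ∂(volume.prod volume) : ℝ) : ℂ) =
    (((2 * π) ^ (2 * s) : ℝ) : ℂ) * bumpFourierMellin (2 * s) e *
      ∫ p, dilatedIntegrand s (bumpFourier E) ε H H p ∂(volume.prod volume) := by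
  set n := Module.finrank ℝ E with hn
  set ν : Measure ℝ := volume.restrict (Ioi 0)
  have hα : 0 < 2 * s := by positivity
  have hp : 0 < n - 2 * s := by linarith
  have hkm : Measurable (radialBump : E → ℝ) := continuous_radialBump.measurable
  have hKm : Measurable (bumpFourier E) := (bumpFourier E).continuous.measurable
  have hτm := hτ.aestronglyMeasurable
  have hne : ∀ᵐ z : E × E ∂(volume.prod volume), z.1 - z.2 ≠ 0 :=
    (quasiMeasurePreserving_sub (volume : Measure E) volume).ae (ae_ne_zero (E := E))
  have hne2 : ∀ᵐ z : E × E ∂(volume.prod volume), z.2 ≠ 0 :=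
    Measure.quasiMeasurePreserving_snd.ae (ae_ne_zero (E := E))
  -- the physical side
  let fA : E × E → ℝ → ℝ := fun z t => t ^ ((n : ℝ) - 2 * s - 1) * radialBump (t • (z.1 - z.2)) *
    (radialBump (ε • z.1) * τ z.1 * τ z.2)
  have hfA : Integrable (Function.uncurry fA) ((volume.prod volume).prod ν) := by
    have hm : AEStronglyMeasurable (Function.uncurry fA) ((volume.prod volume).prod ν) := by
      have m1 : Measurable fun p : (E × E) × ℝ =>
        p.2 ^ ((n : ℝ) - 2 * s - 1) * radialBump (p.2 • (p.1.1 - p.1.2)) := by fun_prop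
      have m2 : AEStronglyMeasurable (fun z : E × E => radialBump (ε • z.1) * τ z.1 * τ z.2)
          (volume.prod volume) := by
        have : Measurable fun z : E × E => radialBump (ε • z.1) := by fun_prop
        exact (this.aestronglyMeasurable.mul hτm.comp_fst).mul hτm.comp_snd
      exact m1.aestronglyMeasurable.mul m2.comp_fst
    rw [integrable_prod_iff hm]
    constructor
    · filter_upwards [hne] with z hz
      exact (integrableOn_rpow_mul_radialBump hp hz).mul_const
        (radialBump (ε • z.1) * τ z.1 * τ z.2)
    · refine (hI.const_mul (bumpMellin (n - 2 * s))).congr ?_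
      filter_upwards [hne] with z hz
      have h1 : ∫ t, ‖Function.uncurry fA (z, t)‖ ∂ν =
          ∫ t in Ioi (0 : ℝ), t ^ ((n : ℝ) - 2 * s - 1) * radialBump (t • (z.1 - z.2)) *
            (radialBump (ε • z.1) * |τ z.1| * |τ z.2|) := by
        refine setIntegral_congr_fun measurableSet_Ioi fun t ht => ?_
        have h2 := Real.rpow_nonneg (le_of_lt ht) ((n : ℝ) - 2 * s - 1)
        simp only [fA, Function.uncurry_apply_pair, norm_mul, Real.norm_of_nonneg h2,
          Real.norm_of_nonneg (radialBump_nonneg _), Real.norm_eq_abs]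
      rw [h1, integral_mul_const, integral_rpow_mul_radialBump _ hz, neg_sub]
      ring
  have eA : ∫ z, ∫ t, fA z t ∂ν ∂(volume.prod volume) = bumpMellin (n - 2 * s) *
      ∫ z : E × E, radialBump (ε • z.1) * τ z.1 * ‖z.1 - z.2‖ ^ (2 * s - n) * τ z.2
        ∂(volume.prod volume) := by
    rw [← integral_const_mul]
    refine integral_congr_ae ?_
    filter_upwards [hne] with z hz
    simp only [fA]
    rw [integral_mul_const, integral_rpow_mul_radialBump _ hz, neg_sub]
    ring
  -- the Fourier side
  let w : E → ℂ := fun ξ => (((2 * π * ‖ξ‖) ^ s : ℝ) : ℂ)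
  let Q : E × E → ℂ := fun p => H p.1 * w p.1 * (H p.2 * w p.2) *
    (((ε ^ n)⁻¹ : ℝ) * bumpFourier E (ε⁻¹ • (p.1 + p.2)))
  let P : E × E → ℂ := fun p => ((‖p.2‖ ^ (-(2 * s)) : ℝ) : ℂ) * Q p
  have hQm : Measurable Q := by
    simp only [Q, w]
    fun_prop
  have hPm : Measurable P := by
    simp only [P]
    fun_prop
  obtain ⟨C, -, hC⟩ := exists_norm_integral_dilatedIntegrand_le hs.le hs' (bumpFourier E)
  have hD := (hC ε hε H H hH hH hH2 hH2).1
  -- The power |η|^{-2s} from subordination meets |η|^s from the transform of τ and leaves |η|^{-s};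
  -- the factor ε^n cancels, and the two weights contribute (2π)^{2s}.
  have hPD : (fun p : E × E => (ε ^ n) • P (ε • p.1 - p.2, p.2)) =ᵐ[volume.prod volume]
      fun p => (((2 * π) ^ (2 * s) : ℝ) : ℂ) * dilatedIntegrand s (bumpFourier E) ε H H p := by
    filter_upwards [hne2] with p hp2
    have h2π : (0 : ℝ) ≤ 2 * π := by positivity
    have hpos : 0 < ‖p.2‖ := norm_pos_iff.mpr hp2
    have e1 : ε⁻¹ • (ε • p.1 - p.2 + p.2) = p.1 := by
      rw [sub_add_cancel, inv_smul_smul₀ hε.ne']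
    have e2 : ‖p.2‖ ^ (-s) = ‖p.2‖ ^ s * ‖p.2‖ ^ (-(2 * s)) := by
      rw [← Real.rpow_add hpos]
      ring_nf
    have e3 : (2 * π) ^ (2 * s) = (2 * π) ^ s * (2 * π) ^ s := by
      rw [← Real.rpow_add (by positivity)]
      ring_nf
    have e4 : ((ε ^ n : ℝ) : ℂ) * (((ε ^ n)⁻¹ : ℝ) : ℂ) = 1 := by
      rw [← Complex.ofReal_mul, mul_inv_cancel₀ (by positivity), Complex.ofReal_one]
    simp only [P, Q, w, dilatedIntegrand, e1, e2, e3, Real.mul_rpow h2π (norm_nonneg _),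
      Complex.real_smul, Complex.ofReal_mul]
    linear_combination (H (ε • p.1 - p.2) * ((((2 * π) ^ s : ℝ) : ℂ) * ((‖ε • p.1 - p.2‖ ^ s : ℝ) : ℂ)) *
      (H p.2 * ((((2 * π) ^ s : ℝ) : ℂ) * ((‖p.2‖ ^ s : ℝ) : ℂ))) * bumpFourier E p.1 *
        ((‖p.2‖ ^ (-(2 * s)) : ℝ) : ℂ)) * e4
  obtain ⟨hPi, hPe⟩ := integrable_and_integral_eq_of_shear hPm hε
    ((hD.const_mul _).congr hPD.symm)
  rw [integral_congr_ae hPD, integral_const_mul] at hPe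
  let fB : E × E → ℝ → ℂ := fun p t => (t ^ (-(2 * s) - 1) • bumpFourier E (t⁻¹ • p.2)) * Q p
  have hfB : Integrable (Function.uncurry fB) ((volume.prod volume).prod ν) := by
    have hm : Measurable (Function.uncurry fB) := by
      simp only [fB, Function.uncurry_def]
      fun_prop
    rw [integrable_prod_iff hm.aestronglyMeasurable]
    constructor
    · filter_upwards [hne2] with p hp2
      exact (integrableOn_rpow_smul_bumpFourier_inv hα hp2).mul_const (Q p)
    · refine (hPi.norm.const_mul
        (∫ t in Ioi (0 : ℝ), t ^ (2 * s - 1) * ‖bumpFourier E (t • e)‖)).congr ?_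
      filter_upwards [hne2] with p hp2
      have h1 : ∫ t, ‖Function.uncurry fB (p, t)‖ ∂ν =
          ∫ t in Ioi (0 : ℝ), t ^ (-(2 * s) - 1) * ‖bumpFourier E (t⁻¹ • p.2)‖ * ‖Q p‖ := by
        refine setIntegral_congr_fun measurableSet_Ioi fun t ht => ?_
        have := Real.rpow_nonneg (le_of_lt ht) (-(2 * s) - 1)
        simp only [fB, Function.uncurry_apply_pair, norm_mul, norm_smul]
        rw [Real.norm_of_nonneg this]
      rw [h1, integral_mul_const, integral_rpow_mul_norm_bumpFourier_inv _ he hp2]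
      simp only [P, norm_mul, Complex.norm_real]
      rw [Real.norm_of_nonneg (by positivity)]
      ring
  have eB : ∫ p, ∫ t, fB p t ∂ν ∂(volume.prod volume) =
      bumpFourierMellin (2 * s) e * ∫ p, P p ∂(volume.prod volume) := by
    rw [← integral_const_mul]
    refine integral_congr_ae ?_
    filter_upwards [hne2] with p hp2
    simp only [fB, P]
    rw [integral_mul_const, integral_rpow_smul_bumpFourier_inv _ he hp2, Complex.real_smul]
    ring
  -- For almost every t both slices are integrable, and the double use of the Fourier formula with r
  -- = t, multiplied by t^{n-2s-1}, identifies them.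
  have hslice : ((∫ t, ∫ z, fA z t ∂(volume.prod volume) ∂ν : ℝ) : ℂ) =
      ∫ t, ∫ p, fB p t ∂(volume.prod volume) ∂ν := by
    rw [← integral_complex_ofReal]
    refine integral_congr_ae ?_
    filter_upwards [hfA.prod_left_ae, hfB.prod_left_ae, ae_restrict_mem measurableSet_Ioi]
      with t hA hB ht
    have ht' : 0 < t := ht
    have hA' : Integrable (fun z => fA z t) (volume.prod volume) := hA
    have hB' : Integrable (fun z => fB z t) (volume.prod volume) := hB
    have key := congrArg (fun z : ℂ => ((t ^ ((n : ℝ) - 2 * s - 1) : ℝ) : ℂ) * z)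
      (integral_mul_cutoff_mul_convolution hτ (w := w) hpair ht' hε)
    rw [← integral_const_mul, ← integral_const_mul] at key
    rw [integral_prod _ hA', integral_prod _ hB', ← integral_complex_ofReal]
    refine Eq.trans ?_ (key.trans ?_)
    · refine integral_congr_ae (Eventually.of_forall fun x => ?_)
      simp only [fA, cutoffMollified]
      have : ∫ y, t ^ ((n : ℝ) - 2 * s - 1) * radialBump (t • (x - y)) *
          (radialBump (ε • x) * τ x * τ y) = t ^ ((n : ℝ) - 2 * s - 1) *
          (radialBump (ε • x) * τ x) * ∫ y, radialBump (t • (x - y)) * τ y := by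
        rw [← integral_const_mul]
        refine integral_congr_ae (Eventually.of_forall fun y => ?_)
        simp only
        ring
      rw [this]
      push_cast
      ring
    · refine integral_congr_ae (Eventually.of_forall fun ξ => ?_)
      simp only
      rw [← integral_const_mul, ← integral_const_mul]
      refine integral_congr_ae (Eventually.of_forall fun η => ?_)
      have e5 : t ^ (-(2 * s) - 1) = t ^ ((n : ℝ) - 2 * s - 1) * (t ^ n)⁻¹ := by
        rw [← Real.rpow_natCast, ← Real.rpow_neg ht'.le, ← Real.rpow_add ht']
        ring_nf
      simp only [fB, Q, w, e5, Complex.real_smul, Complex.ofReal_mul]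
      ring
  rw [← integral_integral_swap hfA, ← integral_integral_swap hfB, eA, eB, hPe] at hslice
  rw [← Complex.ofReal_mul, hslice]
  ring

end EnergyIdentity

/-! ### Removing the cutoff; convergence of the Riesz potential. -/

section EnergyNorm

open Real Set Filter
open scoped Topology

/-- If `g` is bounded from below by an integrable function and the integrals of `χ k * g` converge
for cut-offs `χ k → 1`, then `g` is integrable and they converge to its integral. -/
theorem integrable_and_integral_eq_of_tendsto_cutoff {X : Type*} [MeasurableSpace X]
    {μ : Measure X} {g f : X → ℝ} (hf : Integrable f μ) (hgf : ∀ᵐ x ∂μ, -|f x| ≤ g x)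
    {χ : ℕ → X → ℝ} (hχm : ∀ k, AEStronglyMeasurable (χ k) μ) (hχ0 : ∀ k x, 0 ≤ χ k x)
    (hχ1 : ∀ k x, χ k x ≤ 1) (hχ : ∀ x, Tendsto (fun k => χ k x) atTop (𝓝 1))
    (hint : ∀ k, Integrable (fun x => χ k x * g x) μ) {L : ℝ}
    (hL : Tendsto (fun k => ∫ x, χ k x * g x ∂μ) atTop (𝓝 L)) :
    Integrable g μ ∧ ∫ x, g x ∂μ = L := by
  have hlim : ∀ x, Tendsto (fun k => χ k x * g x) atTop (𝓝 (g x)) := fun x => by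
    simpa using (hχ x).mul_const (g x)
  have hgm : AEStronglyMeasurable g μ := aestronglyMeasurable_of_tendsto_ae atTop
    (fun k => (hint k).1) (Eventually.of_forall hlim)
  have hχf : ∀ k, Integrable (fun x => χ k x * |f x|) μ := fun k =>
    hf.abs.mono ((hχm k).mul hf.abs.1) (Eventually.of_forall fun x => by
      rw [norm_mul, Real.norm_of_nonneg (hχ0 k x)]
      exact mul_le_of_le_one_left (norm_nonneg _) (hχ1 k x))
  -- Nonnegativity after adding |f| permits Fatou. The cut off integrals are bounded by ∫ χ_k g + ∫
  -- |f|, which converges.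
  have hsum : Integrable (fun x => g x + |f x|) μ := by
    refine ⟨hgm.add hf.abs.1, ?_⟩
    have h0 : 0 ≤ᵐ[μ] fun x => g x + |f x| := by
      filter_upwards [hgf] with x hx
      simp only [Pi.zero_apply]
      linarith
    rw [hasFiniteIntegral_iff_ofReal h0]
    have hl : ∀ x, Tendsto (fun k => ENNReal.ofReal (χ k x * g x + χ k x * |f x|)) atTop
        (𝓝 (ENNReal.ofReal (g x + |f x|))) := fun x => by
      have := (hlim x).add ((hχ x).mul_const |f x|)
      rw [one_mul] at this
      exact ENNReal.tendsto_ofReal this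
    have hm : ∀ k, AEMeasurable (fun x => ENNReal.ofReal (χ k x * g x + χ k x * |f x|)) μ :=
      fun k => ((hint k).add (hχf k)).1.aemeasurable.ennreal_ofReal
    calc ∫⁻ x, ENNReal.ofReal (g x + |f x|) ∂μ
        = ∫⁻ x, liminf (fun k => ENNReal.ofReal (χ k x * g x + χ k x * |f x|)) atTop ∂μ :=
          lintegral_congr fun x => (hl x).liminf_eq.symm
      _ ≤ liminf (fun k => ∫⁻ x, ENNReal.ofReal (χ k x * g x + χ k x * |f x|) ∂μ) atTop :=
          lintegral_liminf_le' hm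
      _ ≤ liminf (fun k => ENNReal.ofReal ((∫ x, χ k x * g x ∂μ) + ∫ x, |f x| ∂μ)) atTop := by
          refine liminf_le_liminf (Eventually.of_forall fun k => ?_)
          have h1 : 0 ≤ᵐ[μ] fun x => χ k x * g x + χ k x * |f x| := by
            filter_upwards [hgf] with x hx
            simp only [Pi.zero_apply]
            rw [← mul_add]
            exact mul_nonneg (hχ0 k x) (by linarith)
          have h2 := ofReal_integral_eq_lintegral_ofReal ((hint k).add (hχf k)) h1
          simp only [Pi.add_apply] at h2
          rw [← h2, integral_add (hint k) (hχf k)]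
          refine ENNReal.ofReal_le_ofReal (add_le_add le_rfl (integral_mono (hχf k) hf.abs ?_))
          exact fun x => mul_le_of_le_one_left (abs_nonneg _) (hχ1 k x)
      _ = ENNReal.ofReal (L + ∫ x, |f x| ∂μ) :=
          (ENNReal.tendsto_ofReal (hL.add_const _)).liminf_eq
      _ < ⊤ := ENNReal.ofReal_lt_top
  have hg : Integrable g μ := by
    refine (hsum.sub hf.abs).congr (Eventually.of_forall fun x => ?_)
    simp
  refine ⟨hg, tendsto_nhds_unique ?_ hL⟩
  -- Once g is integrable, |g| dominates all the cut off integrands.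
  refine tendsto_integral_of_dominated_convergence (fun x => |g x|) (fun k => (hint k).1) hg.abs
    (fun k => Eventually.of_forall fun x => ?_) (Eventually.of_forall hlim)
  rw [norm_mul, Real.norm_of_nonneg (hχ0 k x)]
  exact mul_le_of_le_one_left (norm_nonneg _) (hχ1 k x)

section Potential

variable {E : Type*} [NormedAddCommGroup E] [InnerProductSpace ℝ E] [FiniteDimensional ℝ E]
  [MeasurableSpace E] [BorelSpace E] [Nontrivial E] {α q : ℝ} {τ : E → ℝ}

/-- The localized energy was bounded with the outer factor |τ(x)| + 1, not |τ(x)|; since this factor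
is at least 1, almost every slice controls the potential itself, including where τ vanishes. Balls
of integer radius exhaust the space. -/
theorem ae_integrable_norm_rpow_mul (hα : 0 < α)
    (hα' : α < Module.finrank ℝ E)
    (hq : 2 * (Module.finrank ℝ E : ℝ) / (Module.finrank ℝ E + α) < q)
    (hq' : q < (Module.finrank ℝ E : ℝ) / α) (hτ : MemLp τ (ENNReal.ofReal q) volume) :
    ∀ᵐ x, Integrable fun y => ‖x - y‖ ^ (α - Module.finrank ℝ E) * τ y := by
  have h : ∀ᵐ x : E, ∀ k : ℕ, Integrable fun y => (Metric.ball 0 (k : ℝ)).indicator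
      (fun x => |τ x| + 1) x * ‖x - y‖ ^ (α - Module.finrank ℝ E) * |τ y| :=
    ae_all_iff.mpr fun k =>
      (integrable_indicator_mul_norm_rpow_mul hα hα' hq hq' hτ k).prod_right_ae
  filter_upwards [h] with x hx
  obtain ⟨k, hk⟩ := exists_nat_gt ‖x‖
  have hxk := hx k
  rw [indicator_of_mem (mem_ball_zero_iff.mpr hk)] at hxk
  refine hxk.mono ?_ (Eventually.of_forall fun y => ?_)
  · have : Measurable fun y : E => ‖x - y‖ ^ (α - Module.finrank ℝ E) := by fun_prop
    exact this.aestronglyMeasurable.mul hτ.1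
  · have h0 : 0 ≤ ‖x - y‖ ^ (α - Module.finrank ℝ E) := by positivity
    have h1 : 0 ≤ |τ x| + 1 := by positivity
    rw [norm_mul, norm_mul, norm_mul, Real.norm_of_nonneg h0, Real.norm_of_nonneg h1,
      Real.norm_eq_abs, Real.norm_eq_abs, abs_abs, mul_assoc]
    exact le_mul_of_one_le_left (by positivity) (by linarith [abs_nonneg (τ x)])

theorem integrable_cutoff_energy (hα : 0 < α)
    (hα' : α < Module.finrank ℝ E)
    (hq : 2 * (Module.finrank ℝ E : ℝ) / (Module.finrank ℝ E + α) < q)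
    (hq' : q < (Module.finrank ℝ E : ℝ) / α) (hτ : MemLp τ (ENNReal.ofReal q) volume) {ε : ℝ}
    (hε : 0 < ε) :
    Integrable (fun z : E × E => radialBump (ε • z.1) * |τ z.1| *
      ‖z.1 - z.2‖ ^ (α - Module.finrank ℝ E) * |τ z.2|) (volume.prod volume) := by
  -- The cutoff is supported in the closed ball of radius ε⁻¹; the extra 1 puts this inside the open
  -- ball.
  refine (integrable_indicator_mul_norm_rpow_mul hα hα' hq hq' hτ (ε⁻¹ + 1)).mono' ?_
    (Eventually.of_forall fun z => ?_)
  · have m1 : AEStronglyMeasurable (fun x : E => radialBump (ε • x)) volume :=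
      (contDiff_radialBump_smul ε).continuous.aestronglyMeasurable
    have m3 : Measurable fun z : E × E => ‖z.1 - z.2‖ ^ (α - Module.finrank ℝ E) := by fun_prop
    exact (((m1.mul hτ.1.norm).comp_fst).mul m3.aestronglyMeasurable).mul hτ.1.norm.comp_snd
  · have n1 := radialBump_nonneg (ε • z.1)
    rw [Real.norm_of_nonneg (by positivity)]
    gcongr
    rcases eq_or_ne (radialBump (ε • z.1)) 0 with h | h
    · rw [h, zero_mul]
      exact indicator_nonneg (fun _ _ => by positivity) _
    · have h1 := norm_le_inv_of_radialBump_ne_zero hε h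
      rw [indicator_of_mem (mem_ball_zero_iff.mpr (by linarith))]
      have := mul_le_of_le_one_left (abs_nonneg (τ z.1)) (radialBump_le_one (ε • z.1))
      linarith

end Potential

theorem rieszPotential_eq {d : ℕ} (α : ℝ) (τ : EuclideanSpace ℝ (Fin d) → ℝ)
    (x : EuclideanSpace ℝ (Fin d)) :
    rieszPotential α τ x =
      Real.Gamma ((d - α) / 2) / (π ^ ((d : ℝ) / 2) * 2 ^ α * Real.Gamma (α / 2)) *
        ∫ y, ‖x - y‖ ^ (α - d) * τ y := by
  rw [rieszPotential, convolution_def, ← integral_const_mul, ← integral_sub_left_eq_self _ volume x]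
  simp only [ContinuousLinearMap.mul_apply', rieszKernel, sub_sub_cancel, mul_assoc]

theorem convolutionExistsAt_rieszKernel {d : ℕ} {α : ℝ} {τ : EuclideanSpace ℝ (Fin d) → ℝ}
    {x : EuclideanSpace ℝ (Fin d)} (h : Integrable fun y => ‖x - y‖ ^ (α - d) * τ y) :
    ConvolutionExistsAt (rieszKernel d α) τ x (ContinuousLinearMap.mul ℝ ℝ) volume := by
  refine ((h.comp_sub_left x).const_mul
    (Real.Gamma ((d - α) / 2) / (π ^ ((d : ℝ) / 2) * 2 ^ α * Real.Gamma (α / 2)))).congr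
    (Eventually.of_forall fun y => ?_)
  simp only [ContinuousLinearMap.mul_apply', rieszKernel, sub_sub_cancel, mul_assoc]

end EnergyNorm

/-! ### Assembling the norm identity. -/

theorem corollary5p6 (d : ℕ) (hd : 2 ≤ d) (s : ℝ) (hs : 0 < s) (hsd : s < (d : ℝ) / 2)
    (q : ℝ) (hq : 2 * (d : ℝ) / (d + 2 * s) < q) (hq' : q < (d : ℝ) / (2 * s))
    (τ : EuclideanSpace ℝ (Fin d) → ℝ) (hτ : MemLp τ (ENNReal.ofReal q) volume)
    (T : StrongDual ℝ (HomSobolev d s)) (hT : HomSobolev.IsRegularDistribution T τ)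
    (f : EuclideanSpace ℝ (Fin d) → ℝ) (hf : Integrable f volume)
    (hTf : ∀ᵐ x, -|f x| ≤ τ x * rieszPotential (2 * s) τ x) :
    (∀ᵐ x, ConvolutionExistsAt (rieszKernel d (2 * s)) τ x (ContinuousLinearMap.mul ℝ ℝ) volume) ∧
      Integrable (fun x => rieszPotential (2 * s) τ x * τ x) volume ∧
      ‖T‖ ^ 2 = coulombEnergy (2 * s) τ := by
  have : Nontrivial (Fin d) := Fin.nontrivial_iff_two_le.mpr hd
  have hfin : Module.finrank ℝ (EuclideanSpace ℝ (Fin d)) = d := finrank_euclideanSpace_fin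
  have hα : 0 < 2 * s := by positivity
  have hα' : 2 * s < d := by linarith
  have hd0 : (0 : ℝ) < d := hα.trans hα'
  have hq1 : 1 ≤ ENNReal.ofReal q := by
    rw [ENNReal.one_le_ofReal]
    refine le_trans ?_ hq.le
    rw [le_div_iff₀ (by positivity)]
    linarith
  have hloc : LocallyIntegrable τ := hτ.locallyIntegrable hq1
  refine ⟨?_, ?_⟩
  · have := ae_integrable_norm_rpow_mul (α := 2 * s) hα (by rwa [hfin]) (by rwa [hfin])
      (by rwa [hfin]) hτ
    rw [hfin] at this
    filter_upwards [this] with x hx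
    exact convolutionExistsAt_rieszKernel hx
  -- the Fourier transform of `τ`
  obtain ⟨H₀, hH₀, hsymm₀, hnorm₀, hpair₀⟩ :=
    HomSobolev.exists_fourier_pairing (one_le_two.trans hd) hs.le hloc hT
  -- The bilinear estimates ask for a measurable function, so a representative replaces H₀;
  -- Hermitian symmetry then holds only almost everywhere.
  set H := hH₀.1.mk H₀ with hHdef
  have hHH : H₀ =ᵐ[volume] H := hH₀.1.ae_eq_mk
  have hH : Measurable H := hH₀.1.stronglyMeasurable_mk.measurable
  have hH2 : MemLp H 2 volume := hH₀.ae_eq hHH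
  have hpair : ∀ φ : EuclideanSpace ℝ (Fin d) → ℂ, ContDiff ℝ ∞ φ → HasCompactSupport φ →
      ∫ x, (τ x : ℂ) * φ x = ∫ ξ, H ξ * (((2 * Real.pi * ‖ξ‖) ^ s : ℝ) : ℂ) *
        FourierTransform.fourier φ ξ := by
    intro φ h1 h2
    rw [hpair₀ φ h1 h2]
    refine integral_congr_ae ?_
    filter_upwards [hHH] with ξ hξ
    rw [hξ]
  -- The limit form is bilinear, not sesquilinear; it is the Hermitian symmetry that turns it into
  -- the squared norm.
  have hnorm : ∫ η, H (-η) * H η = ((‖T‖ ^ 2 : ℝ) : ℂ) := by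
    rw [← hnorm₀, ← integral_complex_ofReal]
    refine integral_congr_ae ?_
    filter_upwards [hHH, (Measure.measurePreserving_neg volume).quasiMeasurePreserving.ae hHH] with η h1 h2
    rw [← h1, ← h2, hsymm₀, Complex.conj_mul']
    push_cast
    rfl
  -- the localized energies
  set A : ℝ := Real.Gamma ((d - 2 * s) / 2) /
    (Real.pi ^ ((d : ℝ) / 2) * 2 ^ (2 * s) * Real.Gamma (2 * s / 2)) with hA
  obtain ⟨e, he⟩ : ∃ e : EuclideanSpace ℝ (Fin d), ‖e‖ = 1 := exists_norm_eq _ zero_le_one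
  have hB : 0 < bumpMellin ((d : ℝ) - 2 * s) := bumpMellin_pos (by linarith)
  have hcut : ∀ ε : ℝ, 0 < ε →
      Integrable (fun x => radialBump (ε • x) * (τ x * rieszPotential (2 * s) τ x)) ∧
      ((∫ x, radialBump (ε • x) * (τ x * rieszPotential (2 * s) τ x) : ℝ) : ℂ) =
        ∫ p, dilatedIntegrand s (bumpFourier (EuclideanSpace ℝ (Fin d))) ε H H p
          ∂(volume.prod volume) := by
    intro ε hε
    have hI := integrable_cutoff_energy (α := 2 * s) hα (by rwa [hfin]) (by rwa [hfin])
      (by rwa [hfin]) hτ hε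
    have hE := bumpMellin_mul_integral_cutoff_energy hs (by rwa [hfin]) hloc hε hI hH hH2 hpair he
    have hc := rieszConstant_mul_bumpFourierMellin hα (by rwa [hfin]) he
    rw [hfin] at hI hE hc
    rw [Complex.ofReal_mul, ← hA] at hc
    have hI' : Integrable (fun z : EuclideanSpace ℝ (Fin d) × EuclideanSpace ℝ (Fin d) =>
        A * (radialBump (ε • z.1) * τ z.1 * ‖z.1 - z.2‖ ^ (2 * s - d) * τ z.2))
        (volume.prod volume) := by
      refine Integrable.const_mul (hI.mono ?_ (Filter.Eventually.of_forall fun z => ?_)) A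
      · have m1 : AEStronglyMeasurable (fun x : EuclideanSpace ℝ (Fin d) => radialBump (ε • x))
            volume := (contDiff_radialBump_smul ε).continuous.aestronglyMeasurable
        have m3 : Measurable fun z : EuclideanSpace ℝ (Fin d) × EuclideanSpace ℝ (Fin d) =>
          ‖z.1 - z.2‖ ^ (2 * s - d) := by fun_prop
        exact (((m1.mul hτ.1).comp_fst).mul m3.aestronglyMeasurable).mul hτ.1.comp_snd
      · simp only [norm_mul, Real.norm_eq_abs, abs_abs]
        exact le_rfl
    have hinner : ∀ x, ∫ y, A * (radialBump (ε • x) * τ x * ‖x - y‖ ^ (2 * s - d) * τ y) =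
        radialBump (ε • x) * (τ x * rieszPotential (2 * s) τ x) := by
      intro x
      rw [rieszPotential_eq, integral_const_mul, ← hA]
      simp only [mul_assoc, integral_const_mul]
      ring
    refine ⟨hI'.integral_prod_left.congr (Filter.Eventually.of_forall hinner), ?_⟩
    rw [← integral_congr_ae (Filter.Eventually.of_forall hinner), ← integral_prod _ hI',
      integral_const_mul]
    have hB' : (bumpMellin ((d : ℝ) - 2 * s) : ℂ) ≠ 0 := by exact_mod_cast hB.ne'
    apply mul_left_cancel₀ hB'
    rw [Complex.ofReal_mul]
    -- The energy identity carries (2π)^{2s} `bumpFourierMellin`, and A times this is `bumpMellin`;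
    -- the nonzero factor `bumpMellin` has been cancelled.
    linear_combination (A : ℂ) * hE +
      (∫ p, dilatedIntegrand s (bumpFourier (EuclideanSpace ℝ (Fin d))) ε H H p
        ∂(volume.prod volume)) * hc
  have hε : ∀ k : ℕ, (0 : ℝ) < 1 / ((k : ℝ) + 1) := fun k => Nat.one_div_pos_of_nat
  have hε0 : Filter.Tendsto (fun k : ℕ => 1 / ((k : ℝ) + 1)) Filter.atTop (nhds 0) :=
    tendsto_one_div_add_atTop_nhds_zero_nat
  have hlim := tendsto_integral_dilatedIntegrand hs (by rwa [hfin])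
    (bumpFourier (EuclideanSpace ℝ (Fin d))) hH hH2 hH hH2 hε hε0
  rw [integral_bumpFourier, one_mul, hnorm] at hlim
  have hlim' : Filter.Tendsto (fun k : ℕ => ∫ x, radialBump ((1 / ((k : ℝ) + 1)) • x) *
      (τ x * rieszPotential (2 * s) τ x)) Filter.atTop (nhds (‖T‖ ^ 2)) := by
    have := (Complex.continuous_re.tendsto _).comp hlim
    refine this.congr fun k => ?_
    rw [Function.comp_apply, ← (hcut _ (hε k)).2, Complex.ofReal_re]
  have hχ : ∀ x : EuclideanSpace ℝ (Fin d), Filter.Tendsto (fun k : ℕ =>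
      radialBump ((1 / ((k : ℝ) + 1)) • x)) Filter.atTop (nhds 1) := by
    intro x
    have h1 := (continuous_radialBump.tendsto ((0 : ℝ) • x)).comp (hε0.smul_const x)
    rwa [zero_smul, radialBump_zero] at h1
  -- The lower bound by -|f| enters here only: the localized identities and their limit hold without
  -- it.
  obtain ⟨h1, h2⟩ := integrable_and_integral_eq_of_tendsto_cutoff hf hTf
    (fun k => (contDiff_radialBump_smul (1 / ((k : ℝ) + 1))).continuous.aestronglyMeasurable)
    (fun k x => radialBump_nonneg _) (fun k x => radialBump_le_one _) hχ
    (fun k => (hcut _ (hε k)).1) hlim'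
  simp only [mul_comm (τ _)] at h1 h2
  exact ⟨h1, h2.symm⟩
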